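/- Let $K$ be a field of characteristic $0$. All algebras are $\mathbb Z$-graded, associative, graded-commutative and not necessarily unital $K$-algebras; a differential algebra is such an algebra with a derivation $d$ of degree $+1$ and $d^2=0$, and $A[t,dt]=A\otimes_K K[t,dt]$, where $K[t,dt]$ is the de Rham algebra of polynomial forms on the line. A complete quasismooth differential algebra is a differential algebra $(R,d)$ which, as a graded algebra, is the inverse limit $\varprojlim_n \bigoplus_{i=1}^{n} \odot^i V$ for some graded vector space $V$ (possibly infinite-dimensional), where $\odot^i V$ is the $i$-th graded-symmetric power. Here $R^{n}$ denotes the kernel of the projection $R\to\bigoplus_{i=1}^{n-1}\odot^i V$ (the closed $n$-th power of $R$), and $d$ is required to satisfy $d(R^n)\subset R^n$ for all $n$, so that each $R/R^n$ is a differential algebra. $R$ is minimal if $d(R)\subset R^2$. A morphism $f:S\to R$ of complete quasismooth differential algebras is a morphism of differential algebras which is continuous (for every $n$ there is $m$ with $f(S^m)\subset R^n$). For a complete quasismooth $S$ and a differential algebra $B$, a homotopy between two morphisms $f,g:S\to B$ is a morphism of differential algebras $H:S\to B[t,dt]$ which vanishes on some $S^m$ and satisfies $H|_{t=0,\,dt=0}=f$,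 $H|_{t=1,\,dt=0}=g$; homotopy equivalence of morphisms is the equivalence relation generated by homotopy. Two morphisms $f,g:S\to R$ of complete quasismooth differential algebras are prohomotopy equivalent if for every $n$ the compositions $f_n,g_n:S\to R\to R/R^n$ are homotopy equivalent. Two complete quasismooth differential algebras $S,R$ are prohomotopy equivalent if there are morphisms $f:S\to R$ and $g:R\to S$ such that $gf$ is prohomotopy equivalent to $\mathrm{id}_S$ and $fg$ is prohomotopy equivalent to $\mathrm{id}_R$. They are isomorphic if there are morphisms $f:S\to R$ and $g:R\to S$ with $gf=\mathrm{id}_S$ and $fg=\mathrm{id}_R$. **Theorem 4.2.** Every complete quasismooth differential algebra is prohomotopy equivalent to a minimal complete quasismooth differential algebra. Two minimal complete quasismooth differential algebras are prohomotopy equivalent if and only if they are isomorphic. -/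

import Mathlib

open scoped TensorProduct Polynomial

universe u

noncomputable section

namespace QuasiSmooth

/-! ## A criterion for internal gradings -/

theorem isInternal_of_proj {K M : Type*} [Field K] [AddCommGroup M] [Module K M]
    (gr : ℤ → Submodule K M) (π : ℤ → M →ₗ[K] M)
    (hsame : ∀ i, ∀ x ∈ gr i, π i x = x)
    (hne : ∀ i j, i ≠ j → ∀ x ∈ gr i, π j x = 0)
    (htop : iSup gr = ⊤) : DirectSum.IsInternal gr := by
  rw [DirectSum.isInternal_submodule_iff_iSupIndep_and_iSup_eq_top]
  refine ⟨?_, htop⟩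
  rw [iSupIndep_def]
  intro i
  rw [Submodule.disjoint_def]
  intro x hx hx'
  have hker : (⨆ j, ⨆ (_ : j ≠ i), gr j) ≤ LinearMap.ker (π i) := by
    refine iSup_le fun j => iSup_le fun hj => ?_
    intro y hy
    exact hne j i hj y hy
  have h0 : π i x = 0 := hker hx'
  rw [← hsame i x hx, h0]

/-! ## Graded vector spaces and their graded symmetric algebras -/

/-- A `ℤ`-graded vector space over `K`. -/
structure GradedSpace (K : Type u) [Field K] where
  carrier : Type u
  [addCommGroup : AddCommGroup carrier]
  [module : Module K carrier]
  /-- the homogeneous pieces -/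
  gr : ℤ → Submodule K carrier
  isInternal : DirectSum.IsInternal gr

attribute [instance] GradedSpace.addCommGroup GradedSpace.module

namespace GradedSpace

variable {K : Type u} [Field K]

/-- The Koszul commutation relation `v w = (-1)^{ij} w v` for `v`, `w` of degrees `i`, `j`. -/
inductive SymRel (V : GradedSpace K) :
    TensorAlgebra K V.carrier → TensorAlgebra K V.carrier → Prop
  | swap (i j : ℤ) (v w : V.carrier) (hv : v ∈ V.gr i) (hw : w ∈ V.gr j) :
      SymRel V (TensorAlgebra.ι K v * TensorAlgebra.ι K w)
        ((i * j).negOnePow • (TensorAlgebra.ι K w * TensorAlgebra.ι K v))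

/-- The free (unital) graded-commutative algebra `⨁ₙ ⊙ⁿ V`: the tensor algebra modulo the
Koszul commutation relation. -/
def Sym (V : GradedSpace K) : Type u := RingQuot (SymRel V)

instance (V : GradedSpace K) : Ring V.Sym := inferInstanceAs (Ring (RingQuot (SymRel V)))

instance (V : GradedSpace K) : Algebra K V.Sym :=
  inferInstanceAs (Algebra K (RingQuot (SymRel V)))

/-- The inclusion `V = ⊙¹ V → ⨁ₙ ⊙ⁿ V`. -/
def symι (V : GradedSpace K) : V.carrier →ₗ[K] V.Sym :=
  (RingQuot.mkAlgHom K (SymRel V)).toLinearMap ∘ₗ TensorAlgebra.ι K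

/-- The degree `k` part of `⊙ⁿ V`: the span of the products `v₁ ⋯ vₙ` of `n` homogeneous
elements whose degrees add up to `k`. -/
def symPiece (V : GradedSpace K) (n : ℕ) (k : ℤ) : Submodule K V.Sym :=
  Submodule.span K {x | ∃ (e : Fin n → ℤ) (v : Fin n → V.carrier),
    (∀ a, v a ∈ V.gr (e a)) ∧ ∑ a, e a = k ∧ (List.ofFn fun a => V.symι (v a)).prod = x}

/-- `v ↦ v Tⁱ` for `v` of degree `i`. -/
def degLin (V : GradedSpace K) : V.carrier →ₗ[K] AddMonoidAlgebra V.Sym ℤ :=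
  letI := V.isInternal.chooseDecomposition
  DirectSum.toModule K ℤ _
    (fun i => (AddMonoidAlgebra.lsingle (R := K) (S := V.Sym) i) ∘ₗ V.symι ∘ₗ (V.gr i).subtype) ∘ₗ
    (DirectSum.decomposeLinearEquiv V.gr).toLinearMap

theorem degLin_of_mem (V : GradedSpace K) {i : ℤ} {v : V.carrier} (hv : v ∈ V.gr i) :
    V.degLin v = AddMonoidAlgebra.single i (V.symι v) := by
  let _ := V.isInternal.chooseDecomposition
  simp only [degLin, LinearMap.comp_apply, LinearEquiv.coe_coe,
    DirectSum.decomposeLinearEquiv_apply]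
  rw [DirectSum.decompose_of_mem V.gr hv]
  exact (DirectSum.toModule_lof K i _).trans rfl

theorem symι_comm (V : GradedSpace K) {i j : ℤ} {v w : V.carrier} (hv : v ∈ V.gr i)
    (hw : w ∈ V.gr j) :
    V.symι v * V.symι w = (i * j).negOnePow • (V.symι w * V.symι v) := by
  have h := RingQuot.mkAlgHom_rel K (SymRel.swap i j v w hv hw)
  rw [map_mul, Units.smul_def, map_zsmul, map_mul] at h
  rw [Units.smul_def]
  exact h

/-- The coaction `x ↦ x Tᵏ` for `x` of degree `k`. -/
def degHom (V : GradedSpace K) : V.Sym →ₐ[K] AddMonoidAlgebra V.Sym ℤ :=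
  RingQuot.liftAlgHom K (s := SymRel V) ⟨TensorAlgebra.lift K V.degLin, by
    rintro _ _ ⟨i, j, v, w, hv, hw⟩
    rw [Units.smul_def, map_zsmul, map_mul, map_mul, TensorAlgebra.lift_ι_apply,
      TensorAlgebra.lift_ι_apply, V.degLin_of_mem hv, V.degLin_of_mem hw,
      AddMonoidAlgebra.single_mul_single, AddMonoidAlgebra.single_mul_single, V.symι_comm hv hw,
      add_comm j i, Units.smul_def, AddMonoidAlgebra.smul_single]⟩

theorem degHom_symι (V : GradedSpace K) {i : ℤ} {v : V.carrier} (hv : v ∈ V.gr i) :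
    V.degHom (V.symι v) = AddMonoidAlgebra.single i (V.symι v) := by
  rw [← V.degLin_of_mem hv]
  exact (RingQuot.liftAlgHom_mkAlgHom_apply K _ _ _).trans (TensorAlgebra.lift_ι_apply _ _)

theorem degHom_of_mem (V : GradedSpace K) {n : ℕ} {k : ℤ} {x : V.Sym}
    (hx : x ∈ V.symPiece n k) : V.degHom x = AddMonoidAlgebra.single k x := by
  induction hx using Submodule.span_induction with
  | zero => simp
  | add x y _ _ hx hy => rw [map_add, hx, hy, AddMonoidAlgebra.single_add]
  | smul c x _ hx => rw [map_smul, hx, AddMonoidAlgebra.smul_single]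
  | mem x hx =>
    obtain ⟨e, v, hv, rfl, rfl⟩ := hx
    induction n with
    | zero =>
      rw [List.ofFn_zero, List.prod_nil, map_one, Finset.univ_eq_empty, Finset.sum_empty]
      rfl
    | succ n ih =>
      rw [List.ofFn_succ, List.prod_cons, map_mul, V.degHom_symι (hv 0),
        ih (fun a => e a.succ) (fun a => v a.succ) (fun a => hv a.succ),
        AddMonoidAlgebra.single_mul_single, Fin.sum_univ_succ]

/-- The projection of the graded symmetric algebra onto its part of degree `k`. -/
def degProj (V : GradedSpace K) (k : ℤ) : V.Sym →+ V.Sym where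
  toFun x := (V.degHom x).coeff k
  map_zero' := by simp
  map_add' x y := by simp

theorem degProj_same (V : GradedSpace K) {n : ℕ} {k : ℤ} {x : V.Sym}
    (hx : x ∈ V.symPiece n k) : V.degProj k x = x := by
  change (V.degHom x).coeff k = x
  rw [V.degHom_of_mem hx]
  exact Finsupp.single_eq_same

theorem degProj_ne (V : GradedSpace K) {n : ℕ} {k l : ℤ} (h : k ≠ l) {x : V.Sym}
    (hx : x ∈ V.symPiece n k) : V.degProj l x = 0 := by
  change (V.degHom x).coeff l = 0
  rw [V.degHom_of_mem hx]
  exact Finsupp.single_eq_of_ne (Ne.symm h)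

end GradedSpace

/-! ## Differential graded algebras -/

/-- A dg-algebra: a `ℤ`-graded, associative, graded-commutative, not necessarily unital
`K`-algebra with a square-zero derivation `d` of degree `1`. -/
structure DGAlg (K : Type u) [Field K] where
  carrier : Type u
  [ring : NonUnitalRing carrier]
  [module : Module K carrier]
  [smulComm : SMulCommClass K carrier carrier]
  [scalarTower : IsScalarTower K carrier carrier]
  /-- the homogeneous pieces -/
  gr : ℤ → Submodule K carrier
  isInternal : DirectSum.IsInternal gr
  mul_mem : ∀ {i j : ℤ} {a b : carrier}, a ∈ gr i → b ∈ gr j → a * b ∈ gr (i + j)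
  comm : ∀ {i j : ℤ} {a b : carrier}, a ∈ gr i → b ∈ gr j →
    a * b = (i * j).negOnePow • (b * a)
  /-- the differential -/
  d : carrier →ₗ[K] carrier
  d_mem : ∀ {i : ℤ} {a : carrier}, a ∈ gr i → d a ∈ gr (i + 1)
  d_d : ∀ a, d (d a) = 0
  leibniz : ∀ {i : ℤ} {a : carrier}, a ∈ gr i → ∀ b,
    d (a * b) = d a * b + i.negOnePow • (a * d b)

attribute [instance] DGAlg.ring DGAlg.module DGAlg.smulComm DGAlg.scalarTower

namespace DGAlg

variable {K : Type u} [Field K]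

/-- A morphism of dg-algebras. -/
@[ext]
structure Hom (A B : DGAlg K) where
  toLin : A.carrier →ₗ[K] B.carrier
  map_mul : ∀ a b, toLin (a * b) = toLin a * toLin b
  map_mem : ∀ {i : ℤ} {a : A.carrier}, a ∈ A.gr i → toLin a ∈ B.gr i
  map_d : ∀ a, toLin (A.d a) = B.d (toLin a)

namespace Hom

/-- The identity morphism. -/
def id (A : DGAlg K) : Hom A A where
  toLin := LinearMap.id
  map_mul _ _ := rfl
  map_mem h := h
  map_d _ := rfl

/-- Composition of morphisms: first `f`, then `g`. -/
def comp {A B C : DGAlg K} (g : Hom B C) (f : Hom A B) : Hom A C where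
  toLin := g.toLin ∘ₗ f.toLin
  map_mul a b := by simp [f.map_mul, g.map_mul]
  map_mem h := g.map_mem (f.map_mem h)
  map_d a := by simp [f.map_d, g.map_d]

end Hom

/-- The homogeneous component of degree `k` of an element. -/
def component (A : DGAlg K) (k : ℤ) : A.carrier →ₗ[K] A.carrier :=
  letI := A.isInternal.chooseDecomposition
  (A.gr k).subtype ∘ₗ DirectSum.component K ℤ (fun i => A.gr i) k ∘ₗ
    (DirectSum.decomposeLinearEquiv A.gr).toLinearMap

theorem component_mem (A : DGAlg K) (k : ℤ) (a : A.carrier) : A.component k a ∈ A.gr k := by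
  simp [component]

theorem component_same (A : DGAlg K) {k : ℤ} {a : A.carrier} (h : a ∈ A.gr k) :
    A.component k a = a := by
  let _ := A.isInternal.chooseDecomposition
  exact DirectSum.decompose_of_mem_same A.gr h

theorem component_ne (A : DGAlg K) {k l : ℤ} (hkl : k ≠ l) {a : A.carrier} (h : a ∈ A.gr k) :
    A.component l a = 0 := by
  let _ := A.isInternal.chooseDecomposition
  exact DirectSum.decompose_of_mem_ne A.gr h hkl

theorem iSup_gr (A : DGAlg K) : iSup A.gr = ⊤ := A.isInternal.submodule_iSup_eq_top

theorem homog_induction (A : DGAlg K) {P : A.carrier → Prop}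
    (mem : ∀ i, ∀ a ∈ A.gr i, P a) (zero : P 0) (add : ∀ a b, P a → P b → P (a + b))
    (a : A.carrier) : P a := by
  have ha : a ∈ iSup A.gr := by rw [A.iSup_gr]; trivial
  induction ha using Submodule.iSup_induction' with
  | mem i x hx => exact mem i x hx
  | zero => exact zero
  | add x y _ _ hx hy => exact add x y hx hy

/-! ### Quotients by homogeneous differential ideals -/

/-- A homogeneous differential (two-sided) ideal. -/
structure DGIdeal (A : DGAlg K) where
  sub : Submodule K A.carrier
  mul_left : ∀ a, ∀ x ∈ sub, a * x ∈ sub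
  mul_right : ∀ a, ∀ x ∈ sub, x * a ∈ sub
  d_mem : ∀ x ∈ sub, A.d x ∈ sub
  component_mem : ∀ k, ∀ x ∈ sub, A.component k x ∈ sub

/-- The underlying space of the quotient `A / I`. -/
def QuotCarrier (A : DGAlg K) (I : A.DGIdeal) : Type u := A.carrier ⧸ I.sub

section Quot

variable (A : DGAlg K) (I : A.DGIdeal)

instance : AddCommGroup (A.QuotCarrier I) := inferInstanceAs (AddCommGroup (A.carrier ⧸ I.sub))

instance : Module K (A.QuotCarrier I) := inferInstanceAs (Module K (A.carrier ⧸ I.sub))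

/-- The projection `A → A / I`. -/
def quotMk : A.carrier →ₗ[K] A.QuotCarrier I := I.sub.mkQ

theorem quotMk_surjective : Function.Surjective (A.quotMk I) := I.sub.mkQ_surjective

variable {A I} in
theorem quotMk_eq {a b : A.carrier} : A.quotMk I a = A.quotMk I b ↔ a - b ∈ I.sub :=
  Submodule.Quotient.eq I.sub

instance : Mul (A.QuotCarrier I) where
  mul := Quotient.map₂ (fun a b : A.carrier => a * b) (by
    intro a a' ha b b' hb
    have ha' : a - a' ∈ I.sub := (Submodule.quotientRel_def I.sub).1 ha
    have hb' : b - b' ∈ I.sub := (Submodule.quotientRel_def I.sub).1 hb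
    refine (Submodule.quotientRel_def I.sub).2 ?_
    have h : a * b - a' * b' = (a - a') * b + a' * (b - b') := by
      rw [sub_mul, mul_sub]; abel
    rw [h]
    exact I.sub.add_mem (I.mul_right b _ ha') (I.mul_left a' _ hb'))

theorem quotMk_mul (a b : A.carrier) : A.quotMk I (a * b) = A.quotMk I a * A.quotMk I b := rfl

instance : NonUnitalRing (A.QuotCarrier I) where
  __ := (inferInstance : AddCommGroup (A.QuotCarrier I))
  mul := (· * ·)
  left_distrib x y z := by
    obtain ⟨a, rfl⟩ := A.quotMk_surjective I x
    obtain ⟨b, rfl⟩ := A.quotMk_surjective I y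
    obtain ⟨c, rfl⟩ := A.quotMk_surjective I z
    change A.quotMk I a * (A.quotMk I b + A.quotMk I c) =
      A.quotMk I a * A.quotMk I b + A.quotMk I a * A.quotMk I c
    rw [← map_add, ← quotMk_mul, ← quotMk_mul, ← quotMk_mul, ← map_add, mul_add]
  right_distrib x y z := by
    obtain ⟨a, rfl⟩ := A.quotMk_surjective I x
    obtain ⟨b, rfl⟩ := A.quotMk_surjective I y
    obtain ⟨c, rfl⟩ := A.quotMk_surjective I z
    change (A.quotMk I a + A.quotMk I b) * A.quotMk I c =
      A.quotMk I a * A.quotMk I c + A.quotMk I b * A.quotMk I c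
    rw [← map_add, ← quotMk_mul, ← quotMk_mul, ← quotMk_mul, ← map_add, add_mul]
  zero_mul x := by
    obtain ⟨a, rfl⟩ := A.quotMk_surjective I x
    change A.quotMk I (0 * a) = A.quotMk I 0
    rw [zero_mul]
  mul_zero x := by
    obtain ⟨a, rfl⟩ := A.quotMk_surjective I x
    change A.quotMk I (a * 0) = A.quotMk I 0
    rw [mul_zero]
  mul_assoc x y z := by
    obtain ⟨a, rfl⟩ := A.quotMk_surjective I x
    obtain ⟨b, rfl⟩ := A.quotMk_surjective I y
    obtain ⟨c, rfl⟩ := A.quotMk_surjective I z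
    change A.quotMk I (a * b * c) = A.quotMk I (a * (b * c))
    rw [mul_assoc]

instance : SMulCommClass K (A.QuotCarrier I) (A.QuotCarrier I) where
  smul_comm s x y := by
    obtain ⟨a, rfl⟩ := A.quotMk_surjective I x
    obtain ⟨b, rfl⟩ := A.quotMk_surjective I y
    change A.quotMk I (s • (a * b)) = A.quotMk I (a * s • b)
    rw [mul_smul_comm]

instance : IsScalarTower K (A.QuotCarrier I) (A.QuotCarrier I) where
  smul_assoc s x y := by
    obtain ⟨a, rfl⟩ := A.quotMk_surjective I x
    obtain ⟨b, rfl⟩ := A.quotMk_surjective I y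
    change A.quotMk I (s • a * b) = A.quotMk I (s • (a * b))
    rw [smul_mul_assoc]

/-- The linear map of quotients induced by a linear map preserving the ideal. -/
def quotMap (f : A.carrier →ₗ[K] A.carrier) (hf : ∀ x ∈ I.sub, f x ∈ I.sub) :
    A.QuotCarrier I →ₗ[K] A.QuotCarrier I :=
  I.sub.mapQ I.sub f hf

theorem quotMap_mk (f : A.carrier →ₗ[K] A.carrier) (hf : ∀ x ∈ I.sub, f x ∈ I.sub)
    (a : A.carrier) : A.quotMap I f hf (A.quotMk I a) = A.quotMk I (f a) := rfl

/-- The quotient dg-algebra `A / I`. -/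
def quot : DGAlg K where
  carrier := A.QuotCarrier I
  gr k := (A.gr k).map (A.quotMk I)
  isInternal := by
    refine isInternal_of_proj _ (fun k => A.quotMap I (A.component k) (I.component_mem k)) ?_ ?_ ?_
    · rintro i _ ⟨a, ha, rfl⟩
      rw [quotMap_mk, A.component_same ha]
    · rintro i j hij _ ⟨a, ha, rfl⟩
      rw [quotMap_mk, A.component_ne hij ha, map_zero]
    · rw [← Submodule.map_iSup, A.iSup_gr, Submodule.map_top, LinearMap.range_eq_top]
      exact A.quotMk_surjective I
  mul_mem := by
    rintro i j _ _ ⟨a, ha, rfl⟩ ⟨b, hb, rfl⟩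
    exact ⟨a * b, A.mul_mem ha hb, rfl⟩
  comm := by
    rintro i j _ _ ⟨a, ha, rfl⟩ ⟨b, hb, rfl⟩
    rw [← quotMk_mul, ← quotMk_mul, A.comm ha hb, Units.smul_def, Units.smul_def, map_zsmul]
  d := A.quotMap I A.d I.d_mem
  d_mem := by
    rintro i _ ⟨a, ha, rfl⟩
    exact ⟨A.d a, A.d_mem ha, rfl⟩
  d_d x := by
    obtain ⟨a, rfl⟩ := A.quotMk_surjective I x
    rw [quotMap_mk, quotMap_mk, A.d_d, map_zero]
  leibniz := by
    rintro i _ ⟨a, ha, rfl⟩ y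
    obtain ⟨b, rfl⟩ := A.quotMk_surjective I y
    rw [← quotMk_mul, quotMap_mk, quotMap_mk, quotMap_mk, ← quotMk_mul, ← quotMk_mul,
      A.leibniz ha, map_add, Units.smul_def, Units.smul_def, map_zsmul]

/-- The projection `A → A / I` as a morphism of dg-algebras. -/
def quotHom : Hom A (A.quot I) where
  toLin := A.quotMk I
  map_mul _ _ := rfl
  map_mem h := ⟨_, h, rfl⟩
  map_d _ := rfl

end Quot

/-! ### Polynomial forms `A[t, dt] = A ⊗ K[t, dt]` -/

/-- The sign operator `a ↦ (-1)^{deg a} a`. -/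
def sgn (A : DGAlg K) : A.carrier →ₗ[K] A.carrier :=
  letI := A.isInternal.chooseDecomposition
  DirectSum.toModule K ℤ _ (fun i => (i.negOnePow : ℤ) • (A.gr i).subtype) ∘ₗ
    (DirectSum.decomposeLinearEquiv A.gr).toLinearMap

theorem sgn_of_mem (A : DGAlg K) {i : ℤ} {a : A.carrier} (ha : a ∈ A.gr i) :
    A.sgn a = i.negOnePow • a := by
  let _ := A.isInternal.chooseDecomposition
  simp only [sgn, LinearMap.comp_apply, LinearEquiv.coe_coe,
    DirectSum.decomposeLinearEquiv_apply]
  rw [DirectSum.decompose_of_mem A.gr ha]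
  exact (DirectSum.toModule_lof K i _).trans rfl

theorem sgn_mem (A : DGAlg K) {i : ℤ} {a : A.carrier} (ha : a ∈ A.gr i) : A.sgn a ∈ A.gr i := by
  rw [A.sgn_of_mem ha, Units.smul_def]
  exact zsmul_mem ha _

theorem sgn_mul (A : DGAlg K) (a b : A.carrier) : A.sgn (a * b) = A.sgn a * A.sgn b := by
  induction a using A.homog_induction with
  | zero => simp
  | add a a' h h' => rw [add_mul, map_add, map_add, add_mul, h, h']
  | mem i a ha =>
    induction b using A.homog_induction with
    | zero => simp
    | add b b' h h' => rw [mul_add, map_add, map_add, mul_add, h, h']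
    | mem j b hb =>
      rw [A.sgn_of_mem ha, A.sgn_of_mem hb, A.sgn_of_mem (A.mul_mem ha hb), Int.negOnePow_add,
        Units.smul_def, Units.smul_def, Units.smul_def, smul_mul_smul_comm, Units.val_mul]

theorem d_sgn (A : DGAlg K) (a : A.carrier) : A.d (A.sgn a) = -A.sgn (A.d a) := by
  induction a using A.homog_induction with
  | zero => simp
  | add a a' h h' => simp only [map_add, h, h', neg_add]
  | mem i a ha =>
    rw [A.sgn_of_mem ha, A.sgn_of_mem (A.d_mem ha), Int.negOnePow_succ, Units.smul_def,
      Units.smul_def, map_zsmul, Units.val_neg, neg_smul, neg_neg]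

theorem leibniz_sgn (A : DGAlg K) (a b : A.carrier) :
    A.d (a * b) = A.d a * b + A.sgn a * A.d b := by
  induction a using A.homog_induction with
  | zero => simp
  | add a a' h h' => simp only [add_mul, map_add, h, h']; abel
  | mem i a ha =>
    rw [A.leibniz ha, A.sgn_of_mem ha, Units.smul_def, Units.smul_def, smul_mul_assoc]

/-- `A[t]`, with its usual multiplication (`t` is central of degree `0`). -/
abbrev Poly (A : DGAlg K) : Type u := K[X] ⊗[K] A.carrier

section Poly

variable (A : DGAlg K)

/-- The degree `i` part `Aᵢ[t]` of `A[t]`. -/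
def polyGr (i : ℤ) : Submodule K A.Poly :=
  Submodule.span K {x | ∃ (p : K[X]) (a : A.carrier), a ∈ A.gr i ∧ p ⊗ₜ[K] a = x}

/-- Coefficientwise application of a linear map. -/
def polyMap (f : A.carrier →ₗ[K] A.carrier) : A.Poly →ₗ[K] A.Poly := f.lTensor K[X]

/-- The derivative `∂/∂t` on `A[t]`. -/
def polyDeriv : A.Poly →ₗ[K] A.Poly :=
  LinearMap.rTensor A.carrier (Polynomial.derivative (R := K))

theorem polyMap_tmul (f : A.carrier →ₗ[K] A.carrier) (p : K[X]) (a : A.carrier) :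
    A.polyMap f (p ⊗ₜ a) = p ⊗ₜ f a := rfl

theorem polyDeriv_tmul (p : K[X]) (a : A.carrier) :
    A.polyDeriv (p ⊗ₜ a) = Polynomial.derivative p ⊗ₜ a := rfl

theorem poly_mul_tmul (p q : K[X]) (a b : A.carrier) :
    ((p ⊗ₜ[K] a : A.Poly) * (q ⊗ₜ[K] b : A.Poly) : A.Poly) = (p * q) ⊗ₜ[K] (a * b) :=
  Algebra.TensorProduct.tmul_mul_tmul p q a b

theorem tmul_mem_polyGr {i : ℤ} (p : K[X]) {a : A.carrier} (ha : a ∈ A.gr i) :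
    (p ⊗ₜ[K] a : A.Poly) ∈ A.polyGr i := Submodule.subset_span ⟨p, a, ha, rfl⟩

theorem polyMap_mem {i j : ℤ} {f : A.carrier →ₗ[K] A.carrier}
    (hf : ∀ a ∈ A.gr i, f a ∈ A.gr j) {x : A.Poly} (hx : x ∈ A.polyGr i) :
    A.polyMap f x ∈ A.polyGr j := by
  induction hx using Submodule.span_induction with
  | zero => rw [map_zero]; exact Submodule.zero_mem _
  | add x y _ _ hx hy => rw [map_add]; exact Submodule.add_mem _ hx hy
  | smul c x _ hx => rw [map_smul]; exact Submodule.smul_mem _ c hx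
  | mem x hx =>
    obtain ⟨p, a, ha, rfl⟩ := hx
    exact A.tmul_mem_polyGr p (hf a ha)

theorem polyDeriv_mem {i : ℤ} {x : A.Poly} (hx : x ∈ A.polyGr i) :
    A.polyDeriv x ∈ A.polyGr i := by
  induction hx using Submodule.span_induction with
  | zero => rw [map_zero]; exact Submodule.zero_mem _
  | add x y _ _ hx hy => rw [map_add]; exact Submodule.add_mem _ hx hy
  | smul c x _ hx => rw [map_smul]; exact Submodule.smul_mem _ c hx
  | mem x hx =>
    obtain ⟨p, a, ha, rfl⟩ := hx
    exact A.tmul_mem_polyGr _ ha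

theorem polyMap_eq_of_mem {i : ℤ} {f g : A.carrier →ₗ[K] A.carrier}
    (h : ∀ a ∈ A.gr i, f a = g a) {x : A.Poly} (hx : x ∈ A.polyGr i) :
    A.polyMap f x = A.polyMap g x := by
  induction hx using Submodule.span_induction with
  | zero => rw [map_zero, map_zero]
  | add x y _ _ hx hy => rw [map_add, map_add, hx, hy]
  | smul c x _ hx => rw [map_smul, map_smul, hx]
  | mem x hx =>
    obtain ⟨p, a, ha, rfl⟩ := hx
    rw [polyMap_tmul, polyMap_tmul, h a ha]

theorem polyMap_id (x : A.Poly) : A.polyMap LinearMap.id x = x :=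
  LinearMap.lTensor_id_apply _ _ x

theorem polyMap_zero (x : A.Poly) : A.polyMap 0 x = 0 := by
  simp [polyMap]

theorem poly_sgn_of_mem {i : ℤ} {x : A.Poly} (hx : x ∈ A.polyGr i) :
    A.polyMap A.sgn x = i.negOnePow • x := by
  induction hx using Submodule.span_induction with
  | zero => rw [map_zero, smul_zero]
  | add x y _ _ hx hy => rw [map_add, hx, hy, smul_add]
  | smul c x _ hx => rw [map_smul, hx, Units.smul_def, Units.smul_def, smul_comm]
  | mem x hx =>
    obtain ⟨p, a, ha, rfl⟩ := hx
    rw [polyMap_tmul, A.sgn_of_mem ha, Units.smul_def, Units.smul_def,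
      TensorProduct.tmul_smul]

theorem poly_sgn_mul (x y : A.Poly) :
    A.polyMap A.sgn (x * y) = A.polyMap A.sgn x * A.polyMap A.sgn y := by
  induction x using TensorProduct.induction_on with
  | zero => simp
  | add x x' h h' => rw [add_mul, map_add, map_add, add_mul, h, h']
  | tmul p a =>
    induction y using TensorProduct.induction_on with
    | zero => simp
    | add y y' h h' => rw [mul_add, map_add, map_add, mul_add, h, h']
    | tmul q b =>
      rw [poly_mul_tmul, polyMap_tmul, polyMap_tmul, polyMap_tmul, poly_mul_tmul, A.sgn_mul]

theorem poly_d_mul (x y : A.Poly) :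
    A.polyMap A.d (x * y) = A.polyMap A.d x * y + A.polyMap A.sgn x * A.polyMap A.d y := by
  induction x using TensorProduct.induction_on with
  | zero => simp
  | add x x' h h' => simp only [add_mul, map_add, h, h']; abel
  | tmul p a =>
    induction y using TensorProduct.induction_on with
    | zero => simp
    | add y y' h h' => simp only [mul_add, map_add, h, h']; abel
    | tmul q b =>
      simp only [poly_mul_tmul, polyMap_tmul, A.leibniz_sgn, TensorProduct.tmul_add]

theorem polyDeriv_mul (x y : A.Poly) :
    A.polyDeriv (x * y) = A.polyDeriv x * y + x * A.polyDeriv y := by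
  induction x using TensorProduct.induction_on with
  | zero => simp
  | add x x' h h' => simp only [add_mul, map_add, h, h']; abel
  | tmul p a =>
    induction y using TensorProduct.induction_on with
    | zero => simp
    | add y y' h h' => simp only [mul_add, map_add, h, h']; abel
    | tmul q b =>
      simp only [poly_mul_tmul, polyDeriv_tmul, Polynomial.derivative_mul,
        TensorProduct.add_tmul]

theorem poly_d_d (x : A.Poly) : A.polyMap A.d (A.polyMap A.d x) = 0 := by
  induction x using TensorProduct.induction_on with
  | zero => simp
  | add x x' h h' => rw [map_add, map_add, h, h', add_zero]
  | tmul p a => rw [polyMap_tmul, polyMap_tmul, A.d_d, TensorProduct.tmul_zero]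

theorem poly_d_sgn (x : A.Poly) :
    A.polyMap A.d (A.polyMap A.sgn x) = -A.polyMap A.sgn (A.polyMap A.d x) := by
  induction x using TensorProduct.induction_on with
  | zero => simp
  | add x x' h h' => simp only [map_add, h, h', neg_add]
  | tmul p a => simp only [polyMap_tmul, A.d_sgn, TensorProduct.tmul_neg]

theorem polyDeriv_polyMap (f : A.carrier →ₗ[K] A.carrier) (x : A.Poly) :
    A.polyDeriv (A.polyMap f x) = A.polyMap f (A.polyDeriv x) := by
  induction x using TensorProduct.induction_on with
  | zero => simp
  | add x x' h h' => simp only [map_add, h, h']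
  | tmul p a => rfl

theorem poly_mul_mem {i j : ℤ} {x y : A.Poly} (hx : x ∈ A.polyGr i) (hy : y ∈ A.polyGr j) :
    x * y ∈ A.polyGr (i + j) := by
  induction hx using Submodule.span_induction with
  | zero => rw [zero_mul]; exact Submodule.zero_mem _
  | add x x' _ _ h h' => rw [add_mul]; exact Submodule.add_mem _ h h'
  | smul c x _ h => rw [smul_mul_assoc]; exact Submodule.smul_mem _ c h
  | mem x hx =>
    obtain ⟨p, a, ha, rfl⟩ := hx
    induction hy using Submodule.span_induction with
    | zero => rw [mul_zero]; exact Submodule.zero_mem _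
    | add x x' _ _ h h' => rw [mul_add]; exact Submodule.add_mem _ h h'
    | smul c x _ h => rw [mul_smul_comm]; exact Submodule.smul_mem _ c h
    | mem x hx =>
      obtain ⟨q, b, hb, rfl⟩ := hx
      rw [poly_mul_tmul]
      exact A.tmul_mem_polyGr _ (A.mul_mem ha hb)

theorem poly_comm {i j : ℤ} {x y : A.Poly} (hx : x ∈ A.polyGr i) (hy : y ∈ A.polyGr j) :
    x * y = (i * j).negOnePow • (y * x) := by
  rw [Units.smul_def]
  induction hx using Submodule.span_induction with
  | zero => rw [zero_mul, mul_zero, smul_zero]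
  | add x x' _ _ h h' => rw [add_mul, mul_add, smul_add, h, h']
  | smul c x _ h => rw [smul_mul_assoc, mul_smul_comm, h, smul_comm]
  | mem x hx =>
    obtain ⟨p, a, ha, rfl⟩ := hx
    induction hy using Submodule.span_induction with
    | zero => rw [zero_mul, mul_zero, smul_zero]
    | add x x' _ _ h h' => rw [add_mul, mul_add, smul_add, h, h']
    | smul c x _ h => rw [smul_mul_assoc, mul_smul_comm, h, smul_comm]
    | mem x hx =>
      obtain ⟨q, b, hb, rfl⟩ := hx
      rw [poly_mul_tmul, poly_mul_tmul, A.comm ha hb, mul_comm q p, Units.smul_def,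
        TensorProduct.tmul_smul]

theorem poly_mul_neg (x y : A.Poly) : x * -y = -(x * y) :=
  map_neg (AddMonoidHom.mulLeft x) y

theorem poly_neg_mul (x y : A.Poly) : -x * y = -(x * y) :=
  map_neg (AddMonoidHom.mulRight y) x

theorem poly_mul_zsmul (n : ℤ) (x y : A.Poly) : x * n • y = n • (x * y) :=
  map_zsmul (AddMonoidHom.mulLeft x) n y

theorem poly_zsmul_mul (n : ℤ) (x y : A.Poly) : n • x * y = n • (x * y) :=
  map_zsmul (AddMonoidHom.mulRight y) n x

theorem iSup_polyGr : iSup A.polyGr = ⊤ := by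
  rw [eq_top_iff]
  rintro x -
  induction x using TensorProduct.induction_on with
  | zero => exact Submodule.zero_mem _
  | add x y hx hy => exact Submodule.add_mem _ hx hy
  | tmul p a =>
    induction a using A.homog_induction with
    | zero => rw [TensorProduct.tmul_zero]; exact Submodule.zero_mem _
    | add a b ha hb => rw [TensorProduct.tmul_add]; exact Submodule.add_mem _ ha hb
    | mem i a ha => exact Submodule.mem_iSup_of_mem i (A.tmul_mem_polyGr p ha)

end Poly

/-- The underlying space `A[t] ⊕ A[t] dt` of `A[t, dt]`; the pair `(p, q)` stands for
`p + q dt`. -/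
def Forms (A : DGAlg K) : Type u := A.Poly × A.Poly

section Forms

variable (A : DGAlg K)

instance : AddCommGroup A.Forms := inferInstanceAs (AddCommGroup (A.Poly × A.Poly))

instance : Module K A.Forms := inferInstanceAs (Module K (A.Poly × A.Poly))

/-- `(p + q dt)(p' + q' dt) = p p' + (p q' ± q p') dt`, where moving `dt` past `p'` produces the
sign `(-1)^{deg p'}`. -/
instance : Mul A.Forms where
  mul x y := (x.1 * y.1, x.1 * y.2 + x.2 * A.polyMap A.sgn y.1)

variable {A} in
theorem forms_ext {x y : A.Forms} (h₁ : x.1 = y.1) (h₂ : x.2 = y.2) : x = y := Prod.ext h₁ h₂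

theorem forms_mul_fst (x y : A.Forms) : (x * y).1 = x.1 * y.1 := rfl

theorem forms_mul_snd (x y : A.Forms) :
    (x * y).2 = x.1 * y.2 + x.2 * A.polyMap A.sgn y.1 := rfl

theorem forms_add_fst (x y : A.Forms) : (x + y).1 = x.1 + y.1 := rfl

theorem forms_add_snd (x y : A.Forms) : (x + y).2 = x.2 + y.2 := rfl

theorem forms_zero_fst : (0 : A.Forms).1 = 0 := rfl

theorem forms_zero_snd : (0 : A.Forms).2 = 0 := rfl

theorem forms_smul_fst (c : K) (x : A.Forms) : (c • x).1 = c • x.1 := rfl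

theorem forms_smul_snd (c : K) (x : A.Forms) : (c • x).2 = c • x.2 := rfl

theorem forms_zsmul_fst (c : ℤ) (x : A.Forms) : (c • x).1 = c • x.1 := rfl

theorem forms_zsmul_snd (c : ℤ) (x : A.Forms) : (c • x).2 = c • x.2 := rfl

instance : NonUnitalRing A.Forms where
  __ := (inferInstance : AddCommGroup A.Forms)
  mul := (· * ·)
  left_distrib x y z := by
    apply forms_ext
    · simp only [forms_mul_fst, forms_add_fst, mul_add]
    · simp only [forms_mul_snd, forms_add_fst, forms_add_snd, mul_add, map_add]; abel
  right_distrib x y z := by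
    apply forms_ext
    · simp only [forms_mul_fst, forms_add_fst, add_mul]
    · simp only [forms_mul_snd, forms_add_fst, forms_add_snd, add_mul]; abel
  zero_mul x := by
    apply forms_ext
    · simp only [forms_mul_fst, forms_zero_fst, zero_mul]
    · simp only [forms_mul_snd, forms_zero_fst, forms_zero_snd, zero_mul, add_zero]
  mul_zero x := by
    apply forms_ext
    · simp only [forms_mul_fst, forms_zero_fst, mul_zero]
    · simp only [forms_mul_snd, forms_zero_fst, forms_zero_snd, mul_zero, map_zero, add_zero]
  mul_assoc x y z := by
    apply forms_ext
    · simp only [forms_mul_fst, mul_assoc]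
    · simp only [forms_mul_snd, forms_mul_fst, add_mul, mul_add, mul_assoc, poly_sgn_mul,
        add_assoc]

instance : SMulCommClass K A.Forms A.Forms where
  smul_comm c x y := by
    simp only [smul_eq_mul]
    apply forms_ext
    · simp only [forms_mul_fst, forms_smul_fst, mul_smul_comm]
    · simp only [forms_mul_snd, forms_smul_fst, forms_smul_snd, mul_smul_comm, map_smul, smul_add]

instance : IsScalarTower K A.Forms A.Forms where
  smul_assoc c x y := by
    simp only [smul_eq_mul]
    apply forms_ext
    · simp only [forms_mul_fst, forms_smul_fst, smul_mul_assoc]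
    · simp only [forms_mul_snd, forms_smul_fst, forms_smul_snd, smul_mul_assoc, smul_add]

/-- The degree `k` part of `A[t, dt]`: the forms `p + q dt` with `p` of degree `k` and `q` of
degree `k - 1`. -/
def formsGr (k : ℤ) : Submodule K A.Forms := (A.polyGr k).prod (A.polyGr (k - 1))

theorem mem_formsGr {k : ℤ} {x : A.Forms} :
    x ∈ A.formsGr k ↔ x.1 ∈ A.polyGr k ∧ x.2 ∈ A.polyGr (k - 1) := Iff.rfl

/-- The component of degree `k` of a form. -/
def formsComponent (k : ℤ) : A.Forms →ₗ[K] A.Forms :=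
  LinearMap.prodMap (A.polyMap (A.component k)) (A.polyMap (A.component (k - 1)))

/-- `d (p + q dt) = d_A p + (± ∂p/∂t + d_A q) dt`, with the sign `(-1)^{deg p}`; this is the
differential `d (a ⊗ ω) = d a ⊗ ω + (-1)^{deg a} a ⊗ d ω`. -/
def formsD : A.Forms →ₗ[K] A.Forms :=
  LinearMap.prod (A.polyMap A.d ∘ₗ LinearMap.fst K A.Poly A.Poly)
    (A.polyMap A.sgn ∘ₗ A.polyDeriv ∘ₗ LinearMap.fst K A.Poly A.Poly +
      A.polyMap A.d ∘ₗ LinearMap.snd K A.Poly A.Poly)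

theorem formsD_fst (x : A.Forms) : (A.formsD x).1 = A.polyMap A.d x.1 := rfl

theorem formsD_snd (x : A.Forms) :
    (A.formsD x).2 = A.polyMap A.sgn (A.polyDeriv x.1) + A.polyMap A.d x.2 := rfl

theorem formsGr_isInternal : DirectSum.IsInternal A.formsGr := by
  have hs : ∀ i, ∀ x ∈ A.polyGr i, A.polyMap (A.component i) x = x := fun i x hx =>
    (A.polyMap_eq_of_mem (g := LinearMap.id) (fun a ha => A.component_same ha) hx).trans
      (A.polyMap_id x)
  have hn : ∀ i j, i ≠ j → ∀ x ∈ A.polyGr i, A.polyMap (A.component j) x = 0 :=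
    fun i j hij x hx =>
      (A.polyMap_eq_of_mem (g := 0) (fun a ha => A.component_ne hij ha) hx).trans
        (A.polyMap_zero x)
  refine isInternal_of_proj _ A.formsComponent ?_ ?_ ?_
  · intro i x hx
    exact forms_ext (hs _ _ hx.1) (hs _ _ hx.2)
  · intro i j hij x hx
    exact forms_ext (hn _ _ hij _ hx.1) (hn _ _ (fun h => hij (by omega)) _ hx.2)
  · rw [eq_top_iff]
    rintro x -
    have h₁ : iSup A.polyGr ≤ (iSup A.formsGr).comap (LinearMap.inl K A.Poly A.Poly) :=
      iSup_le fun i p hp =>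
        Submodule.mem_iSup_of_mem i (p := A.formsGr) ⟨hp, Submodule.zero_mem _⟩
    have h₂ : iSup A.polyGr ≤ (iSup A.formsGr).comap (LinearMap.inr K A.Poly A.Poly) :=
      iSup_le fun i p hp =>
        Submodule.mem_iSup_of_mem (i + 1) (p := A.formsGr)
          ⟨Submodule.zero_mem _, by rw [add_sub_cancel_right]; exact hp⟩
    have hx : x = LinearMap.inl K A.Poly A.Poly x.1 + LinearMap.inr K A.Poly A.Poly x.2 :=
      forms_ext (add_zero _).symm (zero_add _).symm
    rw [hx]
    refine Submodule.add_mem _ (h₁ ?_) (h₂ ?_) <;> rw [A.iSup_polyGr] <;> trivial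

/-- The dg-algebra `A[t, dt]` of polynomial forms with coefficients in `A`. -/
def forms : DGAlg K where
  carrier := A.Forms
  gr := A.formsGr
  isInternal := A.formsGr_isInternal
  mul_mem := by
    intro i j x y hx hy
    refine ⟨A.poly_mul_mem hx.1 hy.1, ?_⟩
    rw [forms_mul_snd]
    refine Submodule.add_mem _ ?_ ?_
    · rw [add_sub_assoc]
      exact A.poly_mul_mem hx.1 hy.2
    · rw [add_sub_right_comm]
      exact A.poly_mul_mem hx.2 (A.polyMap_mem (fun a ha => A.sgn_mem ha) hy.1)
  comm := by
    intro i j x y hx hy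
    rw [Units.smul_def]
    apply forms_ext
    · rw [forms_zsmul_fst, forms_mul_fst, forms_mul_fst, A.poly_comm hx.1 hy.1, Units.smul_def]
    · rw [forms_zsmul_snd, forms_mul_snd, forms_mul_snd, A.poly_sgn_of_mem hx.1,
        A.poly_sgn_of_mem hy.1, Units.smul_def, Units.smul_def, poly_mul_zsmul, poly_mul_zsmul,
        A.poly_comm hx.1 hy.2, A.poly_comm hx.2 hy.1, Units.smul_def, Units.smul_def, smul_smul,
        smul_add, smul_smul, add_comm, ← Units.val_mul, ← Units.val_mul,
        ← Int.negOnePow_add, ← Int.negOnePow_add]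
      congr 3
      · congr 1; ring
      · rw [Int.negOnePow_eq_iff]
        exact ⟨-i, by ring⟩
  d := A.formsD
  d_mem := by
    intro i x hx
    refine ⟨A.polyMap_mem (fun a ha => A.d_mem ha) hx.1, ?_⟩
    rw [formsD_snd]
    refine Submodule.add_mem _ ?_ ?_
    · rw [add_sub_cancel_right]
      exact A.polyMap_mem (fun a ha => A.sgn_mem ha) (A.polyDeriv_mem hx.1)
    · refine A.polyMap_mem (fun a ha => ?_) hx.2
      have := A.d_mem ha
      rwa [sub_add_cancel, ← add_sub_cancel_right i 1] at this
  d_d := by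
    intro x
    apply forms_ext
    · rw [formsD_fst, formsD_fst, poly_d_d, forms_zero_fst]
    · rw [formsD_snd, formsD_snd, formsD_fst, map_add, poly_d_d, poly_d_sgn, polyDeriv_polyMap,
        forms_zero_snd, add_zero, add_neg_cancel]
  leibniz := by
    intro i x hx y
    rw [Units.smul_def]
    apply forms_ext
    · rw [formsD_fst, forms_add_fst, forms_zsmul_fst, forms_mul_fst, forms_mul_fst, forms_mul_fst,
        formsD_fst, formsD_fst, poly_d_mul, A.poly_sgn_of_mem hx.1, Units.smul_def,
        smul_mul_assoc]
    · have h1 := A.poly_sgn_of_mem hx.1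
      have h2 := A.poly_sgn_of_mem hx.2
      rw [Int.negOnePow_sub, Int.negOnePow_one, mul_neg, mul_one, Units.smul_def, Units.val_neg,
        neg_smul] at h2
      rw [Units.smul_def] at h1
      rw [forms_add_snd, forms_zsmul_snd]
      simp only [formsD_fst, formsD_snd, forms_mul_fst, forms_mul_snd, map_add, poly_d_mul,
        polyDeriv_mul, poly_sgn_mul, poly_d_sgn, h1, h2, poly_zsmul_mul, smul_add, add_mul,
        mul_add, poly_mul_neg, poly_neg_mul, neg_neg]
      abel

/-- The evaluation `A[t] → A` at `t = s`. -/
def polyEval (s : K) : A.Poly →ₗ[K] A.carrier :=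
  TensorProduct.lift
    (LinearMap.toSpanSingleton K (A.carrier →ₗ[K] A.carrier) LinearMap.id ∘ₗ
      Polynomial.leval s)

theorem polyEval_tmul (s : K) (p : K[X]) (a : A.carrier) :
    A.polyEval s (p ⊗ₜ a) = p.eval s • a := by
  simp [polyEval]

/-- The evaluation morphism `e_s : A[t, dt] → A`, `t ↦ s`, `dt ↦ 0`. -/
def eval (s : K) : Hom A.forms A where
  toLin := A.polyEval s ∘ₗ LinearMap.fst K A.Poly A.Poly
  map_mul := by
    intro x y
    change A.polyEval s (x.1 * y.1) = A.polyEval s x.1 * A.polyEval s y.1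
    generalize x.1 = p
    generalize y.1 = q
    induction p using TensorProduct.induction_on with
    | zero => simp
    | add p p' h h' => rw [add_mul, map_add, map_add, add_mul, h, h']
    | tmul p a =>
      induction q using TensorProduct.induction_on with
      | zero => simp
      | add q q' h h' => rw [mul_add, map_add, map_add, mul_add, h, h']
      | tmul q b =>
        rw [poly_mul_tmul, polyEval_tmul, polyEval_tmul, polyEval_tmul, Polynomial.eval_mul,
          smul_mul_smul_comm]
  map_mem := by
    intro i x hx
    change A.polyEval s x.1 ∈ A.gr i
    have hx1 : x.1 ∈ A.polyGr i := hx.1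
    revert hx1
    generalize x.1 = p
    intro hp
    induction hp using Submodule.span_induction with
    | zero => rw [map_zero]; exact Submodule.zero_mem _
    | add x y _ _ hx hy => rw [map_add]; exact Submodule.add_mem _ hx hy
    | smul c x _ hx => rw [map_smul]; exact Submodule.smul_mem _ c hx
    | mem x hx =>
      obtain ⟨p, a, ha, rfl⟩ := hx
      rw [polyEval_tmul]
      exact Submodule.smul_mem _ _ ha
  map_d := by
    intro x
    change A.polyEval s (A.polyMap A.d x.1) = A.d (A.polyEval s x.1)
    generalize x.1 = p
    induction p using TensorProduct.induction_on with
    | zero => simp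
    | add p p' h h' => simp only [map_add, h, h']
    | tmul p a => rw [polyMap_tmul, polyEval_tmul, polyEval_tmul, map_smul]

end Forms

/-- `H` is a homotopy between `f` and `g`: a morphism `A → B[t, dt]` restricting to `f` at `t = 0`
and to `g` at `t = 1`. -/
def Hom.IsHomotopy {A B : DGAlg K} (H : Hom A B.forms) (f g : Hom A B) : Prop :=
  (B.eval 0).comp H = f ∧ (B.eval 1).comp H = g

end DGAlg

/-! ## Complete quasismooth dg-algebras -/

/-- A complete quasismooth (algebraically free) dg-algebra: a graded vector space `V` together
with a dg-algebra `R` which, as a graded algebra, is the inverse limit of the truncated symmetric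
algebras `⨁_{1 ≤ i ≤ n} ⊙ⁱ V`, and whose differential is compatible with this limit.

`coeff i` is the projection of `R` to `⊙ⁱ V`, so that `(coeff 1, …, coeff n)` is the projection to
the `n`-th truncation. The inverse limit is taken in graded algebras: an element of degree `k` is
the same as an arbitrary sequence of elements of `(⊙ⁱ V)ₖ`, `i ≥ 1`. -/
structure CompleteQuasismooth (K : Type u) [Field K] extends DGAlg K where
  V : GradedSpace K
  coeff : ℕ → carrier →ₗ[K] V.Sym
  coeff_zero : coeff 0 = 0
  coeff_mem : ∀ (i : ℕ) {k : ℤ} {r : carrier}, r ∈ gr k → coeff i r ∈ V.symPiece i k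
  coeff_mul : ∀ (n : ℕ) (r s : carrier),
    coeff n (r * s) = ∑ p ∈ Finset.HasAntidiagonal.antidiagonal n, coeff p.1 r * coeff p.2 s
  existsUnique_coeff : ∀ (k : ℤ) (s : ℕ → V.Sym), s 0 = 0 → (∀ i, 1 ≤ i → s i ∈ V.symPiece i k) →
    ∃! r : carrier, r ∈ gr k ∧ ∀ i, coeff i r = s i
  /-- `d` preserves the kernel of the projection to each truncation, i.e. it is induced by
  differentials on the truncations. -/
  coeff_d : ∀ (n : ℕ) (r : carrier), (∀ i < n, coeff i r = 0) → ∀ i < n, coeff i (d r) = 0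

namespace CompleteQuasismooth

variable {K : Type u} [Field K]

/-- The ideal `Rⁿ`: the kernel of the projection of `R` to `⨁_{1 ≤ i < n} ⊙ⁱ V`
(the closure of the span of the `n`-fold products). -/
def pow (R : CompleteQuasismooth K) (n : ℕ) : R.toDGAlg.DGIdeal where
  sub := ⨅ i : Fin n, LinearMap.ker (R.coeff i)
  mul_left := by
    intro a x hx
    simp only [Submodule.mem_iInf, LinearMap.mem_ker] at hx ⊢
    intro i
    rw [R.coeff_mul]
    refine Finset.sum_eq_zero fun p hp => ?_
    have hp' : p.2 < n := by
      have := Finset.HasAntidiagonal.mem_antidiagonal.1 hp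
      have := i.2
      omega
    rw [hx ⟨p.2, hp'⟩, mul_zero]
  mul_right := by
    intro a x hx
    simp only [Submodule.mem_iInf, LinearMap.mem_ker] at hx ⊢
    intro i
    rw [R.coeff_mul]
    refine Finset.sum_eq_zero fun p hp => ?_
    have hp' : p.1 < n := by
      have := Finset.HasAntidiagonal.mem_antidiagonal.1 hp
      have := i.2
      omega
    rw [hx ⟨p.1, hp'⟩, zero_mul]
  d_mem := by
    intro x hx
    simp only [Submodule.mem_iInf, LinearMap.mem_ker] at hx ⊢
    intro i
    exact R.coeff_d n x (fun j hj => hx ⟨j, hj⟩) i i.2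
  component_mem := by
    intro k x hx
    simp only [Submodule.mem_iInf, LinearMap.mem_ker] at hx ⊢
    intro i
    have key : ∀ y : R.carrier,
        R.coeff i (R.toDGAlg.component k y) = R.V.degProj k (R.coeff i y) := by
      intro y
      induction y using R.toDGAlg.homog_induction with
      | zero => simp only [map_zero]
      | add y z hy hz => simp only [map_add, hy, hz]
      | mem j y hy =>
        by_cases hjk : j = k
        · subst hjk
          rw [R.toDGAlg.component_same hy, R.V.degProj_same (R.coeff_mem i hy)]
        · rw [R.toDGAlg.component_ne hjk hy, R.V.degProj_ne hjk (R.coeff_mem i hy), map_zero]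
    rw [key, hx i, map_zero]

theorem mem_pow (R : CompleteQuasismooth K) {n : ℕ} {x : R.carrier} :
    x ∈ (R.pow n).sub ↔ ∀ i < n, R.coeff i x = 0 := by
  simp only [pow, Submodule.mem_iInf, LinearMap.mem_ker]
  exact ⟨fun h i hi => h ⟨i, hi⟩, fun h i => h i i.2⟩

/-- `R` is minimal if `d(R) ⊆ R²`. -/
def IsMinimal (R : CompleteQuasismooth K) : Prop := ∀ r, R.d r ∈ (R.pow 2).sub

/-- A morphism of complete quasismooth dg-algebras: a morphism of dg-algebras that is continuous
for the topologies defined by the ideals `Rⁿ`. -/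
@[ext]
structure Mor (S R : CompleteQuasismooth K) extends DGAlg.Hom S.toDGAlg R.toDGAlg where
  continuous : ∀ n, ∃ m, ∀ x ∈ (S.pow m).sub, toLin x ∈ (R.pow n).sub

namespace Mor

/-- The identity morphism. -/
def id (R : CompleteQuasismooth K) : Mor R R where
  toHom := DGAlg.Hom.id R.toDGAlg
  continuous n := ⟨n, fun _ h => h⟩

/-- Composition of morphisms: first `f`, then `g`. -/
def comp {S R T : CompleteQuasismooth K} (g : Mor R T) (f : Mor S R) : Mor S T where
  toHom := g.toHom.comp f.toHom
  continuous n := by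
    obtain ⟨m, hm⟩ := g.continuous n
    obtain ⟨l, hl⟩ := f.continuous m
    exact ⟨l, fun x hx => hm _ (hl x hx)⟩

/-- The composition `fₙ : S → R / Rⁿ` of `f : S → R` with the projection. -/
def trunc {S R : CompleteQuasismooth K} (f : Mor S R) (n : ℕ) :
    DGAlg.Hom S.toDGAlg (R.toDGAlg.quot (R.pow n)) :=
  (R.toDGAlg.quotHom (R.pow n)).comp f.toHom

end Mor

/-- Elementary homotopy of morphisms from `S` to a (discrete) dg-algebra `B`: there is a homotopy
`H : S → B[t, dt]` which is continuous, i.e. factors through some `S / Sᵐ`. -/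
def Homotopic (S : CompleteQuasismooth K) {B : DGAlg K} (f g : DGAlg.Hom S.toDGAlg B) : Prop :=
  ∃ H : DGAlg.Hom S.toDGAlg B.forms,
    (∃ m, ∀ x ∈ (S.pow m).sub, H.toLin x = 0) ∧ H.IsHomotopy f g

/-- Homotopy equivalence of morphisms: the equivalence relation generated by homotopy. -/
def HomotopyEquivalent (S : CompleteQuasismooth K) {B : DGAlg K}
    (f g : DGAlg.Hom S.toDGAlg B) : Prop :=
  Relation.EqvGen (S.Homotopic (B := B)) f g

/-- `f, g : S → R` are prohomotopy equivalent if `fₙ, gₙ : S → R / Rⁿ` are homotopy equivalent for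
every `n`. -/
def Mor.Prohomotopic {S R : CompleteQuasismooth K} (f g : Mor S R) : Prop :=
  ∀ n, S.HomotopyEquivalent (f.trunc n) (g.trunc n)

/-- Two complete quasismooth dg-algebras are prohomotopy equivalent if there are morphisms in both
directions which are mutually inverse up to prohomotopy equivalence of morphisms. -/
def ProhomotopyEquivalent (S R : CompleteQuasismooth K) : Prop :=
  ∃ (f : Mor S R) (g : Mor R S),
    (g.comp f).Prohomotopic (Mor.id S) ∧ (f.comp g).Prohomotopic (Mor.id R)

/-- Isomorphism of complete quasismooth dg-algebras. -/
def Isomorphic (S R : CompleteQuasismooth K) : Prop :=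
  ∃ (f : Mor S R) (g : Mor R S), g.comp f = Mor.id S ∧ f.comp g = Mor.id R

end CompleteQuasismooth

end QuasiSmooth

end

noncomputable section

namespace QuasiSmooth

namespace GradedSpace

variable {K : Type u} [Field K] (V : GradedSpace K)

/-! ### Homogeneous components of a graded vector space -/

/-! Uniqueness. If `R` is minimal, then `B = R/R²` has zero product and zero differential. A
continuous homotopy `H : R → B[t,dt]` kills `R²`, since products vanish in `B[t,dt]`; hence it kills
`d(R)`, every `H x` is closed, and in characteristic `0` the function part of `H x` takes equal
values at `0` and `1` (`Homotopic.eq_of_isMinimal`). So an endomorphism of `R` prohomotopic to the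
identity is the identity modulo `R²`. It is then unipotent for the filtration by the `Rⁿ`, and
completeness makes it invertible (`exists_inverse`). Mutually inverse prohomotopy equivalences `f`,
`g` therefore have `gf` and `fg` invertible, so `f` is an isomorphism.

Existence. Let `δ` be the linear part of `d` on `V`, and choose `η` of degree `-1` with `η² = 0`,
`δηδ = δ`, `ηδη = η`. Then `P = 1 - δη - ηδ` is a projection onto a copy of the cohomology of `δ`.
Extend `η` to an antiderivation `h` of `R` and put `L = dh + hd`, a derivation of degree `0`. Let
`N` be the Euler derivation of the weight grading in which generators in `im P` have weight `0` and
generators in `ker P` have weight `1`.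

If `L = N`, then `d` and `h` preserve weights, because both commute with `L`. The weight zero part
is then a quotient dg-algebra, free on `im P`, and minimal because `Pδ = 0`. The map `r ↦ ∑ tʲ rⱼ ±
tʲ⁻¹ h(rⱼ) dt` joins the projection onto weight zero, at `t = 0`, to the identity, at `t = 1`
(`exists_weight_homotopy`, `exists_isMinimal_of_weight`).

It remains to find generators for which `L = N`. One change of generators turns the linear
boundaries `δηv` into true boundaries, so that `L` is the identity on the generators in `ker P`
(`exists_isMinimal`). A second corrects the generators in `im P` by elements of `R²` so that `L`
kills them (`exists_isMinimal_of_gen`). The correction exists because `L` differs from `N` by an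
operator raising the filtration, while `N` is invertible away from weight zero, so successive
approximation (`exists_preimage`) solves the equation. -/

theorem iSup_gr : iSup V.gr = ⊤ := V.isInternal.submodule_iSup_eq_top

theorem homog_induction {P : V.carrier → Prop} (mem : ∀ i, ∀ v ∈ V.gr i, P v) (zero : P 0)
    (add : ∀ v w, P v → P w → P (v + w)) (v : V.carrier) : P v := by
  have hv : v ∈ iSup V.gr := by rw [V.iSup_gr]; trivial
  induction hv using Submodule.iSup_induction' with
  | mem i x hx => exact mem i x hx
  | zero => exact zero
  | add x y _ _ hx hy => exact add x y hx hy

/-- A linear map on a graded vector space is determined by arbitrary linear maps on the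
homogeneous pieces. -/
theorem exists_linearMap_of_pieces {M : Type*} [AddCommGroup M] [Module K M]
    (φ : ∀ i, V.gr i →ₗ[K] M) :
    ∃ f : V.carrier →ₗ[K] M, ∀ i (v : V.carrier) (hv : v ∈ V.gr i), f v = φ i ⟨v, hv⟩ := by
  let _ := V.isInternal.chooseDecomposition
  refine ⟨DirectSum.toModule K ℤ _ φ ∘ₗ (DirectSum.decomposeLinearEquiv V.gr).toLinearMap, ?_⟩
  intro i v hv
  simp only [LinearMap.comp_apply, LinearEquiv.coe_coe, DirectSum.decomposeLinearEquiv_apply]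
  rw [DirectSum.decompose_of_mem V.gr hv]
  exact DirectSum.toModule_lof K i _

/-- A linear relation which is total on every homogeneous piece contains the graph of a linear
map. -/
theorem exists_linearMap_of_rel {M : Type*} [AddCommGroup M] [Module K M]
    (rel : ℤ → Submodule K (V.carrier × M))
    (h : ∀ i, ∀ v ∈ V.gr i, ∃ m, (v, m) ∈ rel i) :
    ∃ f : V.carrier →ₗ[K] M, ∀ i, ∀ v ∈ V.gr i, (v, f v) ∈ rel i := by
  have key : ∀ i, ∃ φ : V.gr i →ₗ[K] M, ∀ v : V.gr i, ((v : V.carrier), φ v) ∈ rel i := by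
    intro i
    let E : Submodule K (V.gr i × M) :=
      (rel i).comap ((V.gr i).subtype.prodMap (LinearMap.id : M →ₗ[K] M))
    let p : E →ₗ[K] V.gr i := LinearMap.fst K (V.gr i) M ∘ₗ E.subtype
    have hp : LinearMap.range p = ⊤ := by
      rw [LinearMap.range_eq_top]
      intro v
      obtain ⟨m, hm⟩ := h i v v.2
      exact ⟨⟨(v, m), hm⟩, rfl⟩
    -- Over a field the projection of the relation onto the piece has a linear section. Elementwise
    -- existence thus upgrades to a linear choice.
    obtain ⟨s, hs⟩ := p.exists_rightInverse_of_surjective hp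
    refine ⟨LinearMap.snd K (V.gr i) M ∘ₗ E.subtype ∘ₗ s, fun v => ?_⟩
    have h1 : (s v : V.gr i × M).1 = v := LinearMap.congr_fun hs v
    have h2 : (((s v : V.gr i × M).1 : V.carrier), (s v : V.gr i × M).2) ∈ rel i := (s v).2
    rw [h1] at h2
    exact h2
  choose φ hφ using key
  obtain ⟨f, hf⟩ := V.exists_linearMap_of_pieces φ
  exact ⟨f, fun i v hv => by rw [hf i v hv]; exact hφ i ⟨v, hv⟩⟩

/-! ### The universal property of the graded symmetric algebra -/

section Lift

variable {A : Type*} [Ring A] [Algebra K A]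

/-- The algebra map out of the graded symmetric algebra induced by a linear map whose values
satisfy the Koszul commutation relations. -/
def symLift (φ : V.carrier →ₗ[K] A)
    (hφ : ∀ i j v w, v ∈ V.gr i → w ∈ V.gr j →
      φ v * φ w = (i * j).negOnePow • (φ w * φ v)) : V.Sym →ₐ[K] A :=
  RingQuot.liftAlgHom K (s := SymRel V) ⟨TensorAlgebra.lift K φ, by
    rintro _ _ ⟨i, j, v, w, hv, hw⟩
    rw [Units.smul_def, map_zsmul, map_mul, map_mul, TensorAlgebra.lift_ι_apply,
      TensorAlgebra.lift_ι_apply, hφ i j v w hv hw, Units.smul_def]⟩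

theorem symLift_ι (φ : V.carrier →ₗ[K] A)
    (hφ : ∀ i j v w, v ∈ V.gr i → w ∈ V.gr j →
      φ v * φ w = (i * j).negOnePow • (φ w * φ v)) (v : V.carrier) :
    V.symLift φ hφ (V.symι v) = φ v :=
  (RingQuot.liftAlgHom_mkAlgHom_apply K _ _ _).trans (TensorAlgebra.lift_ι_apply _ _)

end Lift

theorem sym_induction {P : V.Sym → Prop} (algebraMap : ∀ c : K, P (algebraMap K V.Sym c))
    (ι : ∀ i, ∀ v ∈ V.gr i, P (V.symι v)) (mul : ∀ x y, P x → P y → P (x * y))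
    (add : ∀ x y, P x → P y → P (x + y)) (x : V.Sym) : P x := by
  obtain ⟨x, rfl⟩ := RingQuot.mkAlgHom_surjective K (SymRel V) x
  induction x using TensorAlgebra.induction with
  | algebraMap c => rw [AlgHom.commutes]; exact algebraMap c
  | mul x y hx hy => rw [map_mul]; exact mul _ _ hx hy
  | add x y hx hy => rw [map_add]; exact add _ _ hx hy
  | ι v =>
    change P (V.symι v)
    induction v using V.homog_induction with
    | mem i v hv => exact ι i v hv
    | zero => simpa using algebraMap 0
    | add v w hv hw => rw [map_add]; exact add _ _ hv hw

theorem algHom_ext {A : Type*} [Ring A] [Algebra K A] {f g : V.Sym →ₐ[K] A}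
    (h : ∀ i, ∀ v ∈ V.gr i, f (V.symι v) = g (V.symι v)) (x : V.Sym) : f x = g x := by
  induction x using V.sym_induction with
  | algebraMap c => rw [AlgHom.commutes, AlgHom.commutes]
  | ι i v hv => exact h i v hv
  | mul x y hx hy => rw [map_mul, map_mul, hx, hy]
  | add x y hx hy => rw [map_add, map_add, hx, hy]

/-! ### The pieces of the graded symmetric algebra -/

theorem one_mem_symPiece : (1 : V.Sym) ∈ V.symPiece 0 0 :=
  Submodule.subset_span ⟨Fin.elim0, Fin.elim0, fun a => a.elim0, by simp, by simp⟩

variable {V}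

theorem ι_mul_mem_symPiece {i k : ℤ} {n : ℕ} {v : V.carrier} {x : V.Sym} (hv : v ∈ V.gr i)
    (hx : x ∈ V.symPiece n k) : V.symι v * x ∈ V.symPiece (n + 1) (i + k) := by
  induction hx using Submodule.span_induction with
  | zero => rw [mul_zero]; exact Submodule.zero_mem _
  | add x y _ _ hx hy => rw [mul_add]; exact Submodule.add_mem _ hx hy
  | smul c x _ hx => rw [mul_smul_comm]; exact Submodule.smul_mem _ c hx
  | mem x hx =>
    obtain ⟨e, w, hw, rfl, rfl⟩ := hx
    refine Submodule.subset_span ⟨Fin.cons i e, Fin.cons v w, ?_, ?_, ?_⟩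
    · intro a
      refine Fin.cases ?_ (fun a => ?_) a
      · simpa using hv
      · simpa using hw a
    · simp [Fin.sum_univ_succ]
    · simp [List.ofFn_succ]

theorem ι_mem_symPiece {k : ℤ} {v : V.carrier} (hv : v ∈ V.gr k) :
    V.symι v ∈ V.symPiece 1 k := by
  have := ι_mul_mem_symPiece hv V.one_mem_symPiece
  rwa [mul_one, add_zero, zero_add] at this

/-- Spanning products are built by multiplying by one generator on the left. The property carries
`n` and `k` because that step changes both indices. -/
theorem symPiece_induction {P : ℕ → ℤ → V.Sym → Prop} (zero : ∀ n k, P n k 0)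
    (add : ∀ n k x y, P n k x → P n k y → P n k (x + y))
    (smul : ∀ n k (c : K) x, P n k x → P n k (c • x)) (one : P 0 0 1)
    (mul : ∀ n i k v x, v ∈ V.gr i → x ∈ V.symPiece n k → P n k x →
      P (n + 1) (i + k) (V.symι v * x))
    {n : ℕ} {k : ℤ} {x : V.Sym} (hx : x ∈ V.symPiece n k) : P n k x := by
  induction hx using Submodule.span_induction with
  | zero => exact zero n k
  | add x y _ _ hx hy => exact add n k x y hx hy
  | smul c x _ hx => exact smul n k c x hx
  | mem x hx =>
    obtain ⟨e, v, hv, rfl, rfl⟩ := hx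
    induction n with
    | zero => simpa using one
    | succ n ih =>
      rw [List.ofFn_succ, List.prod_cons, Fin.sum_univ_succ]
      exact mul n _ _ _ _ (hv 0)
        (Submodule.subset_span ⟨fun a => e a.succ, fun a => v a.succ, fun a => hv a.succ, rfl, rfl⟩)
        (ih (fun a => e a.succ) (fun a => v a.succ) (fun a => hv a.succ))

theorem mul_mem_symPiece {n m : ℕ} {k l : ℤ} {x y : V.Sym} (hx : x ∈ V.symPiece n k)
    (hy : y ∈ V.symPiece m l) : x * y ∈ V.symPiece (n + m) (k + l) := by
  revert y m l
  refine symPiece_induction (P := fun n k x => ∀ {m : ℕ} {l : ℤ} {y : V.Sym},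
    y ∈ V.symPiece m l → x * y ∈ V.symPiece (n + m) (k + l)) ?_ ?_ ?_ ?_ ?_ hx
  · intro n k m l y _
    rw [zero_mul]; exact Submodule.zero_mem _
  · intro n k x x' h h' m l y hy
    rw [add_mul]; exact Submodule.add_mem _ (h hy) (h' hy)
  · intro n k c x h m l y hy
    rw [smul_mul_assoc]; exact Submodule.smul_mem _ c (h hy)
  · intro m l y hy
    rwa [one_mul, zero_add, zero_add]
  · intro n i k v x hv _ h m l y hy
    rw [mul_assoc, add_assoc i, show n + 1 + m = n + m + 1 by omega]
    exact ι_mul_mem_symPiece hv (h hy)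

variable (V)

/-! ### The linear part of an element of the graded symmetric algebra -/

/-- The action of the graded symmetric algebra on its quotient `K ⊕ V`. -/
def symRep : V.Sym →ₐ[K] Module.End K (K × V.carrier) :=
  V.symLift
    { toFun := fun v => LinearMap.inr K K V.carrier ∘ₗ
        LinearMap.toSpanSingleton K V.carrier v ∘ₗ LinearMap.fst K K V.carrier
      map_add' := fun v w => by ext <;> simp
      map_smul' := fun c v => by ext <;> simp }
    (by
      intro i j v w _ _
      -- Each operator maps into `V` and kills `V`, so both sides of the Koszul relation are zero.
      have h : ∀ v w : V.carrier,
          ((LinearMap.inr K K V.carrier ∘ₗ LinearMap.toSpanSingleton K V.carrier v ∘ₗ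
            LinearMap.fst K K V.carrier : Module.End K (K × V.carrier)) *
          (LinearMap.inr K K V.carrier ∘ₗ LinearMap.toSpanSingleton K V.carrier w ∘ₗ
            LinearMap.fst K K V.carrier : Module.End K (K × V.carrier))) = 0 := by
        intro v w
        ext <;> simp
      change _ * _ = _ • (_ * _)
      simp only [LinearMap.coe_mk, AddHom.coe_mk]
      rw [h, h, smul_zero])

theorem symRep_ι (v : V.carrier) (x : K × V.carrier) : V.symRep (V.symι v) x = (0, x.1 • v) := by
  rw [symRep, symLift_ι]
  rfl

/-- The linear part of an element of the graded symmetric algebra. -/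
def symFst : V.Sym →ₗ[K] V.carrier where
  toFun x := (V.symRep x (1, 0)).2
  map_add' x y := by simp
  map_smul' c x := by simp

theorem symFst_ι (v : V.carrier) : V.symFst (V.symι v) = v := by
  change (V.symRep (V.symι v) (1, 0)).2 = v
  rw [symRep_ι, one_smul]

variable {V}

theorem exists_of_mem_symPiece_one {k : ℤ} {x : V.Sym} (hx : x ∈ V.symPiece 1 k) :
    ∃ v ∈ V.gr k, V.symι v = x := by
  induction hx using Submodule.span_induction with
  | zero => exact ⟨0, Submodule.zero_mem _, map_zero _⟩
  | add x y _ _ hx hy =>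
    obtain ⟨v, hv, rfl⟩ := hx
    obtain ⟨w, hw, rfl⟩ := hy
    exact ⟨v + w, Submodule.add_mem _ hv hw, map_add _ _ _⟩
  | smul c x _ hx =>
    obtain ⟨v, hv, rfl⟩ := hx
    exact ⟨c • v, Submodule.smul_mem _ c hv, map_smul _ _ _⟩
  | mem x hx =>
    obtain ⟨e, v, hv, rfl, rfl⟩ := hx
    exact ⟨v 0, by simpa using hv 0, by simp⟩

theorem symFst_mem {k : ℤ} {x : V.Sym} (hx : x ∈ V.symPiece 1 k) : V.symFst x ∈ V.gr k := by
  obtain ⟨v, hv, rfl⟩ := exists_of_mem_symPiece_one hx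
  rwa [symFst_ι]

theorem ι_symFst {k : ℤ} {x : V.Sym} (hx : x ∈ V.symPiece 1 k) : V.symι (V.symFst x) = x := by
  obtain ⟨v, hv, rfl⟩ := exists_of_mem_symPiece_one hx
  rw [symFst_ι]

end GradedSpace

namespace DGAlg

variable {K : Type u} [Field K]

/-- The underlying graded vector space of a dg-algebra. -/
abbrev toGradedSpace (A : DGAlg K) : GradedSpace K where
  carrier := A.carrier
  gr := A.gr
  isInternal := A.isInternal

theorem eq_zero_of_component (A : DGAlg K) {a : A.carrier} (h : ∀ k, A.component k a = 0) :
    a = 0 := by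
  let _ := A.isInternal.chooseDecomposition
  apply (DirectSum.decomposeLinearEquiv A.gr).injective
  rw [map_zero]
  ext k
  exact h k

end DGAlg

namespace CompleteQuasismooth

variable {K : Type u} [Field K] (R : CompleteQuasismooth K)

/-! ### Elements and their coefficients -/

theorem coeff_component (i : ℕ) (k : ℤ) (y : R.carrier) :
    R.coeff i (R.toDGAlg.component k y) = R.V.degProj k (R.coeff i y) := by
  induction y using R.toDGAlg.homog_induction with
  | zero => simp only [map_zero]
  | add y z hy hz => simp only [map_add, hy, hz]
  | mem j y hy =>
    by_cases hjk : j = k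
    · subst hjk
      rw [R.toDGAlg.component_same hy, R.V.degProj_same (R.coeff_mem i hy)]
    · rw [R.toDGAlg.component_ne hjk hy, R.V.degProj_ne hjk (R.coeff_mem i hy), map_zero]

/-- The limit property gives uniqueness only for homogeneous elements, so it is applied to each
homogeneous component; `coeff_component` says that its coefficients are components of the
coefficients. -/
theorem eq_zero_of_coeff {x : R.carrier} (h : ∀ n, R.coeff n x = 0) : x = 0 := by
  refine R.toDGAlg.eq_zero_of_component fun k => ?_
  obtain ⟨r, -, hr⟩ := R.existsUnique_coeff k 0 rfl fun i _ => Submodule.zero_mem _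
  rw [hr (R.toDGAlg.component k x) ⟨R.toDGAlg.component_mem k x, fun i => by
    rw [coeff_component, h, map_zero]; rfl⟩]
  exact (hr 0 ⟨Submodule.zero_mem _, fun i => map_zero _⟩).symm

theorem ext_coeff {x y : R.carrier} (h : ∀ n, R.coeff n x = R.coeff n y) : x = y :=
  sub_eq_zero.1 (R.eq_zero_of_coeff fun n => by rw [map_sub, h, sub_self])

theorem coeff_zero_apply (x : R.carrier) : R.coeff 0 x = 0 := by
  rw [R.coeff_zero]; rfl

/-- A family of linear maps to the symmetric powers, homogeneous of degree `δ`, is the family of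
coefficients of a linear map. -/
theorem exists_linearMap_of_coeff {V : GradedSpace K} (S : CompleteQuasismooth K) (δ : ℤ)
    (T : ℕ → V.carrier →ₗ[K] S.V.Sym) (T_zero : T 0 = 0)
    (hT : ∀ n k, ∀ r ∈ V.gr k, T n r ∈ S.V.symPiece n (k + δ)) :
    ∃ f : V.carrier →ₗ[K] S.carrier, (∀ n r, S.coeff n (f r) = T n r) ∧
      ∀ k, ∀ r ∈ V.gr k, f r ∈ S.gr (k + δ) := by
  -- Having the prescribed coefficients is a linear condition on the pair, so
  -- `exists_linearMap_of_rel` gives linearity of the solution.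
  let rel : ℤ → Submodule K (V.carrier × S.carrier) := fun k =>
    { carrier := {x | x.2 ∈ S.gr (k + δ) ∧ ∀ n, S.coeff n x.2 = T n x.1}
      zero_mem' := ⟨Submodule.zero_mem _, fun n => by simp⟩
      add_mem' := fun {x y} hx hy => ⟨Submodule.add_mem _ hx.1 hy.1, fun n => by
        simp [hx.2, hy.2]⟩
      smul_mem' := fun c x hx => ⟨Submodule.smul_mem _ c hx.1, fun n => by simp [hx.2]⟩ }
  obtain ⟨f, hf⟩ := V.exists_linearMap_of_rel rel (by
    intro k r hr
    obtain ⟨s, hs, -⟩ := S.existsUnique_coeff (k + δ) (fun n => T n r) (by simp [T_zero])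
      (fun n _ => hT n k r hr)
    exact ⟨s, hs⟩)
  refine ⟨f, fun n r => ?_, fun k r hr => (hf k r hr).1⟩
  induction r using V.homog_induction with
  | mem k r hr => exact (hf k r hr).2 n
  | zero => simp
  | add r s hr hs => simp [hr, hs]

theorem exists_linearMap_of_sym (δ : ℤ) (T : R.V.Sym →ₗ[K] R.V.Sym)
    (hT : ∀ n k, ∀ x ∈ R.V.symPiece n k, T x ∈ R.V.symPiece n (k + δ)) :
    ∃ f : R.carrier →ₗ[K] R.carrier, (∀ n r, R.coeff n (f r) = T (R.coeff n r)) ∧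
      ∀ k, ∀ r ∈ R.gr k, f r ∈ R.gr (k + δ) :=
  exists_linearMap_of_coeff (V := R.toDGAlg.toGradedSpace) R δ (fun n => T ∘ₗ R.coeff n)
    (by rw [R.coeff_zero, LinearMap.comp_zero]) (fun n k r hr => hT n k _ (R.coeff_mem n hr))

theorem exists_gen : ∃ g : R.V.carrier →ₗ[K] R.carrier,
    (∀ n v, R.coeff n (g v) = if n = 1 then R.V.symι v else 0) ∧ ∀ k, ∀ v ∈ R.V.gr k, g v ∈ R.gr k := by
  obtain ⟨g, hg, hg'⟩ := exists_linearMap_of_coeff (V := R.V) R 0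
    (fun n => if n = 1 then R.V.symι else 0) (by simp) (by
      intro n k v hv
      by_cases hn : n = 1
      · subst hn
        simpa using GradedSpace.ι_mem_symPiece hv
      · simp [hn])
  refine ⟨g, fun n v => ?_, fun k v hv => by simpa using hg' k v hv⟩
  rw [hg]
  split_ifs <;> rfl

/-- The inclusion of the space of generators. -/
def gen : R.V.carrier →ₗ[K] R.carrier := Classical.choose R.exists_gen

theorem coeff_gen (n : ℕ) (v : R.V.carrier) :
    R.coeff n (R.gen v) = if n = 1 then R.V.symι v else 0 :=
  (Classical.choose_spec R.exists_gen).1 n v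

theorem coeff_one_gen (v : R.V.carrier) : R.coeff 1 (R.gen v) = R.V.symι v := by
  rw [coeff_gen, if_pos rfl]

variable {R} in
theorem gen_mem {k : ℤ} {v : R.V.carrier} (hv : v ∈ R.V.gr k) : R.gen v ∈ R.gr k :=
  (Classical.choose_spec R.exists_gen).2 k v hv

theorem coeff_succ_gen_mul (n : ℕ) (v : R.V.carrier) (b : R.carrier) :
    R.coeff (n + 1) (R.gen v * b) = R.V.symι v * R.coeff n b := by
  rw [R.coeff_mul, Finset.sum_eq_single (1, n)]
  · rw [coeff_one_gen]
  · rintro ⟨i, j⟩ hij hne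
    rw [Finset.HasAntidiagonal.mem_antidiagonal] at hij
    rw [coeff_gen, if_neg, zero_mul]
    rintro rfl
    apply hne
    congr 1
    simp only at hij
    omega
  · intro h
    exact absurd (Finset.HasAntidiagonal.mem_antidiagonal.2 (add_comm 1 n)) h

theorem exists_coeff_eq {n : ℕ} (hn : 1 ≤ n) {k : ℤ} {y : R.V.Sym} (hy : y ∈ R.V.symPiece n k) :
    ∃ r ∈ (R.pow n).sub, R.coeff n r = y := by
  obtain ⟨r, ⟨-, hr⟩, -⟩ := R.existsUnique_coeff k (fun i => if i = n then y else 0)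
    (if_neg (by omega)) (fun i _ => by
      by_cases h : i = n
      · subst h; simpa using hy
      · simp [h])
  refine ⟨r, R.mem_pow.2 fun i hi => ?_, ?_⟩
  · rw [hr, if_neg hi.ne]
  · rw [hr, if_pos rfl]

/-! ### The filtration -/

variable {R}

theorem mem_pow_one (x : R.carrier) : x ∈ (R.pow 1).sub := by
  rw [mem_pow]
  intro i hi
  obtain rfl : i = 0 := by omega
  exact R.coeff_zero_apply x

theorem pow_mono {m n : ℕ} (h : m ≤ n) {x : R.carrier} (hx : x ∈ (R.pow n).sub) :
    x ∈ (R.pow m).sub := by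
  rw [mem_pow] at hx ⊢
  exact fun i hi => hx i (by omega)

theorem mem_pow_succ {n : ℕ} {x : R.carrier} :
    x ∈ (R.pow (n + 1)).sub ↔ x ∈ (R.pow n).sub ∧ R.coeff n x = 0 := by
  simp only [mem_pow]
  constructor
  · exact fun h => ⟨fun i hi => h i (by omega), h n (by omega)⟩
  · rintro ⟨h, h'⟩ i hi
    rcases Nat.lt_succ_iff_lt_or_eq.1 hi with hi | rfl
    · exact h i hi
    · exact h'

theorem mem_pow_two {x : R.carrier} : x ∈ (R.pow 2).sub ↔ R.coeff 1 x = 0 := by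
  rw [mem_pow_succ]
  exact and_iff_right (mem_pow_one x)

theorem mul_mem_pow {m n : ℕ} {a b : R.carrier} (ha : a ∈ (R.pow m).sub)
    (hb : b ∈ (R.pow n).sub) : a * b ∈ (R.pow (m + n)).sub := by
  rw [mem_pow] at ha hb ⊢
  intro i hi
  rw [R.coeff_mul]
  refine Finset.sum_eq_zero fun p hp => ?_
  rw [Finset.HasAntidiagonal.mem_antidiagonal] at hp
  by_cases h : p.1 < m
  · rw [ha _ h, zero_mul]
  · rw [hb p.2 (by omega), mul_zero]

theorem eq_zero_of_mem_pow {x : R.carrier} (h : ∀ n, x ∈ (R.pow n).sub) : x = 0 :=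
  R.eq_zero_of_coeff fun n => R.mem_pow.1 (h (n + 1)) n (by omega)

variable (R) in
/-- The span of the products of a generator with elements of `Rⁿ`. -/
def genMulPow (n : ℕ) : Submodule K R.carrier :=
  Submodule.span K {x | ∃ i, ∃ v ∈ R.V.gr i, ∃ b ∈ (R.pow n).sub, R.gen v * b = x}

theorem genMulPow_mono {m n : ℕ} (h : m ≤ n) : R.genMulPow n ≤ R.genMulPow m := by
  refine Submodule.span_mono ?_
  rintro _ ⟨i, v, hv, b, hb, rfl⟩
  exact ⟨i, v, hv, b, pow_mono h hb, rfl⟩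

/-- `⊙ⁿ⁺¹ V` is spanned by products of a generator with an element of `⊙ⁿ V`, and the latter lifts
to `Rⁿ` once `n ≥ 1`. This matches one coefficient by a finite sum of products. -/
theorem exists_genMulPow_coeff {n : ℕ} (hn : 1 ≤ n) (x : R.carrier) :
    ∃ y ∈ R.genMulPow n, y ∈ (R.pow (n + 1)).sub ∧ R.coeff (n + 1) y = R.coeff (n + 1) x := by
  induction x using R.toDGAlg.homog_induction with
  | zero => exact ⟨0, Submodule.zero_mem _, Submodule.zero_mem _, by simp⟩
  | add x x' h h' =>
    obtain ⟨y, hy, hy', e⟩ := h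
    obtain ⟨z, hz, hz', e'⟩ := h'
    exact ⟨y + z, Submodule.add_mem _ hy hz, Submodule.add_mem _ hy' hz', by simp [e, e']⟩
  | mem k x hx =>
    have hx := R.coeff_mem (n + 1) hx
    generalize R.coeff (n + 1) x = c at hx
    revert hx
    -- The induction principle needs a free index, so `n + 1` is replaced by `N` with an equation.
    suffices ∀ N, c ∈ R.V.symPiece N k → N = n + 1 →
        ∃ y ∈ R.genMulPow n, y ∈ (R.pow (n + 1)).sub ∧ R.coeff (n + 1) y = c from
      fun h => this _ h rfl
    intro N hc
    refine GradedSpace.symPiece_induction (P := fun N k c => N = n + 1 →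
        ∃ y ∈ R.genMulPow n, y ∈ (R.pow (n + 1)).sub ∧ R.coeff (n + 1) y = c) ?_ ?_ ?_ ?_ ?_ hc
    · exact fun _ _ _ => ⟨0, Submodule.zero_mem _, Submodule.zero_mem _, by simp⟩
    · intro _ _ x x' h h' hN
      obtain ⟨y, hy, hy', e⟩ := h hN
      obtain ⟨z, hz, hz', e'⟩ := h' hN
      exact ⟨y + z, Submodule.add_mem _ hy hz, Submodule.add_mem _ hy' hz', by simp [e, e']⟩
    · intro _ _ a x h hN
      obtain ⟨y, hy, hy', e⟩ := h hN
      exact ⟨a • y, Submodule.smul_mem _ a hy, Submodule.smul_mem _ a hy', by simp [e]⟩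
    · intro h; omega
    · intro m i k v x hv hx _ hN
      obtain rfl : m = n := by omega
      obtain ⟨b, hb, e⟩ := R.exists_coeff_eq hn hx
      refine ⟨R.gen v * b, Submodule.subset_span ⟨i, v, hv, b, hb, rfl⟩, ?_, ?_⟩
      · rw [add_comm]
        exact mul_mem_pow (mem_pow_one _) hb
      · rw [coeff_succ_gen_mul, e]

/-- The leading coefficient of the error is removed `d` times. Only finitely many are removed, so
products span `Rⁿ⁺¹` up to a tail of arbitrarily high order. -/
theorem exists_sub_mem_pow {n : ℕ} (hn : 1 ≤ n) (d : ℕ) {x : R.carrier}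
    (hx : x ∈ (R.pow (n + 1)).sub) :
    ∃ y ∈ R.genMulPow n, x - y ∈ (R.pow (n + 1 + d)).sub := by
  induction d with
  | zero => exact ⟨0, Submodule.zero_mem _, by simpa using hx⟩
  | succ d ih =>
    obtain ⟨y, hy, hxy⟩ := ih
    obtain ⟨z, hz, hz', e⟩ := exists_genMulPow_coeff (n := n + d) (by omega) (x - y)
    refine ⟨y + z, Submodule.add_mem _ hy (genMulPow_mono (by omega) hz), ?_⟩
    rw [← add_assoc, mem_pow_succ, ← sub_sub]
    rw [show n + 1 + d = n + d + 1 by omega] at *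
    exact ⟨Submodule.sub_mem _ hxy hz', by rw [map_sub, e, sub_self]⟩

/-- `Rⁿ⁺¹` is the closure of the span of the products of a generator with elements of `Rⁿ`. -/
theorem pow_succ_induction {n : ℕ} (hn : 1 ≤ n) (m : ℕ) {P : R.carrier → Prop} (zero : P 0)
    (add : ∀ x y, P x → P y → P (x + y)) (mem : ∀ x ∈ (R.pow m).sub, P x)
    (mul : ∀ i, ∀ v ∈ R.V.gr i, ∀ b ∈ (R.pow n).sub, P (R.gen v * b)) {x : R.carrier}
    (hx : x ∈ (R.pow (n + 1)).sub) : P x := by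
  -- The error lies in `Rⁿ⁺¹⁺ᵐ ⊆ Rᵐ`, where the property is assumed; in applications this is
  -- continuity.
  obtain ⟨y, hy, hxy⟩ := exists_sub_mem_pow hn m hx
  rw [← sub_add_cancel x y]
  refine add _ _ (mem _ (pow_mono (by omega) hxy)) ?_
  rw [genMulPow] at hy
  refine (Submodule.closure_induction (p := fun y _ => P y) zero (fun x y _ _ => add x y) ?_ hy)
  rintro a _ ⟨i, v, hv, b, hb, rfl⟩
  -- A scalar is absorbed into the generator, so the property need not be stable under scalars.
  rw [← smul_mul_assoc, ← map_smul]
  exact mul i _ (Submodule.smul_mem _ a hv) b hb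

variable (R) in
theorem exists_gen_sub_mem (x : R.carrier) :
    ∃ v, x - R.gen v ∈ (R.pow 2).sub := by
  induction x using R.toDGAlg.homog_induction with
  | zero => exact ⟨0, by simp⟩
  | add x y h h' =>
    obtain ⟨v, hv⟩ := h
    obtain ⟨w, hw⟩ := h'
    exact ⟨v + w, by rw [map_add, add_sub_add_comm]; exact Submodule.add_mem _ hv hw⟩
  | mem k x hx =>
    obtain ⟨v, -, hv⟩ := GradedSpace.exists_of_mem_symPiece_one (R.coeff_mem 1 hx)
    exact ⟨v, by rw [mem_pow_two, map_sub, coeff_one_gen, hv, sub_self]⟩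

/-! ### Filtered operators -/

/-- Congruence to the identity modulo `R²` propagates through `φ(vb) - vb = (φv - v) φb + v (φb -
b)`: the first factor gains an order, or the second does by induction. Continuity disposes of the
tail. -/
theorem hom_sub_mem_pow_succ {φ : R.carrier →ₗ[K] R.carrier}
    (map_mul : ∀ a b, φ (a * b) = φ a * φ b)
    (cont : ∀ n, ∃ m, ∀ x ∈ (R.pow m).sub, φ x ∈ (R.pow n).sub)
    (h : ∀ x, φ x - x ∈ (R.pow 2).sub) (n : ℕ) :
    ∀ x ∈ (R.pow n).sub, φ x - x ∈ (R.pow (n + 1)).sub := by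
  induction n with
  | zero => exact fun x _ => mem_pow_one _
  | succ n ih =>
    rcases Nat.eq_zero_or_pos n with rfl | hn
    · exact fun x _ => h x
    intro x hx
    obtain ⟨m, hm⟩ := cont (n + 2)
    refine pow_succ_induction hn (max m (n + 2)) (P := fun x => φ x - x ∈ (R.pow (n + 2)).sub)
      ?_ ?_ ?_ ?_ hx
    · simp
    · intro x y hx hy
      rw [map_add, add_sub_add_comm]
      exact Submodule.add_mem _ hx hy
    · intro x hx
      exact Submodule.sub_mem _ (hm x (pow_mono (le_max_left _ _) hx))
        (pow_mono (le_max_right _ _) hx)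
    · intro i v _ b hb
      have hb' := ih b hb
      have e : φ (R.gen v * b) - R.gen v * b =
          (φ (R.gen v) - R.gen v) * φ b + R.gen v * (φ b - b) := by
        rw [map_mul, sub_mul, mul_sub]; abel
      rw [e]
      refine Submodule.add_mem _ ?_ ?_
      · rw [add_comm n 2]
        refine mul_mem_pow (h _) ?_
        rw [← sub_add_cancel (φ b) b]
        exact Submodule.add_mem _ (pow_mono (by omega) hb') hb
      · rw [show n + 2 = 1 + (n + 1) by omega]
        exact mul_mem_pow (mem_pow_one _) hb'

/-- The infinitesimal form of `hom_sub_mem_pow_succ`: by the Leibniz rule, raising the order of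
every element of `R = R¹` raises the order on every `Rⁿ`. -/
theorem derivation_mem_pow_succ {D : R.carrier →ₗ[K] R.carrier}
    (leibniz : ∀ a b, D (a * b) = D a * b + a * D b)
    (hD : ∀ n, ∀ x ∈ (R.pow n).sub, D x ∈ (R.pow n).sub)
    (h : ∀ x, D x ∈ (R.pow 2).sub) (n : ℕ) :
    ∀ x ∈ (R.pow n).sub, D x ∈ (R.pow (n + 1)).sub := by
  induction n with
  | zero => exact fun x _ => mem_pow_one _
  | succ n ih =>
    rcases Nat.eq_zero_or_pos n with rfl | hn
    · exact fun x _ => h x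
    intro x hx
    refine pow_succ_induction hn (n + 2) (P := fun x => D x ∈ (R.pow (n + 2)).sub)
      ?_ ?_ (hD _) ?_ hx
    · simp
    · intro x y hx hy
      rw [map_add]
      exact Submodule.add_mem _ hx hy
    · intro i v _ b hb
      rw [leibniz]
      refine Submodule.add_mem _ ?_ ?_
      · rw [add_comm n 2]
        exact mul_mem_pow (h _) hb
      · rw [show n + 2 = 1 + (n + 1) by omega]
        exact mul_mem_pow (mem_pow_one _) (ih b hb)

/-- A filtered operator vanishing on generators, and on products with an element which it kills,
is zero. -/
theorem eq_zero_of_gen {D : R.carrier →ₗ[K] R.carrier}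
    (hD : ∀ n, ∀ x ∈ (R.pow n).sub, D x ∈ (R.pow n).sub) (gen : ∀ v, D (R.gen v) = 0)
    (mul : ∀ i, ∀ v ∈ R.V.gr i, ∀ b, ∃ a, D (R.gen v * b) = a * D b) (x : R.carrier) :
    D x = 0 := by
  refine eq_zero_of_mem_pow fun n => ?_
  induction n generalizing x with
  | zero => exact pow_mono (Nat.zero_le 1) (mem_pow_one _)
  | succ n ih =>
    -- From `D(R) ⊆ Rⁿ` follows `D(R) ⊆ Rⁿ⁺¹`: modulo a generator, which `D` kills, `x` lies in
    -- `R²`, and on products `D` has the form `a * D b` with `a` in `R¹`.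
    obtain ⟨v, hv⟩ := R.exists_gen_sub_mem x
    rw [← sub_add_cancel x (R.gen v), map_add, gen, add_zero]
    refine pow_succ_induction le_rfl (n + 1) (P := fun x => D x ∈ (R.pow (n + 1)).sub)
      ?_ ?_ (hD _) ?_ hv
    · simp
    · intro x y hx hy
      rw [map_add]
      exact Submodule.add_mem _ hx hy
    · intro i v hv b _
      obtain ⟨a, ha⟩ := mul i v hv b
      rw [ha, add_comm n 1]
      exact mul_mem_pow (mem_pow_one _) (ih b)

/-! ### Completeness -/

variable (R) in
theorem exists_limit {k : ℤ} (x : ℕ → R.carrier) (hx : ∀ n, x n ∈ R.gr k)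
    (h : ∀ n, x (n + 1) - x n ∈ (R.pow n).sub) :
    ∃ y ∈ R.gr k, ∀ n, y - x n ∈ (R.pow n).sub := by
  -- The coefficient of index `i` no longer changes from `x (i + 1)` on.
  obtain ⟨y, ⟨hy, e⟩, -⟩ := R.existsUnique_coeff k (fun i => R.coeff i (x (i + 1)))
    (R.coeff_zero_apply _) (fun i _ => R.coeff_mem i (hx _))
  refine ⟨y, hy, fun n => R.mem_pow.2 fun i hi => ?_⟩
  rw [map_sub, e, sub_eq_zero]
  obtain ⟨d, rfl⟩ := Nat.exists_eq_add_of_le hi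
  induction d with
  | zero => rfl
  | succ d ih =>
    rw [ih (by omega), eq_comm, ← sub_eq_zero, ← map_sub]
    exact R.mem_pow.1 (h (i + 1 + d)) i (by omega)

/-- Successive approximation: an operator which is unipotent on a closed subspace is surjective
there. -/
theorem exists_preimage {T : R.carrier →ₗ[K] R.carrier} {X : Submodule K R.carrier}
    (closed : ∀ x, (∀ n, ∃ y ∈ X, x - y ∈ (R.pow n).sub) → x ∈ X)
    (hgr : ∀ k, ∀ x ∈ R.gr k, T x ∈ R.gr k) (hX : ∀ x ∈ X, T x ∈ X)
    (hpow : ∀ n, ∀ x ∈ (R.pow n).sub, T x ∈ (R.pow n).sub)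
    (hT : ∀ n, ∀ x ∈ X, x ∈ (R.pow n).sub → T x - x ∈ (R.pow (n + 1)).sub)
    {k : ℤ} {z : R.carrier} (hz : z ∈ X) (hzk : z ∈ R.gr k) :
    ∃ x ∈ X, x ∈ R.gr k ∧ T x = z := by
  -- Neumann iteration: each step adds the current error. The new error is `(1 - T)` of the old one,
  -- hence one order higher.
  let s : ℕ → R.carrier := fun n => Nat.rec 0 (fun _ x => x + (z - T x)) n
  have hs : ∀ n, s (n + 1) = s n + (z - T (s n)) := fun n => rfl
  have hsX : ∀ n, s n ∈ X ∧ s n ∈ R.gr k := by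
    intro n
    induction n with
    | zero => exact ⟨Submodule.zero_mem _, Submodule.zero_mem _⟩
    | succ n ih =>
      rw [hs]
      exact ⟨Submodule.add_mem _ ih.1 (Submodule.sub_mem _ hz (hX _ ih.1)),
        Submodule.add_mem _ ih.2 (Submodule.sub_mem _ hzk (hgr _ _ ih.2))⟩
  have hsT : ∀ n, z - T (s n) ∈ (R.pow n).sub := by
    intro n
    induction n with
    | zero => exact pow_mono (Nat.zero_le 1) (mem_pow_one _)
    | succ n ih =>
      have e : z - T (s (n + 1)) = -(T (z - T (s n)) - (z - T (s n))) := by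
        rw [hs, map_add]; abel
      rw [e]
      exact Submodule.neg_mem _ (hT n _ (Submodule.sub_mem _ hz (hX _ (hsX n).1)) ih)
  obtain ⟨x, hxk, hx⟩ := R.exists_limit s (fun n => (hsX n).2) (fun n => by
    rw [hs, add_sub_cancel_left]; exact hsT n)
  refine ⟨x, closed x fun n => ⟨s n, (hsX n).1, hx n⟩, hxk, ?_⟩
  rw [← sub_eq_zero]
  refine eq_zero_of_mem_pow fun n => ?_
  have e : T x - z = T (x - s n) - (z - T (s n)) := by rw [map_sub]; abel
  rw [e]
  exact Submodule.sub_mem _ (hpow _ _ (hx n)) (hsT n)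

/-- A kernel element climbs through every `Rⁿ` and so vanishes; surjectivity is `exists_preimage` on
the whole space. -/
theorem exists_inverse {φ : R.carrier →ₗ[K] R.carrier}
    (hgr : ∀ k, ∀ x ∈ R.gr k, φ x ∈ R.gr k)
    (hφ : ∀ n, ∀ x ∈ (R.pow n).sub, φ x - x ∈ (R.pow (n + 1)).sub) :
    ∃ ψ : R.carrier →ₗ[K] R.carrier, (∀ x, φ (ψ x) = x) ∧ (∀ x, ψ (φ x) = x) ∧
      (∀ k, ∀ x ∈ R.gr k, ψ x ∈ R.gr k) ∧ ∀ n, ∀ x ∈ (R.pow n).sub, ψ x ∈ (R.pow n).sub := by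
  have hinj : Function.Injective φ := by
    rw [injective_iff_map_eq_zero]
    intro x hx
    refine eq_zero_of_mem_pow fun n => ?_
    induction n with
    | zero => exact pow_mono (Nat.zero_le 1) (mem_pow_one _)
    | succ n ih => simpa [hx] using hφ n x ih
  have hpre : ∀ k, ∀ z ∈ R.gr k, ∃ x ∈ R.gr k, φ x = z := by
    intro k z hz
    obtain ⟨x, -, hx⟩ := exists_preimage (T := φ) (X := ⊤) (fun _ _ => trivial) hgr
      (fun _ _ => trivial) (fun n x hx => by
        rw [← sub_add_cancel (φ x) x]
        exact Submodule.add_mem _ (pow_mono (by omega) (hφ n x hx)) hx)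
      (fun n x _ => hφ n x) (z := z) trivial hz
    exact ⟨x, hx⟩
  have hsurj : Function.Surjective φ := by
    intro z
    induction z using R.toDGAlg.homog_induction with
    | mem k z hz =>
      obtain ⟨x, -, hx⟩ := hpre k z hz
      exact ⟨x, hx⟩
    | zero => exact ⟨0, map_zero _⟩
    | add y z hy hz =>
      obtain ⟨y', rfl⟩ := hy
      obtain ⟨z', rfl⟩ := hz
      exact ⟨y' + z', map_add _ _ _⟩
  let e := LinearEquiv.ofBijective φ ⟨hinj, hsurj⟩
  have h1 : ∀ x, φ (e.symm x) = x := e.apply_symm_apply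
  have h2 : ∀ x, e.symm (φ x) = x := e.symm_apply_apply
  refine ⟨e.symm.toLinearMap, h1, h2, ?_, ?_⟩
  · intro k z hz
    obtain ⟨x, hx, rfl⟩ := hpre k z hz
    change e.symm (φ x) ∈ _
    rwa [h2]
  · intro n z hz
    change e.symm z ∈ _
    -- With `x = φ⁻¹ z`, the identity `x = z - (φ x - x)` moves `x` up one order at a time until
    -- that of `z` is reached.
    suffices ∀ m ≤ n, e.symm z ∈ (R.pow m).sub from this n le_rfl
    intro m
    induction m with
    | zero => exact fun _ => pow_mono (Nat.zero_le 1) (mem_pow_one _)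
    | succ m ih =>
      intro hm
      have := hφ m _ (ih (by omega))
      rw [h1] at this
      rw [← sub_sub_cancel z (e.symm z)]
      exact Submodule.sub_mem _ (pow_mono hm hz) this

end CompleteQuasismooth

namespace DGAlg

variable {K : Type u} [Field K]

/-! ### Forms with coefficients in an algebra with zero product and zero differential -/

theorem forms_mul_eq_zero (B : DGAlg K) (hmul : ∀ a b : B.carrier, a * b = 0) (x y : B.Forms) :
    x * y = 0 := by
  have h : ∀ p q : B.Poly, p * q = 0 := by
    intro p q
    induction p using TensorProduct.induction_on with
    | zero => rw [zero_mul]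
    | add p p' h h' => rw [add_mul, h, h', add_zero]
    | tmul p a =>
      induction q using TensorProduct.induction_on with
      | zero => rw [mul_zero]
      | add q q' h h' => rw [mul_add, h, h', add_zero]
      | tmul q b => rw [poly_mul_tmul, hmul, TensorProduct.tmul_zero]
  apply forms_ext
  · rw [forms_mul_fst, h, forms_zero_fst]
  · rw [forms_mul_snd, h, h, add_zero, forms_zero_snd]

theorem sgn_sgn (A : DGAlg K) (a : A.carrier) : A.sgn (A.sgn a) = a := by
  induction a using A.homog_induction with
  | zero => simp
  | add a b ha hb => rw [map_add, map_add, ha, hb]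
  | mem i a ha =>
    rw [A.sgn_of_mem ha, Units.smul_def, map_zsmul, A.sgn_of_mem ha, Units.smul_def, smul_smul,
      ← Units.val_mul, ← Int.negOnePow_add, Int.negOnePow_even _ ⟨i, rfl⟩, Units.val_one,
      one_smul]

theorem poly_sgn_sgn (A : DGAlg K) (x : A.Poly) : A.polyMap A.sgn (A.polyMap A.sgn x) = x := by
  induction x using TensorProduct.induction_on with
  | zero => simp
  | add x y hx hy => rw [map_add, map_add, hx, hy]
  | tmul p a => rw [polyMap_tmul, polyMap_tmul, sgn_sgn]

/-- A polynomial in characteristic zero with vanishing derivative has equal values at `0`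
and `1`. -/
theorem polyEval_eq_of_polyDeriv [CharZero K] (A : DGAlg K) {x : A.Poly}
    (hx : A.polyDeriv x = 0) : A.polyEval 0 x = A.polyEval 1 x := by
  -- `Λ` is integration over `[0,1]`, sending `tⁱ` to `1/(i+1)`; here characteristic `0` enters.
  let Λ : K[X] →ₗ[K] K := Polynomial.lsum fun i => ((i : K) + 1)⁻¹ • LinearMap.id
  have hΛ : ∀ p : K[X], Λ (Polynomial.derivative p) = p.eval 1 - p.eval 0 := by
    intro p
    induction p using Polynomial.induction_on' with
    | add p q hp hq => simp only [map_add, Polynomial.eval_add, hp, hq]; ring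
    | monomial n a =>
      rw [Polynomial.derivative_monomial]
      rcases n with _ | n
      · simp
      · have : (n : K) + 1 ≠ 0 := by exact_mod_cast n.succ_ne_zero
        simp [Λ, Polynomial.lsum_apply, Polynomial.sum_monomial_index]
        field_simp
  let Θ : A.Poly →ₗ[K] A.carrier := TensorProduct.lift
    (LinearMap.toSpanSingleton K (A.carrier →ₗ[K] A.carrier) LinearMap.id ∘ₗ Λ)
  have hΘ : ∀ y : A.Poly, Θ (A.polyDeriv y) = A.polyEval 1 y - A.polyEval 0 y := by
    intro y
    induction y using TensorProduct.induction_on with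
    | zero => simp
    | add y z hy hz => simp only [map_add, hy, hz]; abel
    | tmul p a =>
      rw [polyDeriv_tmul, polyEval_tmul, polyEval_tmul, ← sub_smul, ← hΛ]
      simp [Θ]
  rw [eq_comm, ← sub_eq_zero, ← hΘ, hx, map_zero]

theorem quotMk_eq_zero {A : DGAlg K} {I : A.DGIdeal} {a : A.carrier} :
    A.quotMk I a = 0 ↔ a ∈ I.sub :=
  Submodule.Quotient.mk_eq_zero I.sub

theorem quot_mul_eq_zero {A : DGAlg K} {I : A.DGIdeal} (h : ∀ a b : A.carrier, a * b ∈ I.sub)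
    (x y : (A.quot I).carrier) : x * y = 0 := by
  obtain ⟨a, rfl⟩ := A.quotMk_surjective I x
  obtain ⟨b, rfl⟩ := A.quotMk_surjective I y
  exact quotMk_eq_zero.2 (h a b)

theorem quot_d_eq_zero {A : DGAlg K} {I : A.DGIdeal} (h : ∀ a : A.carrier, A.d a ∈ I.sub)
    (x : (A.quot I).carrier) : (A.quot I).d x = 0 := by
  obtain ⟨a, rfl⟩ := A.quotMk_surjective I x
  exact quotMk_eq_zero.2 (h a)

end DGAlg

namespace CompleteQuasismooth

variable {K : Type u} [Field K]

/-! ### Homotopies between minimal algebras are trivial in first order -/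

/-- `H` kills `S²`, since its values have zero products and it is continuous. Minimality then gives
`H(dx) = 0`, and as `B` has no differential the `dt`-part of `d(Hx) = 0` says that the
`t`-derivative of the function part vanishes. -/
theorem Homotopic.eq_of_isMinimal [CharZero K] {S : CompleteQuasismooth K} (hS : S.IsMinimal)
    {B : DGAlg K} (hmul : ∀ a b : B.carrier, a * b = 0) (hd : ∀ a, B.d a = 0)
    {f g : DGAlg.Hom S.toDGAlg B} (h : S.Homotopic f g) : f = g := by
  obtain ⟨H, ⟨m, hm⟩, rfl, rfl⟩ := h
  have hH : ∀ x ∈ (S.pow 2).sub, H.toLin x = 0 := by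
    intro x hx
    refine pow_succ_induction le_rfl m (P := fun x => H.toLin x = 0) (map_zero _) ?_ hm ?_ hx
    · intro x y hx hy
      rw [map_add, hx, hy, add_zero]
    · intro i v _ b _
      rw [H.map_mul]
      exact B.forms_mul_eq_zero hmul _ _
  have hd' : ∀ p : B.Poly, B.polyMap B.d p = 0 := by
    intro p
    rw [show B.d = 0 from LinearMap.ext hd]
    exact B.polyMap_zero p
  ext x
  have h2 : B.formsD (H.toLin x) = 0 := (H.map_d x).symm.trans (hH _ (hS x))
  have h3 := congrArg Prod.snd h2
  change B.polyMap B.sgn (B.polyDeriv (H.toLin x).1) + B.polyMap B.d (H.toLin x).2 = 0 at h3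
  rw [hd', add_zero] at h3
  have h4 : B.polyDeriv (H.toLin x).1 = 0 := by rw [← B.poly_sgn_sgn (B.polyDeriv _), h3, map_zero]
  exact B.polyEval_eq_of_polyDeriv h4

/-- Only the truncation `n = 2` is needed: `R/R²` has zero product and, by minimality, zero
differential, so there homotopic maps are equal. -/
theorem Mor.sub_mem_pow_two_of_prohomotopic [CharZero K] {R : CompleteQuasismooth K}
    (hR : R.IsMinimal) {φ : Mor R R} (h : φ.Prohomotopic (Mor.id R)) (x : R.carrier) :
    φ.toLin x - x ∈ (R.pow 2).sub := by
  have key : ∀ {f g : DGAlg.Hom R.toDGAlg (R.toDGAlg.quot (R.pow 2))},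
      R.HomotopyEquivalent f g → f = g := by
    intro f g hfg
    induction hfg with
    | rel f g hfg =>
      exact hfg.eq_of_isMinimal hR
        (DGAlg.quot_mul_eq_zero fun a b => mul_mem_pow (mem_pow_one a) (mem_pow_one b))
        (DGAlg.quot_d_eq_zero hR)
    | refl => rfl
    | symm _ _ _ h => exact h.symm
    | trans _ _ _ _ _ h h' => exact h.trans h'
  have := congrArg (fun f => DGAlg.Hom.toLin f x) (key (h 2))
  exact DGAlg.quotMk_eq.1 this

theorem Mor.exists_inverse_of_sub_mem {R : CompleteQuasismooth K} (φ : Mor R R)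
    (h : ∀ x, φ.toLin x - x ∈ (R.pow 2).sub) :
    ∃ ψ : Mor R R, φ.comp ψ = Mor.id R ∧ ψ.comp φ = Mor.id R := by
  obtain ⟨ψ, h1, h2, hgr, hpow⟩ := exists_inverse (fun k x => φ.map_mem)
    (hom_sub_mem_pow_succ φ.map_mul φ.continuous h)
  have hinj : Function.Injective φ.toLin := Function.LeftInverse.injective h2
  refine ⟨⟨⟨ψ, ?_, fun hx => hgr _ _ hx, ?_⟩, fun n => ⟨n, hpow n⟩⟩, ?_, ?_⟩
  · intro a b
    apply hinj
    rw [φ.map_mul, h1, h1, h1]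
  · intro a
    apply hinj
    rw [φ.map_d, h1, h1]
  · ext x; exact h1 x
  · ext x; exact h2 x

theorem ProhomotopyEquivalent.isomorphic [CharZero K] {R S : CompleteQuasismooth K}
    (hR : R.IsMinimal) (hS : S.IsMinimal) (h : R.ProhomotopyEquivalent S) : R.Isomorphic S := by
  obtain ⟨f, g, hgf, hfg⟩ := h
  obtain ⟨α, -, hα⟩ := (g.comp f).exists_inverse_of_sub_mem
    (Mor.sub_mem_pow_two_of_prohomotopic hR hgf)
  obtain ⟨β, hβ, -⟩ := (f.comp g).exists_inverse_of_sub_mem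
    (Mor.sub_mem_pow_two_of_prohomotopic hS hfg)
  -- `αg` is a left inverse of `f` and `gβ` is a right inverse, so they agree.
  have e : α.comp g = g.comp β := by
    calc α.comp g = (α.comp g).comp ((f.comp g).comp β) := by rw [hβ]; rfl
      _ = (α.comp (g.comp f)).comp (g.comp β) := rfl
      _ = g.comp β := by rw [hα]; rfl
  refine ⟨f, g.comp β, ?_, hβ⟩
  rw [← e]
  exact hα

theorem Isomorphic.prohomotopyEquivalent {R S : CompleteQuasismooth K} (h : R.Isomorphic S) :
    R.ProhomotopyEquivalent S := by
  obtain ⟨f, g, hgf, hfg⟩ := h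
  refine ⟨f, g, fun n => ?_, fun n => ?_⟩
  · rw [hgf]; exact Relation.EqvGen.refl _
  · rw [hfg]; exact Relation.EqvGen.refl _

end CompleteQuasismooth

namespace GradedSpace

variable {K : Type u} [Field K]

/-! ### Functoriality of the graded symmetric algebra -/

/-- The algebra map of graded symmetric algebras induced by a linear map of degree `0`. -/
def symMap {V W : GradedSpace K} (f : V.carrier →ₗ[K] W.carrier)
    (hf : ∀ k, ∀ v ∈ V.gr k, f v ∈ W.gr k) : V.Sym →ₐ[K] W.Sym :=
  V.symLift (W.symι ∘ₗ f) fun i j v w hv hw => W.symι_comm (hf i v hv) (hf j w hw)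

theorem symMap_ι {V W : GradedSpace K} (f : V.carrier →ₗ[K] W.carrier)
    (hf : ∀ k, ∀ v ∈ V.gr k, f v ∈ W.gr k) (v : V.carrier) :
    symMap f hf (V.symι v) = W.symι (f v) :=
  V.symLift_ι _ _ v

theorem symMap_mem {V W : GradedSpace K} (f : V.carrier →ₗ[K] W.carrier)
    (hf : ∀ k, ∀ v ∈ V.gr k, f v ∈ W.gr k) {n : ℕ} {k : ℤ} {x : V.Sym}
    (hx : x ∈ V.symPiece n k) : symMap f hf x ∈ W.symPiece n k := by
  refine symPiece_induction (P := fun n k x => symMap f hf x ∈ W.symPiece n k) ?_ ?_ ?_ ?_ ?_ hx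
  · intro n k
    rw [map_zero]; exact Submodule.zero_mem _
  · intro n k x y hx hy
    rw [map_add]; exact Submodule.add_mem _ hx hy
  · intro n k c x hx
    rw [map_smul]; exact Submodule.smul_mem _ c hx
  · rw [map_one]; exact W.one_mem_symPiece
  · intro n i k v x hv _ hx
    rw [map_mul, symMap_ι]
    exact ι_mul_mem_symPiece (hf i v hv) hx

variable (V : GradedSpace K)

theorem exists_sign : ∃ s : V.carrier →ₗ[K] V.carrier, ∀ k, ∀ v ∈ V.gr k, s v = k.negOnePow • v := by
  obtain ⟨s, hs⟩ := V.exists_linearMap_of_pieces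
    fun k => ((k.negOnePow : ℤ) : K) • (V.gr k).subtype
  refine ⟨s, fun k v hv => ?_⟩
  rw [hs k v hv, Units.smul_def, LinearMap.smul_apply, Int.cast_smul_eq_zsmul]
  rfl

/-- The operator `v ↦ (-1)^{deg v} v`. -/
def sign : V.carrier →ₗ[K] V.carrier := Classical.choose V.exists_sign

variable {V} in
theorem sign_of_mem {k : ℤ} {v : V.carrier} (hv : v ∈ V.gr k) : V.sign v = k.negOnePow • v :=
  Classical.choose_spec V.exists_sign k v hv

theorem sign_mem (k : ℤ) (v : V.carrier) (hv : v ∈ V.gr k) : V.sign v ∈ V.gr k := by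
  rw [sign_of_mem hv, Units.smul_def]
  exact zsmul_mem hv _

/-- The operator `x ↦ (-1)^{deg x} x` on the graded symmetric algebra. -/
def symSign : V.Sym →ₐ[K] V.Sym := symMap V.sign V.sign_mem

variable {V} in
theorem symSign_ι {k : ℤ} {v : V.carrier} (hv : v ∈ V.gr k) :
    V.symSign (V.symι v) = k.negOnePow • V.symι v := by
  rw [symSign, symMap_ι, sign_of_mem hv, Units.smul_def, Units.smul_def, map_zsmul]

variable {V} in
theorem symSign_of_mem {n : ℕ} {k : ℤ} {x : V.Sym} (hx : x ∈ V.symPiece n k) :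
    V.symSign x = k.negOnePow • x := by
  refine symPiece_induction (P := fun n k x => V.symSign x = k.negOnePow • x) ?_ ?_ ?_ ?_ ?_ hx
  · intro n k
    rw [map_zero, smul_zero]
  · intro n k x y hx hy
    rw [map_add, hx, hy, smul_add]
  · intro n k c x hx
    rw [map_smul, hx, Units.smul_def, Units.smul_def, smul_comm]
  · rw [map_one, Int.negOnePow_zero, one_smul]
  · intro n i k v x hv _ hx
    rw [map_mul, symSign_ι hv, hx, Units.smul_def, Units.smul_def, smul_mul_smul_comm,
      ← Units.val_mul, ← Int.negOnePow_add, Units.smul_def]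

/-! ### Derivations of the graded symmetric algebra -/

/-- A derivation twisted by `s` is the corner entry of an algebra map `x ↦ [[s x, D x], [0, x]]`
into upper triangular matrices. Freeness reduces its existence to the Koszul relations on
generators, and `hη` is the corner entry of those. -/
theorem exists_twistedDerivation (s : V.Sym →ₐ[K] V.Sym) (η : V.carrier →ₗ[K] V.Sym)
    (hη : ∀ i j v w, v ∈ V.gr i → w ∈ V.gr j →
      s (V.symι v) * η w + η v * V.symι w =
        (i * j).negOnePow • (s (V.symι w) * η v + η w * V.symι v)) :
    ∃ D : V.Sym →ₗ[K] V.Sym, (∀ v, D (V.symι v) = η v) ∧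
      ∀ x y, D (x * y) = D x * y + s x * D y := by
  let φ : V.carrier →ₗ[K] Matrix (Fin 2) (Fin 2) V.Sym :=
    { toFun := fun v => !![s (V.symι v), η v; 0, V.symι v]
      map_add' := fun v w => by simp [map_add]
      map_smul' := fun c v => by simp [map_smul] }
  have hφ : ∀ v, φ v = !![s (V.symι v), η v; 0, V.symι v] := fun v => rfl
  let F := V.symLift φ (by
    intro i j v w hv hw
    have h1 := V.symι_comm hv hw
    have h2 : s (V.symι v) * s (V.symι w) =
        (i * j).negOnePow • (s (V.symι w) * s (V.symι v)) := by
      rw [← map_mul, h1, Units.smul_def, map_zsmul, map_mul, Units.smul_def]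
    have h3 := hη i j v w hv hw
    rw [Units.smul_def] at *
    rw [hφ, hφ, Matrix.mul_fin_two, Matrix.mul_fin_two]
    ext a b
    fin_cases a <;> fin_cases b <;> simp [h1, h2, h3])
  have hFι : ∀ v, F (V.symι v) = φ v := V.symLift_ι φ _
  have hF : ∀ x, F x 0 0 = s x ∧ F x 1 0 = 0 ∧ F x 1 1 = x := by
    intro x
    induction x using V.sym_induction with
    | algebraMap c =>
      rw [AlgHom.commutes, AlgHom.commutes, Matrix.algebraMap_eq_diagonal]
      simp
    | ι i v hv => simp [hFι, hφ]
    | mul x y hx hy => simp [Matrix.mul_apply, Fin.sum_univ_two, hx, hy]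
    | add x y hx hy => simp [hx, hy]
  refine ⟨{ toFun := fun x => F x 0 1, map_add' := fun x y => by simp,
            map_smul' := fun c x => by simp }, fun v => ?_, fun x y => ?_⟩
  · change F (V.symι v) 0 1 = η v
    rw [hFι, hφ]
    simp
  · change F (x * y) 0 1 = F x 0 1 * y + s x * F y 0 1
    rw [map_mul, Matrix.mul_apply, Fin.sum_univ_two, (hF x).1, (hF y).2.2, add_comm]

section Derivation

variable {V} {s : V.Sym →ₐ[K] V.Sym} {D : V.Sym →ₗ[K] V.Sym}

theorem derivation_one (hD : ∀ x y, D (x * y) = D x * y + s x * D y) : D 1 = 0 := by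
  have h := hD 1 1
  rw [map_one s, mul_one, mul_one, one_mul] at h
  exact left_eq_add.1 h

theorem derivation_algebraMap (hD : ∀ x y, D (x * y) = D x * y + s x * D y) (c : K) :
    D (algebraMap K V.Sym c) = 0 := by
  rw [Algebra.algebraMap_eq_smul_one, map_smul, derivation_one hD, smul_zero]

theorem derivation_mem (hD : ∀ x y, D (x * y) = D x * y + s x * D y) {δ : ℤ}
    (hs : ∀ k, ∀ v ∈ V.gr k, s (V.symι v) ∈ V.symPiece 1 k)
    (hδ : ∀ k, ∀ v ∈ V.gr k, D (V.symι v) ∈ V.symPiece 1 (k + δ))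
    {n : ℕ} {k : ℤ} {x : V.Sym} (hx : x ∈ V.symPiece n k) : D x ∈ V.symPiece n (k + δ) := by
  refine symPiece_induction (P := fun n k x => D x ∈ V.symPiece n (k + δ)) ?_ ?_ ?_ ?_ ?_ hx
  · intro n k
    rw [map_zero]; exact Submodule.zero_mem _
  · intro n k x y hx hy
    rw [map_add]; exact Submodule.add_mem _ hx hy
  · intro n k c x hx
    rw [map_smul]; exact Submodule.smul_mem _ c hx
  · rw [derivation_one hD]; exact Submodule.zero_mem _
  · intro n i k v x hv hx hx'
    rw [hD]
    refine Submodule.add_mem _ ?_ ?_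
    · have := mul_mem_symPiece (hδ i v hv) hx
      rwa [add_comm 1 n, add_right_comm i δ k] at this
    · have := mul_mem_symPiece (hs i v hv) hx'
      rwa [add_comm 1 n, ← add_assoc] at this

end Derivation

/-- The extension of an operator of degree `-1` to an antiderivation. -/
theorem exists_antiderivation (η : V.carrier →ₗ[K] V.carrier)
    (hη : ∀ k, ∀ v ∈ V.gr k, η v ∈ V.gr (k - 1)) :
    ∃ D : V.Sym →ₗ[K] V.Sym, (∀ v, D (V.symι v) = V.symι (η v)) ∧
      ∀ x y, D (x * y) = D x * y + V.symSign x * D y := by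
  refine V.exists_twistedDerivation V.symSign (V.symι ∘ₗ η) ?_
  intro i j v w hv hw
  simp only [LinearMap.comp_apply]
  rw [symSign_ι hv, symSign_ι hw, V.symι_comm (hη i v hv) hw, smul_mul_assoc, smul_mul_assoc,
    V.symι_comm hv (hη j w hw), smul_add, smul_smul, smul_smul, ← Int.negOnePow_add,
    ← Int.negOnePow_add, add_comm]
  congr 2
  · rw [Int.negOnePow_eq_iff]
    exact ⟨-j, by ring⟩
  · congr 1; ring

/-! ### Weights

A projection `P` of `V` gives the weight grading of the graded symmetric algebra for which the
image of `P` has weight `0` and its kernel has weight `1`. -/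

section Weight

variable {V} (P : V.carrier →ₗ[K] V.carrier) (hP : ∀ k, ∀ v ∈ V.gr k, P v ∈ V.gr k)

/-- The algebra map `v ↦ P v + (v - P v) X`. -/
def weightHom : V.Sym →ₐ[K] (V.Sym)[X] :=
  V.symLift
    { toFun := fun v => Polynomial.monomial 0 (V.symι (P v)) +
        Polynomial.monomial 1 (V.symι (v - P v))
      map_add' := fun v w => by
        simp only [map_add, add_sub_add_comm]; abel
      map_smul' := fun c v => by
        simp only [map_smul, ← smul_sub, ← Polynomial.smul_monomial, smul_add, RingHom.id_apply] }
    (by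
      intro i j v w hv hw
      have hv' := Submodule.sub_mem _ hv (hP i v hv)
      have hw' := Submodule.sub_mem _ hw (hP j w hw)
      simp only [LinearMap.coe_mk, AddHom.coe_mk, add_mul, mul_add,
        Polynomial.monomial_mul_monomial, V.symι_comm (hP i v hv) (hP j w hw),
        V.symι_comm (hP i v hv) hw', V.symι_comm hv' (hP j w hw), V.symι_comm hv' hw',
        Units.smul_def, smul_add, map_zsmul]
      abel)

theorem weightHom_ι (v : V.carrier) : weightHom P hP (V.symι v) =
    Polynomial.monomial 0 (V.symι (P v)) + Polynomial.monomial 1 (V.symι (v - P v)) :=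
  V.symLift_ι _ _ v

/-- The component of weight `j`. -/
def weight (j : ℕ) : V.Sym →ₗ[K] V.Sym where
  toFun x := (weightHom P hP x).coeff j
  map_add' x y := by simp
  map_smul' c x := by simp

theorem weight_apply (j : ℕ) (x : V.Sym) : weight P hP j x = (weightHom P hP x).coeff j := rfl

theorem weight_mul (k : ℕ) (x y : V.Sym) : weight P hP k (x * y) =
    ∑ p ∈ Finset.HasAntidiagonal.antidiagonal k, weight P hP p.1 x * weight P hP p.2 y := by
  simp only [weight_apply, map_mul, Polynomial.coeff_mul]

theorem weight_ι (j : ℕ) (v : V.carrier) : weight P hP j (V.symι v) =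
    if j = 0 then V.symι (P v) else if j = 1 then V.symι (v - P v) else 0 := by
  rw [weight_apply, weightHom_ι, Polynomial.coeff_add, Polynomial.coeff_monomial,
    Polynomial.coeff_monomial]
  rcases j with _ | _ | j <;> simp

theorem weight_algebraMap (j : ℕ) (c : K) : weight P hP j (algebraMap K V.Sym c) =
    if j = 0 then algebraMap K V.Sym c else 0 := by
  rw [weight_apply, AlgHom.commutes, Polynomial.algebraMap_apply, Polynomial.coeff_C]

theorem weight_zero_mul (x y : V.Sym) :
    weight P hP 0 (x * y) = weight P hP 0 x * weight P hP 0 y := by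
  rw [weight_mul]; simp

theorem weight_mem (j : ℕ) {n : ℕ} {k : ℤ} {x : V.Sym} (hx : x ∈ V.symPiece n k) :
    weight P hP j x ∈ V.symPiece n k := by
  revert j
  refine symPiece_induction (P := fun n k x => ∀ j, weight P hP j x ∈ V.symPiece n k)
    ?_ ?_ ?_ ?_ ?_ hx
  · intro n k j
    rw [map_zero]; exact Submodule.zero_mem _
  · intro n k x y hx hy j
    rw [map_add]; exact Submodule.add_mem _ (hx j) (hy j)
  · intro n k c x hx j
    rw [map_smul]; exact Submodule.smul_mem _ c (hx j)
  · intro j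
    rw [← map_one (algebraMap K V.Sym), weight_algebraMap, map_one]
    split_ifs
    · exact V.one_mem_symPiece
    · exact Submodule.zero_mem _
  · intro n i k v x hv _ hx j
    rw [weight_mul]
    refine Submodule.sum_mem _ fun p _ => ?_
    rw [weight_ι]
    split_ifs
    · exact ι_mul_mem_symPiece (hP i v hv) (hx _)
    · exact ι_mul_mem_symPiece (Submodule.sub_mem _ hv (hP i v hv)) (hx _)
    · rw [zero_mul]; exact Submodule.zero_mem _

/-- Each factor contributes weight at most one. Hence weight sums are finite on `⊙ⁿ V`, and elements
of weight `j` in the completion lie in `Rʲ`. -/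
theorem natDegree_weightHom_le {n : ℕ} {k : ℤ} {x : V.Sym} (hx : x ∈ V.symPiece n k) :
    (weightHom P hP x).natDegree ≤ n := by
  refine symPiece_induction (P := fun n k x => (weightHom P hP x).natDegree ≤ n)
    ?_ ?_ ?_ ?_ ?_ hx
  · intro n k; simp
  · intro n k x y hx hy
    rw [map_add]
    exact (Polynomial.natDegree_add_le _ _).trans (max_le hx hy)
  · intro n k c x hx
    rw [map_smul]
    exact (Polynomial.natDegree_smul_le _ _).trans hx
  · simp
  · intro n i k v x _ _ hx
    rw [map_mul, weightHom_ι, add_comm n 1]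
    refine Polynomial.natDegree_mul_le_of_le ?_ hx
    exact (Polynomial.natDegree_add_le _ _).trans
      (max_le ((Polynomial.natDegree_monomial_le _).trans (by omega))
        (Polynomial.natDegree_monomial_le _))

theorem weight_eq_zero {j n : ℕ} {k : ℤ} {x : V.Sym} (hx : x ∈ V.symPiece n k) (hj : n < j) :
    weight P hP j x = 0 :=
  Polynomial.coeff_eq_zero_of_natDegree_lt ((natDegree_weightHom_le P hP hx).trans_lt hj)

/-- The operator which multiplies the component of weight `j` by `c j`. -/
def weightSum (c : ℕ → K) : V.Sym →ₗ[K] V.Sym :=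
  Polynomial.lsum (fun j => c j • (LinearMap.id : V.Sym →ₗ[K] V.Sym)) ∘ₗ (weightHom P hP).toLinearMap

theorem weightSum_eq (c : ℕ → K) {m n : ℕ} {k : ℤ} {x : V.Sym} (hx : x ∈ V.symPiece n k)
    (hn : n < m) : weightSum P hP c x = ∑ j ∈ Finset.range m, c j • weight P hP j x := by
  change (weightHom P hP x).sum _ = _
  rw [Polynomial.sum_over_range' _ _ m ((natDegree_weightHom_le P hP hx).trans_lt hn)]
  · rfl
  · intro j; simp

/-- Summing coefficients is evaluation at `X = 1`. It is multiplicative, and `P v + (v - P v) = v`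
shows that the composite fixes generators. -/
theorem weightSum_one (x : V.Sym) : weightSum P hP (fun _ => 1) x = x := by
  have key : ∀ f : (V.Sym)[X], Polynomial.lsum
      (fun _ => (1 : K) • (LinearMap.id : V.Sym →ₗ[K] V.Sym)) f = f.sum fun _ a => a := by
    intro f
    simp [Polynomial.lsum_apply]
  have hlin : ∀ f g : (V.Sym)[X], (f * g).sum (fun _ a => a) =
      f.sum (fun _ a => a) * g.sum (fun _ a => a) := by
    intro f g
    simp only [← key]
    induction f using Polynomial.induction_on' with
    | add f f' h h' => rw [add_mul, map_add, map_add, add_mul, h, h']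
    | monomial i a =>
      induction g using Polynomial.induction_on' with
      | add g g' h h' => rw [mul_add, map_add, map_add, mul_add, h, h']
      | monomial j b =>
        rw [Polynomial.monomial_mul_monomial]
        simp [Polynomial.lsum_apply, Polynomial.sum_monomial_index]
  change Polynomial.lsum (fun _ => (1 : K) • (LinearMap.id : V.Sym →ₗ[K] V.Sym))
    (weightHom P hP x) = x
  induction x using V.sym_induction with
  | algebraMap c =>
    rw [AlgHom.commutes, Polynomial.algebraMap_apply, key, Polynomial.sum_C_index]
    rfl
  | ι i v hv =>
    rw [weightHom_ι, map_add, key, key, Polynomial.sum_monomial_index _ _ rfl,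
      Polynomial.sum_monomial_index _ _ rfl, ← map_add, add_sub_cancel]
  | mul x y hx hy =>
    rw [map_mul, key, hlin, ← key, ← key, hx, hy]
  | add x y hx hy => rw [map_add, map_add, hx, hy]

theorem sum_weight {m n : ℕ} {k : ℤ} {x : V.Sym} (hx : x ∈ V.symPiece n k) (hn : n < m) :
    ∑ j ∈ Finset.range m, weight P hP j x = x := by
  conv_rhs => rw [← weightSum_one P hP x, weightSum_eq P hP _ hx hn]
  simp

/-- Weight components are homogeneous for the weight grading. On generators this is the idempotence
of `P`, and it passes to products. -/
theorem weightHom_weight (hPP : ∀ v, P (P v) = P v) (x : V.Sym) (j : ℕ) :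
    weightHom P hP (weight P hP j x) = Polynomial.monomial j (weight P hP j x) := by
  induction x using V.sym_induction generalizing j with
  | algebraMap c =>
    rw [weight_algebraMap]
    split_ifs with h
    · rw [h, AlgHom.commutes]; rfl
    · simp
  | ι i v hv =>
    rw [weight_ι]
    split_ifs with h h'
    · rw [h, weightHom_ι, hPP, sub_self]; simp
    · rw [h', weightHom_ι, map_sub, hPP, sub_self]; simp
    · simp
  | mul x y hx hy =>
    rw [weight_mul, map_sum, map_sum]
    refine Finset.sum_congr rfl fun p hp => ?_
    rw [map_mul, hx, hy, Polynomial.monomial_mul_monomial,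
      Finset.HasAntidiagonal.mem_antidiagonal.1 hp]
  | add x y hx hy => rw [map_add, map_add, map_add, hx, hy]

theorem weight_weight (hPP : ∀ v, P (P v) = P v) (x : V.Sym) (i j : ℕ) :
    weight P hP i (weight P hP j x) = if i = j then weight P hP j x else 0 := by
  rw [weight_apply, weightHom_weight P hP hPP, Polynomial.coeff_monomial]
  simp only [eq_comm]

theorem weightSum_weight (hPP : ∀ v, P (P v) = P v) (c : ℕ → K) (x : V.Sym) (j : ℕ) :
    weightSum P hP c (weight P hP j x) = c j • weight P hP j x := by
  change (weightHom P hP (weight P hP j x)).sum _ = _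
  rw [weightHom_weight P hP hPP, Polynomial.sum_monomial_index _ _ (by simp)]
  rfl

theorem weight_zero_eq_symMap (x : V.Sym) : weight P hP 0 x = symMap P hP x := by
  induction x using V.sym_induction with
  | algebraMap c => rw [weight_algebraMap, if_pos rfl, AlgHom.commutes]
  | ι i v hv => rw [weight_ι, if_pos rfl, symMap_ι]
  | mul x y hx hy => rw [weight_zero_mul, hx, hy, map_mul]
  | add x y hx hy => rw [map_add, map_add, hx, hy]

theorem weight_symSign (j : ℕ) {n : ℕ} {k : ℤ} {x : V.Sym} (hx : x ∈ V.symPiece n k) :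
    weight P hP j (V.symSign x) = V.symSign (weight P hP j x) := by
  rw [symSign_of_mem hx, symSign_of_mem (weight_mem P hP j hx), Units.smul_def, map_zsmul,
    Units.smul_def]

end Weight

end GradedSpace

/-! ### The Euler derivation and antiderivations in the weight grading -/

namespace GradedSpace

variable {K : Type u} [Field K] {V : GradedSpace K}
  (P : V.carrier →ₗ[K] V.carrier) (hP : ∀ k, ∀ v ∈ V.gr k, P v ∈ V.gr k)

/-- This operator is `X d/dX` followed by `X = 1`, hence a derivation: the Euler operator counting
factors outside `im P`. -/
theorem weightSum_natCast_mul (x y : V.Sym) :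
    weightSum P hP (fun j => (j : K)) (x * y) =
      weightSum P hP (fun j => (j : K)) x * y + x * weightSum P hP (fun j => (j : K)) y := by
  let ev : (V.Sym)[X] →ₗ[K] V.Sym := Polynomial.lsum fun _ => (1 : K) • LinearMap.id
  let E : (V.Sym)[X] →ₗ[K] V.Sym := Polynomial.lsum fun j => (j : K) • LinearMap.id
  have hev : ∀ x, ev (weightHom P hP x) = x := weightSum_one P hP
  have key : ∀ f g : (V.Sym)[X], E (f * g) = E f * ev g + ev f * E g := by
    intro f g
    induction f using Polynomial.induction_on' with
    | add f f' h h' => rw [add_mul, map_add, map_add, map_add, add_mul, add_mul, h, h']; abel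
    | monomial i a =>
      induction g using Polynomial.induction_on' with
      | add g g' h h' => rw [mul_add, map_add, map_add, map_add, mul_add, mul_add, h, h']; abel
      | monomial j b =>
        rw [Polynomial.monomial_mul_monomial]
        simp [E, ev, Polynomial.lsum_apply, Polynomial.sum_monomial_index, add_smul]
  change E (weightHom P hP (x * y)) = E (weightHom P hP x) * y + x * E (weightHom P hP y)
  rw [map_mul, key, hev, hev]

theorem weightSum_ι (c : ℕ → K) (v : V.carrier) :
    weightSum P hP c (V.symι v) = c 0 • V.symι (P v) + c 1 • V.symι (v - P v) := by
  change Polynomial.lsum (fun j => c j • (LinearMap.id : V.Sym →ₗ[K] V.Sym))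
    (weightHom P hP (V.symι v)) = _
  rw [weightHom_ι, map_add, Polynomial.lsum_apply, Polynomial.lsum_apply,
    Polynomial.sum_monomial_index _ _ (by simp), Polynomial.sum_monomial_index _ _ (by simp)]
  rfl

section Antiderivation

variable {η : V.carrier →ₗ[K] V.carrier} {D : V.Sym →ₗ[K] V.Sym}

/-- Since `Pη = 0` and `ηP = 0`, the map `η` kills generators of weight `0` and keeps those of
weight `1` in weight `1`; the Leibniz rule does the rest. -/
theorem weight_antiderivation (hι : ∀ v, D (V.symι v) = V.symι (η v))
    (hD : ∀ x y, D (x * y) = D x * y + V.symSign x * D y)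
    (hPη : ∀ v, P (η v) = 0) (hηP : ∀ v, η (P v) = 0) (x : V.Sym) (j : ℕ) :
    weight P hP j (D x) = D (weight P hP j x) := by
  have hs : ∀ (x : V.Sym) (j : ℕ), weight P hP j (V.symSign x) = V.symSign (weight P hP j x) := by
    intro x
    induction x using V.sym_induction with
    | algebraMap c =>
      intro j
      rw [AlgHom.commutes, weight_algebraMap]
      split_ifs
      · rw [AlgHom.commutes]
      · rw [map_zero]
    | ι i v hv => exact fun j => weight_symSign P hP j (ι_mem_symPiece hv)
    | mul x y hx hy =>
      intro j
      simp only [map_mul, weight_mul, hx, hy, map_sum]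
    | add x y hx hy => intro j; simp only [map_add, hx, hy]
  induction x using V.sym_induction generalizing j with
  | algebraMap c =>
    rw [derivation_algebraMap hD, map_zero, weight_algebraMap]
    split_ifs
    · rw [derivation_algebraMap hD]
    · rw [map_zero]
  | ι i v hv =>
    rw [hι, weight_ι, weight_ι, hPη, sub_zero]
    split_ifs
    · rw [hι, hηP]
    · rw [hι, map_sub, hηP, sub_zero]
    · rw [map_zero]
  | mul x y hx hy =>
    rw [hD, map_add, weight_mul, weight_mul, weight_mul, map_sum, ← Finset.sum_add_distrib]
    refine Finset.sum_congr rfl fun p _ => ?_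
    rw [hx, hy, hs, hD]
  | add x y hx hy => rw [map_add, map_add, map_add, map_add, hx, hy]

/-- Weight `0` is multiplicative and kills `η v`, so every term of the Leibniz expansion has a
factor without weight zero part. -/
theorem weight_zero_antiderivation (hι : ∀ v, D (V.symι v) = V.symι (η v))
    (hD : ∀ x y, D (x * y) = D x * y + V.symSign x * D y)
    (hPη : ∀ v, P (η v) = 0) (x : V.Sym) : weight P hP 0 (D x) = 0 := by
  induction x using V.sym_induction with
  | algebraMap c => rw [derivation_algebraMap hD, map_zero]
  | ι i v hv => rw [hι, weight_ι, if_pos rfl, hPη, map_zero]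
  | mul x y hx hy =>
    rw [hD, map_add, weight_zero_mul, weight_zero_mul, hx, hy, zero_mul, mul_zero, add_zero]
  | add x y hx hy => rw [map_add, map_add, hx, hy, add_zero]

theorem antiderivation_symSign (hη : ∀ k, ∀ v ∈ V.gr k, η v ∈ V.gr (k - 1))
    (hι : ∀ v, D (V.symι v) = V.symι (η v))
    (hD : ∀ x y, D (x * y) = D x * y + V.symSign x * D y) (x : V.Sym) :
    D (V.symSign x) = -V.symSign (D x) := by
  induction x using V.sym_induction with
  | algebraMap c => rw [AlgHom.commutes, derivation_algebraMap hD, map_zero, neg_zero]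
  | ι i v hv =>
    rw [symSign_ι hv, Units.smul_def, map_zsmul, hι, symSign_ι (hη i v hv), Int.negOnePow_sub,
      Int.negOnePow_one, mul_neg, mul_one, Units.smul_def, Units.val_neg, neg_smul, neg_neg]
  | mul x y hx hy =>
    rw [map_mul, hD, hD, hx, hy, map_add, map_mul, map_mul, neg_mul, mul_neg, neg_add]
  | add x y hx hy => rw [map_add, map_add, map_add, map_add, hx, hy, neg_add]

theorem antiderivation_antiderivation (hη : ∀ k, ∀ v ∈ V.gr k, η v ∈ V.gr (k - 1))
    (hηη : ∀ v, η (η v) = 0) (hι : ∀ v, D (V.symι v) = V.symι (η v))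
    (hD : ∀ x y, D (x * y) = D x * y + V.symSign x * D y) (x : V.Sym) : D (D x) = 0 := by
  induction x using V.sym_induction with
  | algebraMap c => rw [derivation_algebraMap hD, map_zero]
  | ι i v hv => rw [hι, hι, hηη, map_zero]
  | mul x y hx hy =>
    rw [hD, map_add, hD, hD, hx, hy, antiderivation_symSign hη hι hD]
    simp
  | add x y hx hy => rw [map_add, map_add, hx, hy, add_zero]

end Antiderivation

end GradedSpace

namespace CompleteQuasismooth

open GradedSpace

variable {K : Type u} [Field K] (R : CompleteQuasismooth K)

/-! ### Coefficientwise operators -/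

/-- Apply an operator on the graded symmetric algebra to all coefficients. -/
def mapSym (δ : ℤ) (T : R.V.Sym →ₗ[K] R.V.Sym)
    (hT : ∀ n k, ∀ x ∈ R.V.symPiece n k, T x ∈ R.V.symPiece n (k + δ)) :
    R.carrier →ₗ[K] R.carrier :=
  Classical.choose (R.exists_linearMap_of_sym δ T hT)

section MapSym

variable {R} {δ : ℤ} {T : R.V.Sym →ₗ[K] R.V.Sym}
  {hT : ∀ n k, ∀ x ∈ R.V.symPiece n k, T x ∈ R.V.symPiece n (k + δ)}

theorem coeff_mapSym (n : ℕ) (r : R.carrier) :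
    R.coeff n (R.mapSym δ T hT r) = T (R.coeff n r) :=
  (Classical.choose_spec (R.exists_linearMap_of_sym δ T hT)).1 n r

theorem mapSym_mem {k : ℤ} {r : R.carrier} (hr : r ∈ R.gr k) : R.mapSym δ T hT r ∈ R.gr (k + δ) :=
  (Classical.choose_spec (R.exists_linearMap_of_sym δ T hT)).2 k r hr

theorem mapSym_mem_pow {n : ℕ} {r : R.carrier} (hr : r ∈ (R.pow n).sub) :
    R.mapSym δ T hT r ∈ (R.pow n).sub := by
  rw [mem_pow] at hr ⊢
  intro i hi
  rw [coeff_mapSym, hr i hi, map_zero]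

theorem mapSym_gen {v w : R.V.carrier} (h : T (R.V.symι v) = R.V.symι w) :
    R.mapSym δ T hT (R.gen v) = R.gen w := by
  refine R.ext_coeff fun n => ?_
  rw [coeff_mapSym, coeff_gen, coeff_gen]
  split_ifs
  · exact h
  · exact map_zero _

end MapSym

variable {R} in
-- A coefficient of a general element is a finite sum of elements of the pieces of `⊙ⁿ V`, so bounds
-- and identities known on the pieces apply to it.
theorem linearMap_coeff_ext {M : Type*} [AddCommGroup M] [Module K M] {n : ℕ}
    {T T' : R.V.Sym →ₗ[K] M} (h : ∀ k, ∀ x ∈ R.V.symPiece n k, T x = T' x) (r : R.carrier) :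
    T (R.coeff n r) = T' (R.coeff n r) := by
  induction r using R.toDGAlg.homog_induction with
  | mem k r hr => exact h k _ (R.coeff_mem n hr)
  | zero => rw [map_zero, map_zero, map_zero]
  | add r s hr hs => rw [map_add, map_add, map_add, hr, hs]

theorem coeff_sgn (n : ℕ) (r : R.carrier) :
    R.coeff n (R.toDGAlg.sgn r) = R.V.symSign (R.coeff n r) := by
  induction r using R.toDGAlg.homog_induction with
  | mem k r hr =>
    rw [R.toDGAlg.sgn_of_mem hr, symSign_of_mem (R.coeff_mem n hr), Units.smul_def, map_zsmul,
      Units.smul_def]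
  | zero => simp only [map_zero]
  | add r s hr hs => simp only [map_add, hr, hs]

/-! ### Weights -/

section Weight

variable {R} (P : R.V.carrier →ₗ[K] R.V.carrier) (hP : ∀ k, ∀ v ∈ R.V.gr k, P v ∈ R.V.gr k)

/-- The component of weight `j` for the weight grading given by a projection of the space of
generators. -/
def wt (j : ℕ) : R.carrier →ₗ[K] R.carrier :=
  R.mapSym 0 (weight P hP j) fun n k x hx => by
    rw [add_zero]; exact weight_mem P hP j hx

/-- The operator which multiplies the component of weight `j` by `c j`. -/
def wtSum (c : ℕ → K) : R.carrier →ₗ[K] R.carrier :=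
  R.mapSym 0 (weightSum P hP c) fun n k x hx => by
    rw [add_zero, weightSum_eq P hP c hx n.lt_succ_self]
    exact Submodule.sum_mem _ fun j _ => Submodule.smul_mem _ _ (weight_mem P hP j hx)

theorem coeff_wt (j n : ℕ) (r : R.carrier) :
    R.coeff n (wt P hP j r) = weight P hP j (R.coeff n r) := coeff_mapSym n r

theorem coeff_wtSum (c : ℕ → K) (n : ℕ) (r : R.carrier) :
    R.coeff n (wtSum P hP c r) = weightSum P hP c (R.coeff n r) := coeff_mapSym n r

theorem wt_mem (j : ℕ) {k : ℤ} {r : R.carrier} (hr : r ∈ R.gr k) : wt P hP j r ∈ R.gr k := by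
  have := mapSym_mem (δ := 0) (T := weight P hP j) (hT := fun n k x hx => by
    rw [add_zero]; exact weight_mem P hP j hx) hr
  rwa [add_zero] at this

theorem wtSum_mem (c : ℕ → K) {k : ℤ} {r : R.carrier} (hr : r ∈ R.gr k) :
    wtSum P hP c r ∈ R.gr k := by
  have := mapSym_mem (δ := 0) (T := weightSum P hP c) (hT := fun n k x hx => by
    rw [add_zero, weightSum_eq P hP c hx n.lt_succ_self]
    exact Submodule.sum_mem _ fun j _ => Submodule.smul_mem _ _ (weight_mem P hP j hx)) hr
  rwa [add_zero] at this

theorem wt_mem_pow (j : ℕ) {n : ℕ} {r : R.carrier} (hr : r ∈ (R.pow n).sub) :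
    wt P hP j r ∈ (R.pow n).sub := mapSym_mem_pow hr

theorem wtSum_mem_pow (c : ℕ → K) {n : ℕ} {r : R.carrier} (hr : r ∈ (R.pow n).sub) :
    wtSum P hP c r ∈ (R.pow n).sub := mapSym_mem_pow hr

theorem wt_mem_pow_self (j : ℕ) (r : R.carrier) : wt P hP j r ∈ (R.pow j).sub := by
  rw [mem_pow]
  intro i hi
  rw [coeff_wt]
  exact linearMap_coeff_ext (T' := 0) (fun k x hx => weight_eq_zero P hP hx hi) r

/-- Coefficients of index below `n` have weights below `n` only. This replaces the infinite weight
decomposition by finite ones, modulo `Rⁿ`. -/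
theorem sub_sum_wt_mem (n : ℕ) (r : R.carrier) :
    r - ∑ j ∈ Finset.range n, wt P hP j r ∈ (R.pow n).sub := by
  rw [mem_pow]
  intro i hi
  rw [map_sub, map_sum, sub_eq_zero]
  simp only [coeff_wt]
  have := linearMap_coeff_ext (R := R) (n := i) (T := LinearMap.id)
    (T' := ∑ j ∈ Finset.range n, weight P hP j) (fun k x hx => by
      rw [LinearMap.sum_apply, sum_weight P hP hx hi]; rfl) r
  rw [LinearMap.sum_apply] at this
  exact this

theorem wt_mul (k : ℕ) (r s : R.carrier) : wt P hP k (r * s) =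
    ∑ p ∈ Finset.HasAntidiagonal.antidiagonal k, wt P hP p.1 r * wt P hP p.2 s := by
  refine R.ext_coeff fun n => ?_
  rw [coeff_wt, R.coeff_mul, map_sum, map_sum]
  simp only [weight_mul, R.coeff_mul, coeff_wt]
  exact Finset.sum_comm

theorem wt_zero_mul (r s : R.carrier) : wt P hP 0 (r * s) = wt P hP 0 r * wt P hP 0 s := by
  rw [wt_mul]; simp

theorem wt_zero_gen (v : R.V.carrier) : wt P hP 0 (R.gen v) = R.gen (P v) :=
  mapSym_gen (by rw [weight_ι, if_pos rfl])

theorem wt_wt (hPP : ∀ v, P (P v) = P v) (i j : ℕ) (r : R.carrier) :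
    wt P hP i (wt P hP j r) = if i = j then wt P hP j r else 0 := by
  refine R.ext_coeff fun n => ?_
  rw [coeff_wt, coeff_wt, weight_weight P hP hPP]
  split_ifs
  · rw [coeff_wt]
  · rw [map_zero]

theorem wtSum_wt (hPP : ∀ v, P (P v) = P v) (c : ℕ → K) (j : ℕ) (r : R.carrier) :
    wtSum P hP c (wt P hP j r) = c j • wt P hP j r := by
  refine R.ext_coeff fun n => ?_
  rw [coeff_wtSum, coeff_wt, weightSum_weight P hP hPP, map_smul, coeff_wt]

theorem wt_wtSum (hPP : ∀ v, P (P v) = P v) (c : ℕ → K) (j : ℕ) (r : R.carrier) :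
    wt P hP j (wtSum P hP c r) = c j • wt P hP j r := by
  refine R.ext_coeff fun n => ?_
  rw [coeff_wt, coeff_wtSum, map_smul, coeff_wt]
  refine linearMap_coeff_ext (T := weight P hP j ∘ₗ weightSum P hP c)
    (T' := c j • weight P hP j) (fun k x hx => ?_) r
  rw [LinearMap.comp_apply, weightSum_eq P hP c hx (m := max (n + 1) (j + 1)) (by omega), map_sum]
  simp only [map_smul, weight_weight P hP hPP, LinearMap.smul_apply]
  rw [Finset.sum_eq_single j]
  · rw [if_pos rfl]
  · intro i _ hij
    rw [if_neg hij.symm, smul_zero]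
  · intro h
    exact absurd (Finset.mem_range.2 (by omega)) h

theorem wtSum_natCast_mul (r s : R.carrier) : wtSum P hP (fun j => (j : K)) (r * s) =
    wtSum P hP (fun j => (j : K)) r * s + r * wtSum P hP (fun j => (j : K)) s := by
  refine R.ext_coeff fun n => ?_
  rw [coeff_wtSum, R.coeff_mul, map_sum, map_add, R.coeff_mul, R.coeff_mul,
    ← Finset.sum_add_distrib]
  refine Finset.sum_congr rfl fun p _ => ?_
  rw [weightSum_natCast_mul, coeff_wtSum, coeff_wtSum]

theorem wtSum_natCast_gen (v : R.V.carrier) :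
    wtSum P hP (fun j => (j : K)) (R.gen v) = R.gen (v - P v) :=
  mapSym_gen (by rw [weightSum_ι]; simp)

/-- The Euler operator is inverted weight by weight; the convention `0⁻¹ = 0` is harmless because
there is no weight zero component. -/
theorem wtSum_wtSum_inv [CharZero K] (r : R.carrier) (h : wt P hP 0 r = 0)
    (hPP : ∀ v, P (P v) = P v) :
    wtSum P hP (fun j => (j : K)) (wtSum P hP (fun j => (j : K)⁻¹) r) = r := by
  have key : ∀ j, wt P hP j (wtSum P hP (fun j => (j : K)) (wtSum P hP (fun j => (j : K)⁻¹) r)) =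
      wt P hP j r := by
    intro j
    rw [wt_wtSum P hP hPP, wt_wtSum P hP hPP, smul_smul]
    rcases Nat.eq_zero_or_pos j with rfl | hj
    · rw [h, smul_zero]
    · rw [mul_inv_cancel₀ (Nat.cast_ne_zero.2 hj.ne'), one_smul]
  rw [← sub_eq_zero]
  refine eq_zero_of_mem_pow fun n => ?_
  have h' := sub_sum_wt_mem P hP n
    (wtSum P hP (fun j => (j : K)) (wtSum P hP (fun j => (j : K)⁻¹) r) - r)
  simpa only [map_sub, key, sub_self, Finset.sum_const_zero, sub_zero] using h'

/-- A filtered operator commuting with the weight operator preserves weights. -/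
theorem wt_comm [CharZero K] (hPP : ∀ v, P (P v) = P v) {T : R.carrier →ₗ[K] R.carrier}
    (hT : ∀ n, ∀ r ∈ (R.pow n).sub, T r ∈ (R.pow n).sub)
    (comm : ∀ r, wtSum P hP (fun j => (j : K)) (T r) = T (wtSum P hP (fun j => (j : K)) r))
    (i : ℕ) (r : R.carrier) : wt P hP i (T r) = T (wt P hP i r) := by
  -- `T` of a weight `j` element is an eigenvector of the Euler operator with eigenvalue `j`, while
  -- its weight `i` component has eigenvalue `i`; these differ in characteristic `0`.
  have h1 : ∀ i j, i ≠ j → wt P hP i (T (wt P hP j r)) = 0 := by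
    intro i j hij
    have e := wt_wtSum P hP hPP (fun j => (j : K)) i (T (wt P hP j r))
    rw [comm, wtSum_wt P hP hPP, map_smul, map_smul, eq_comm, ← sub_eq_zero, ← sub_smul,
      smul_eq_zero, sub_eq_zero] at e
    exact e.resolve_left fun h => hij (Nat.cast_injective h)
  have h2 : ∀ j, wt P hP j (T (wt P hP j r)) = T (wt P hP j r) := by
    intro j
    rw [eq_comm, ← sub_eq_zero]
    refine eq_zero_of_mem_pow fun n => ?_
    have h := sub_sum_wt_mem P hP (max n (j + 1)) (T (wt P hP j r))
    rw [Finset.sum_eq_single j] at h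
    · exact pow_mono (le_max_left _ _) h
    · exact fun i _ hij => h1 i j hij
    · intro h; exact absurd (Finset.mem_range.2 (by omega)) h
  rw [← sub_eq_zero]
  refine eq_zero_of_mem_pow fun n => ?_
  have h := wt_mem_pow P hP i (hT _ _ (sub_sum_wt_mem P hP (max n (i + 1)) r))
  rw [map_sub, map_sub, map_sum, map_sum, Finset.sum_eq_single i, h2] at h
  · exact pow_mono (le_max_left _ _) h
  · exact fun j _ hij => h1 i j hij.symm
  · intro h; exact absurd (Finset.mem_range.2 (by omega)) h

/-- The antiderivation extending `η` is applied coefficient by coefficient. `η² = 0` gives `h² = 0`,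
and `Pη = ηP = 0` makes `h` compatible with weights. -/
theorem exists_homotopyOperator {η : R.V.carrier →ₗ[K] R.V.carrier}
    (hη : ∀ k, ∀ v ∈ R.V.gr k, η v ∈ R.V.gr (k - 1)) (hηη : ∀ v, η (η v) = 0)
    (hPη : ∀ v, P (η v) = 0) (hηP : ∀ v, η (P v) = 0) :
    ∃ h : R.carrier →ₗ[K] R.carrier, (∀ k, ∀ r ∈ R.gr k, h r ∈ R.gr (k - 1)) ∧
      (∀ n, ∀ r ∈ (R.pow n).sub, h r ∈ (R.pow n).sub) ∧
      (∀ r s, h (r * s) = h r * s + R.toDGAlg.sgn r * h s) ∧ (∀ r, h (h r) = 0) ∧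
      (∀ v, h (R.gen v) = R.gen (η v)) ∧ (∀ r, wt P hP 0 (h r) = 0) ∧
      ∀ c r, h (wtSum P hP c r) = wtSum P hP c (h r) := by
  obtain ⟨D, hι, hD⟩ := R.V.exists_antiderivation η hη
  have hmem : ∀ n k, ∀ x ∈ R.V.symPiece n k, D x ∈ R.V.symPiece n (k + -1) := by
    intro n k x hx
    refine derivation_mem hD ?_ ?_ hx
    · intro k v hv
      exact symMap_mem _ _ (ι_mem_symPiece hv)
    · intro k v hv
      rw [hι]
      exact ι_mem_symPiece (hη k v hv)
  refine ⟨R.mapSym (-1) D hmem, fun k r hr => mapSym_mem hr, fun n r => mapSym_mem_pow,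
    fun r s => ?_, fun r => ?_, fun v => mapSym_gen (hι v), fun r => ?_, fun c r => ?_⟩
  · refine R.ext_coeff fun n => ?_
    rw [coeff_mapSym, R.coeff_mul, map_sum, map_add, R.coeff_mul, R.coeff_mul,
      ← Finset.sum_add_distrib]
    refine Finset.sum_congr rfl fun p _ => ?_
    rw [hD, coeff_mapSym, coeff_mapSym, coeff_sgn]
  · refine R.eq_zero_of_coeff fun n => ?_
    rw [coeff_mapSym, coeff_mapSym, antiderivation_antiderivation hη hηη hι hD]
  · refine R.eq_zero_of_coeff fun n => ?_
    rw [coeff_wt, coeff_mapSym, weight_zero_antiderivation P hP hι hD hPη]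
  · refine R.ext_coeff fun n => ?_
    rw [coeff_mapSym, coeff_wtSum, coeff_wtSum, coeff_mapSym]
    refine linearMap_coeff_ext (T := D ∘ₗ weightSum P hP c) (T' := weightSum P hP c ∘ₗ D)
      (fun k x hx => ?_) r
    rw [LinearMap.comp_apply, LinearMap.comp_apply, weightSum_eq P hP c hx n.lt_succ_self,
      weightSum_eq P hP c (hmem n k x hx) n.lt_succ_self, map_sum]
    refine Finset.sum_congr rfl fun j _ => ?_
    rw [map_smul, weight_antiderivation P hP hι hD hPη hηP]

end Weight

end CompleteQuasismooth

/-- Truncated Cauchy products: the terms of the square outside the triangle vanish, so the square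
may be summed along antidiagonals. -/
theorem sum_range_antidiagonal {M : Type*} [AddCommMonoid M] (n : ℕ) (F : ℕ → ℕ → M)
    (h : ∀ i j, n ≤ i + j → F i j = 0) :
    ∑ k ∈ Finset.range n, ∑ p ∈ Finset.HasAntidiagonal.antidiagonal k, F p.1 p.2 =
      ∑ i ∈ Finset.range n, ∑ j ∈ Finset.range n, F i j := by
  rw [← Finset.sum_product', ← Finset.sum_filter_of_ne (p := fun p : ℕ × ℕ => p.1 + p.2 < n),
    ← Finset.sum_fiberwise_of_maps_to (g := fun p : ℕ × ℕ => p.1 + p.2) (t := Finset.range n)]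
  · refine Finset.sum_congr rfl fun k hk => Finset.sum_congr ?_ fun _ _ => rfl
    ext ⟨i, j⟩
    rw [Finset.mem_range] at hk
    simp only [Finset.HasAntidiagonal.mem_antidiagonal, Finset.mem_filter, Finset.mem_product,
      Finset.mem_range]
    omega
  · intro p hp
    exact Finset.mem_range.2 (Finset.mem_filter.1 hp).2
  · intro p _ hp
    by_contra hlt
    exact hp (h _ _ (not_lt.1 hlt))

namespace DGAlg

variable {K : Type u} [Field K]

/-- The linear map on a quotient induced by a linear map vanishing on the ideal. -/
def quotLift (A : DGAlg K) (I : A.DGIdeal) {M : Type*} [AddCommGroup M] [Module K M]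
    (f : A.carrier →ₗ[K] M) (hf : ∀ x ∈ I.sub, f x = 0) : A.QuotCarrier I →ₗ[K] M :=
  I.sub.liftQ f hf

theorem quot_sgn (A : DGAlg K) (I : A.DGIdeal) (a : A.carrier) :
    (A.quot I).sgn (A.quotMk I a) = A.quotMk I (A.sgn a) := by
  induction a using A.homog_induction with
  | zero => simp only [map_zero]; exact map_zero (A.quot I).sgn
  | add a b ha hb =>
    rw [map_add, map_add, map_add, ← ha, ← hb]
    exact map_add (A.quot I).sgn _ _
  | mem k a ha =>
    rw [A.sgn_of_mem ha, Units.smul_def, map_zsmul]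
    exact (A.quot I).sgn_of_mem ⟨a, ha, rfl⟩

end DGAlg

/-! ### The homotopy contracting onto weight zero -/

namespace CompleteQuasismooth

open GradedSpace

variable {K : Type u} [Field K] {R : CompleteQuasismooth K}

theorem sgn_mem_pow {n : ℕ} {r : R.carrier} (hr : r ∈ (R.pow n).sub) :
    R.toDGAlg.sgn r ∈ (R.pow n).sub := by
  rw [mem_pow] at hr ⊢
  intro i hi
  rw [coeff_sgn, hr i hi, map_zero]

/-- The homotopy `r ↦ ∑ⱼ tʲ rⱼ + tʲ⁻¹ (± h rⱼ) dt` contracting a weight grading for which the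
weight operator is the commutator of the differential with an antiderivation `h`. -/
theorem exists_weight_homotopy (n : ℕ) (W : ℕ → R.carrier →ₗ[K] R.carrier)
    (h : R.carrier →ₗ[K] R.carrier)
    (W_gr : ∀ j k, ∀ r ∈ R.gr k, W j r ∈ R.gr k)
    (W_pow : ∀ j n, ∀ r ∈ (R.pow n).sub, W j r ∈ (R.pow n).sub)
    (W_self : ∀ j r, W j r ∈ (R.pow j).sub)
    (W_sum : ∀ r, r - ∑ j ∈ Finset.range n, W j r ∈ (R.pow n).sub)
    (W_mul : ∀ k r s, W k (r * s) =
      ∑ p ∈ Finset.HasAntidiagonal.antidiagonal k, W p.1 r * W p.2 s)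
    (W_d : ∀ j r, W j (R.d r) = R.d (W j r))
    (h_gr : ∀ k, ∀ r ∈ R.gr k, h r ∈ R.gr (k - 1))
    (h_pow : ∀ n, ∀ r ∈ (R.pow n).sub, h r ∈ (R.pow n).sub)
    (h_mul : ∀ r s, h (r * s) = h r * s + R.toDGAlg.sgn r * h s)
    (h_zero : ∀ r, h (W 0 r) = 0)
    (h_d : ∀ j r, R.d (h (W j r)) + h (R.d (W j r)) = (j : K) • W j r) :
    ∃ H : DGAlg.Hom R.toDGAlg (R.toDGAlg.quot (R.pow n)).forms,
      (∀ x ∈ (R.pow n).sub, H.toLin x = 0) ∧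
      (∀ x, ((R.toDGAlg.quot (R.pow n)).eval 0).toLin (H.toLin x) =
        R.toDGAlg.quotMk (R.pow n) (W 0 x)) ∧
      ∀ x, ((R.toDGAlg.quot (R.pow n)).eval 1).toLin (H.toLin x) =
        R.toDGAlg.quotMk (R.pow n) x := by
  let B := R.toDGAlg.quot (R.pow n)
  let π : R.carrier →ₗ[K] B.carrier := R.toDGAlg.quotMk (R.pow n)
  have π_mul : ∀ a b, π (a * b) = π a * π b := fun a b => rfl
  have π_d : ∀ a, B.d (π a) = π (R.d a) := fun a => rfl
  have π_sgn : ∀ a, B.sgn (π a) = π (R.toDGAlg.sgn a) := R.toDGAlg.quot_sgn (R.pow n)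
  have π_gr : ∀ k, ∀ a ∈ R.gr k, π a ∈ B.gr k := fun k a ha => ⟨a, ha, rfl⟩
  have π_zero : ∀ a ∈ (R.pow n).sub, π a = 0 := fun a ha => DGAlg.quotMk_eq_zero.2 ha
  let σ := R.toDGAlg.sgn
  let p : R.carrier →ₗ[K] B.Poly := ∑ j ∈ Finset.range n,
    TensorProduct.mk K K[X] B.carrier (Polynomial.X ^ j) ∘ₗ π ∘ₗ W j
  -- The coefficient of `dt`; the sign operator comes from writing `dt` on the right. For `j = 0`
  -- the truncated exponent `j - 1` does no harm since `h` kills weight zero.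
  let q : R.carrier →ₗ[K] B.Poly := ∑ j ∈ Finset.range n,
    TensorProduct.mk K K[X] B.carrier (Polynomial.X ^ (j - 1)) ∘ₗ π ∘ₗ σ ∘ₗ h ∘ₗ W j
  have hp : ∀ r, p r = ∑ j ∈ Finset.range n,
      ((Polynomial.X ^ j : K[X]) ⊗ₜ[K] π (W j r) : B.Poly) := by
    intro r
    rw [LinearMap.sum_apply]; rfl
  have hq : ∀ r, q r = ∑ j ∈ Finset.range n,
      ((Polynomial.X ^ (j - 1) : K[X]) ⊗ₜ[K] π (σ (h (W j r))) : B.Poly) := by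
    intro r
    rw [LinearMap.sum_apply]; rfl
  have hσh : ∀ a b, σ (h (a * b)) = σ (h a) * σ b + a * σ (h b) := by
    intro a b
    rw [h_mul, map_add, R.toDGAlg.sgn_mul, R.toDGAlg.sgn_mul, R.toDGAlg.sgn_sgn]
  have p_mul : ∀ x y, p (x * y) = p x * p y := by
    intro x y
    rw [hp, hp, hp, Finset.sum_mul_sum]
    simp only [DGAlg.poly_mul_tmul, ← pow_add, ← π_mul]
    rw [← sum_range_antidiagonal n fun i j =>
      ((Polynomial.X ^ (i + j) : K[X]) ⊗ₜ[K] π (W i x * W j y) : B.Poly)]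
    · refine Finset.sum_congr rfl fun k _ => ?_
      rw [W_mul, map_sum, TensorProduct.tmul_sum]
      refine Finset.sum_congr rfl fun s hs => ?_
      rw [Finset.HasAntidiagonal.mem_antidiagonal.1 hs]
    -- A product of weights `i` and `j` with `i + j ≥ n` lies in `Rⁿ`, so it vanishes in the
    -- quotient.
    · intro i j hij
      rw [π_zero _ (pow_mono hij (mul_mem_pow (W_self i x) (W_self j y))),
        TensorProduct.tmul_zero]
  have q_mul : ∀ x y, q (x * y) = p x * q y + q x * B.polyMap B.sgn (p y) := by
    intro x y
    rw [hq, hp, hq, hq, hp, map_sum]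
    simp only [DGAlg.polyMap_tmul, π_sgn]
    rw [Finset.sum_mul_sum, Finset.sum_mul_sum, ← Finset.sum_add_distrib]
    simp only [← Finset.sum_add_distrib, DGAlg.poly_mul_tmul, ← π_mul, ← pow_add]
    rw [Finset.sum_congr rfl fun i _ => Finset.sum_congr rfl fun j _ => show
      ((Polynomial.X ^ (i + (j - 1)) : K[X]) ⊗ₜ[K] π (W i x * σ (h (W j y))) : B.Poly) +
        (Polynomial.X ^ (i - 1 + j) : K[X]) ⊗ₜ[K] π (σ (h (W i x)) * σ (W j y)) =
      (Polynomial.X ^ (i + j - 1) : K[X]) ⊗ₜ[K] π (σ (h (W i x * W j y))) from ?_]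
    · rw [← sum_range_antidiagonal n fun i j =>
        ((Polynomial.X ^ (i + j - 1) : K[X]) ⊗ₜ[K] π (σ (h (W i x * W j y))) : B.Poly)]
      · refine Finset.sum_congr rfl fun k _ => ?_
        rw [W_mul, map_sum, map_sum, map_sum, TensorProduct.tmul_sum]
        refine Finset.sum_congr rfl fun s hs => ?_
        rw [Finset.HasAntidiagonal.mem_antidiagonal.1 hs]
      · intro i j hij
        rw [π_zero _ (sgn_mem_pow (h_pow _ _
          (pow_mono hij (mul_mem_pow (W_self i x) (W_self j y))))), TensorProduct.tmul_zero]
    · rw [hσh, map_add, TensorProduct.tmul_add, add_comm]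
      congr 1
      -- For positive weight the exponents agree; in weight zero, where they may not, the term is
      -- zero.
      · rcases i with _ | i
        · rw [h_zero, map_zero, zero_mul, map_zero, TensorProduct.tmul_zero,
            TensorProduct.tmul_zero]
        · congr 2; omega
      · rcases j with _ | j
        · rw [h_zero, map_zero, mul_zero, map_zero, TensorProduct.tmul_zero,
            TensorProduct.tmul_zero]
        · congr 2
  have p_d : ∀ x, p (R.d x) = B.polyMap B.d (p x) := by
    intro x
    rw [hp, hp, map_sum]
    refine Finset.sum_congr rfl fun j _ => ?_
    rw [DGAlg.polyMap_tmul, π_d, W_d]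
  have q_d : ∀ x, q (R.d x) =
      B.polyMap B.sgn (B.polyDeriv (p x)) + B.polyMap B.d (q x) := by
    intro x
    rw [hp, hq, hq, map_sum, map_sum, map_sum, ← Finset.sum_add_distrib]
    refine Finset.sum_congr rfl fun j _ => ?_
    rw [DGAlg.polyDeriv_tmul, DGAlg.polyMap_tmul, DGAlg.polyMap_tmul, π_sgn, π_d,
      Polynomial.derivative_X_pow, ← Polynomial.smul_eq_C_mul, TensorProduct.smul_tmul,
      ← TensorProduct.tmul_add, ← map_smul, ← map_smul, ← map_add]
    congr 2
    -- The derivative of `tʲ` produces `j Wⱼ = (dh + hd) Wⱼ`; the `dh` term cancels against `d` of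
    -- the `dt`-part because `d` anticommutes with the sign.
    rw [← h_d, W_d, map_add, R.toDGAlg.d_sgn]
    abel
  refine ⟨{ toLin := LinearMap.prod p q, map_mul := ?_, map_mem := ?_, map_d := ?_ }, ?_, ?_, ?_⟩
  · intro x y
    exact DGAlg.forms_ext (p_mul x y) (q_mul x y)
  · intro k x hx
    refine ⟨?_, ?_⟩
    · change p x ∈ B.polyGr k
      rw [hp]
      exact Submodule.sum_mem _ fun j _ => B.tmul_mem_polyGr _ (π_gr _ _ (W_gr _ _ _ hx))
    · change q x ∈ B.polyGr (k - 1)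
      rw [hq]
      exact Submodule.sum_mem _ fun j _ => B.tmul_mem_polyGr _
        (π_gr _ _ (R.toDGAlg.sgn_mem (h_gr _ _ (W_gr _ _ _ hx))))
  · intro x
    exact DGAlg.forms_ext (p_d x) (q_d x)
  · intro x hx
    refine DGAlg.forms_ext ?_ ?_
    · change p x = 0
      rw [hp]
      exact Finset.sum_eq_zero fun j _ => by
        rw [π_zero _ (W_pow _ _ _ hx), TensorProduct.tmul_zero]
    · change q x = 0
      rw [hq]
      exact Finset.sum_eq_zero fun j _ => by
        rw [π_zero _ (sgn_mem_pow (h_pow _ _ (W_pow _ _ _ hx))), TensorProduct.tmul_zero]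
  · intro x
    change B.polyEval 0 (p x) = π (W 0 x)
    rw [hp, map_sum]
    simp only [DGAlg.polyEval_tmul, Polynomial.eval_pow, Polynomial.eval_X]
    -- For `n = 0` the sum is empty, but so is the quotient's content: `R⁰` is everything.
    rcases Nat.eq_zero_or_pos n with rfl | hn
    · rw [Finset.range_zero, Finset.sum_empty, π_zero _ (W_self 0 x)]
    · rw [Finset.sum_eq_single 0]
      · rw [pow_zero, one_smul]
      · intro j _ hj
        rw [zero_pow hj, zero_smul]
      · intro h; exact absurd (Finset.mem_range.2 hn) h
  · intro x
    change B.polyEval 1 (p x) = π x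
    rw [hp, map_sum]
    simp only [DGAlg.polyEval_tmul, Polynomial.eval_pow, Polynomial.eval_X, one_pow, one_smul]
    rw [← map_sum, eq_comm, ← sub_eq_zero, ← map_sub]
    exact π_zero _ (W_sum x)

end CompleteQuasismooth

/-! ### The graded symmetric algebra of the image of a projection -/

namespace GradedSpace

variable {K : Type u} [Field K] (V : GradedSpace K)

theorem exists_component (k : ℤ) : ∃ c : V.carrier →ₗ[K] V.carrier,
    (∀ v ∈ V.gr k, c v = v) ∧ (∀ i, i ≠ k → ∀ v ∈ V.gr i, c v = 0) ∧ ∀ v, c v ∈ V.gr k := by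
  obtain ⟨c, hc⟩ := V.exists_linearMap_of_pieces fun i => if i = k then (V.gr i).subtype else 0
  have h1 : ∀ v ∈ V.gr k, c v = v := fun v hv => by rw [hc k v hv, if_pos rfl]; rfl
  have h2 : ∀ i, i ≠ k → ∀ v ∈ V.gr i, c v = 0 := fun i hi v hv => by
    rw [hc i v hv, if_neg hi]; rfl
  refine ⟨c, h1, h2, fun v => ?_⟩
  induction v using V.homog_induction with
  | mem i v hv =>
    by_cases hi : i = k
    · subst hi
      rwa [h1 v hv]
    · rw [h2 i hi v hv]; exact Submodule.zero_mem _
  | zero => rw [map_zero]; exact Submodule.zero_mem _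
  | add v w hv hw => rw [map_add]; exact Submodule.add_mem _ hv hw

variable {V} (P : V.carrier →ₗ[K] V.carrier) (hP : ∀ k, ∀ v ∈ V.gr k, P v ∈ V.gr k)

/-- The image of an operator of degree `0`. -/
def range : GradedSpace K where
  carrier := LinearMap.range P
  gr k := (V.gr k).comap (LinearMap.range P).subtype
  isInternal := by
    choose c hc hc' hc'' using V.exists_component
    have hcP : ∀ k v, c k (P v) = P (c k v) := by
      intro k v
      induction v using V.homog_induction with
      | mem i v hv =>
        by_cases hi : i = k
        · subst hi
          rw [hc _ _ hv, hc _ _ (hP _ _ hv)]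
        · rw [hc' k i hi v hv, hc' k i hi _ (hP i v hv), map_zero]
      | zero => simp only [map_zero]
      | add v w hv hw => simp only [map_add, hv, hw]
    refine isInternal_of_proj _ (fun k => (c k).restrict (p := LinearMap.range P)
      (q := LinearMap.range P) ?_) ?_ ?_ ?_
    · rintro _ ⟨v, rfl⟩
      exact ⟨c k v, (hcP k v).symm⟩
    · intro k x hx
      exact Subtype.ext (hc k _ hx)
    · intro i j hij x hx
      exact Subtype.ext (hc' j i hij _ hx)
    · rw [eq_top_iff]
      rintro ⟨_, v, rfl⟩ -
      change P.rangeRestrict v ∈ _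
      induction v using V.homog_induction with
      | mem i v hv =>
        exact Submodule.mem_iSup_of_mem i (show P.rangeRestrict v ∈ (V.gr i).comap _ from hP i v hv)
      | zero => rw [map_zero]; exact Submodule.zero_mem _
      | add v w hv hw => rw [map_add]; exact Submodule.add_mem _ hv hw

/-- The inclusion of the image of an operator. -/
def rangeSubtype : (range P hP).carrier →ₗ[K] V.carrier := (LinearMap.range P).subtype

/-- The projection onto the image of an operator. -/
def toRange : V.carrier →ₗ[K] (range P hP).carrier := P.rangeRestrict

theorem rangeSubtype_toRange (v : V.carrier) : rangeSubtype P hP (toRange P hP v) = P v := rfl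

theorem rangeSubtype_injective : Function.Injective (rangeSubtype P hP) :=
  (LinearMap.range P).subtype_injective

/-- The inclusion of the graded symmetric algebra of the image of a projection. -/
def rangeInc : (range P hP).Sym →ₐ[K] V.Sym :=
  symMap (rangeSubtype P hP) fun _ _ hv => hv

/-- The projection onto the graded symmetric algebra of the image of a projection. -/
def rangeProj : V.Sym →ₐ[K] (range P hP).Sym :=
  symMap (toRange P hP) fun k v hv => hP k v hv

theorem rangeInc_ι (v : (range P hP).carrier) :
    rangeInc P hP ((range P hP).symι v) = V.symι (rangeSubtype P hP v) := symMap_ι _ _ v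

theorem rangeProj_ι (v : V.carrier) :
    rangeProj P hP (V.symι v) = (range P hP).symι (toRange P hP v) := symMap_ι _ _ v

theorem rangeInc_rangeProj (x : V.Sym) :
    rangeInc P hP (rangeProj P hP x) = weight P hP 0 x := by
  rw [weight_zero_eq_symMap]
  exact V.algHom_ext (f := (rangeInc P hP).comp (rangeProj P hP)) (g := symMap P hP)
    (fun i v _ => by
      rw [AlgHom.comp_apply, rangeProj_ι, rangeInc_ι, symMap_ι, rangeSubtype_toRange]) x

theorem rangeProj_rangeInc (hPP : ∀ v, P (P v) = P v) (x : (range P hP).Sym) :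
    rangeProj P hP (rangeInc P hP x) = x := by
  refine (range P hP).algHom_ext (f := (rangeProj P hP).comp (rangeInc P hP))
    (g := AlgHom.id K _) (fun i v _ => ?_) x
  rw [AlgHom.comp_apply, rangeInc_ι, rangeProj_ι, AlgHom.id_apply]
  congr 1
  refine rangeSubtype_injective P hP ?_
  rw [rangeSubtype_toRange]
  obtain ⟨_, w, rfl⟩ := v
  exact hPP w

theorem rangeProj_mem {n : ℕ} {k : ℤ} {x : V.Sym} (hx : x ∈ V.symPiece n k) :
    rangeProj P hP x ∈ (range P hP).symPiece n k := symMap_mem _ _ hx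

theorem rangeInc_mem {n : ℕ} {k : ℤ} {x : (range P hP).Sym}
    (hx : x ∈ (range P hP).symPiece n k) : rangeInc P hP x ∈ V.symPiece n k := symMap_mem _ _ hx

end GradedSpace

/-! ### The weight zero part and its minimality -/

namespace CompleteQuasismooth

open GradedSpace

variable {K : Type u} [Field K] {R : CompleteQuasismooth K}

section WeightZero

variable (P : R.V.carrier →ₗ[K] R.V.carrier) (hP : ∀ k, ∀ v ∈ R.V.gr k, P v ∈ R.V.gr k)

theorem rangeInc_rangeProj_coeff (n : ℕ) (r : R.carrier) :
    rangeInc P hP (rangeProj P hP (R.coeff n r)) = R.coeff n (wt P hP 0 r) := by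
  rw [rangeInc_rangeProj, coeff_wt]

theorem rangeProj_coeff_wt_zero (hPP : ∀ v, P (P v) = P v) (n : ℕ) (r : R.carrier) :
    rangeProj P hP (R.coeff n (wt P hP 0 r)) = rangeProj P hP (R.coeff n r) := by
  rw [← rangeInc_rangeProj_coeff, rangeProj_rangeInc P hP hPP]

/-- The projection to the symmetric algebra on `im P` sees exactly the weight zero component.
Therefore the quotient by the kernel of `wt P hP 0` has well-defined coefficients there. -/
theorem wt_zero_eq_zero_iff (hPP : ∀ v, P (P v) = P v) (r : R.carrier) :
    wt P hP 0 r = 0 ↔ ∀ n, rangeProj P hP (R.coeff n r) = 0 := by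
  constructor
  · intro h n
    rw [← rangeProj_coeff_wt_zero P hP hPP, h, map_zero, map_zero]
  · intro h
    refine R.eq_zero_of_coeff fun n => ?_
    rw [← rangeInc_rangeProj_coeff, h, map_zero]

theorem component_wt (j : ℕ) (k : ℤ) (r : R.carrier) :
    R.toDGAlg.component k (wt P hP j r) = wt P hP j (R.toDGAlg.component k r) := by
  induction r using R.toDGAlg.homog_induction with
  | mem i r hr =>
    by_cases hi : i = k
    · subst hi
      rw [R.toDGAlg.component_same hr, R.toDGAlg.component_same (wt_mem P hP j hr)]
    · rw [R.toDGAlg.component_ne hi hr, R.toDGAlg.component_ne hi (wt_mem P hP j hr), map_zero]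
  | zero => simp only [map_zero]
  | add r s hr hs => simp only [map_add, hr, hs]

variable (hd : ∀ r, wt P hP 0 (R.d r) = R.d (wt P hP 0 r))

/-- The ideal of elements without component of weight zero. -/
def weightIdeal : R.toDGAlg.DGIdeal where
  sub := LinearMap.ker (wt P hP 0)
  mul_left a x hx := by
    rw [LinearMap.mem_ker] at hx ⊢
    rw [wt_zero_mul, hx, mul_zero]
  mul_right a x hx := by
    rw [LinearMap.mem_ker] at hx ⊢
    rw [wt_zero_mul, hx, zero_mul]
  d_mem x hx := by
    rw [LinearMap.mem_ker] at hx ⊢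
    rw [hd, hx, map_zero]
  component_mem k x hx := by
    rw [LinearMap.mem_ker] at hx ⊢
    rw [← component_wt, hx, map_zero]

theorem mem_weightIdeal {x : R.carrier} :
    x ∈ (weightIdeal P hP hd).sub ↔ wt P hP 0 x = 0 := Iff.rfl

variable (hPP : ∀ v, P (P v) = P v)

/-- The weight zero part of a complete quasismooth algebra, as a quotient. -/
def weightZero : CompleteQuasismooth K where
  toDGAlg := R.toDGAlg.quot (weightIdeal P hP hd)
  V := range P hP
  coeff n := R.toDGAlg.quotLift (weightIdeal P hP hd)
    ((rangeProj P hP).toLinearMap ∘ₗ R.coeff n)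
    fun x hx => (wt_zero_eq_zero_iff P hP hPP x).1 hx n
  coeff_zero := by
    ext x
    obtain ⟨x, rfl⟩ := R.toDGAlg.quotMk_surjective _ x
    change rangeProj P hP (R.coeff 0 x) = 0
    rw [coeff_zero_apply, map_zero]
  coeff_mem := by
    rintro i k _ ⟨r, hr, rfl⟩
    exact rangeProj_mem P hP (R.coeff_mem i hr)
  coeff_mul n r s := by
    obtain ⟨r, rfl⟩ := R.toDGAlg.quotMk_surjective _ r
    obtain ⟨s, rfl⟩ := R.toDGAlg.quotMk_surjective _ s
    change rangeProj P hP (R.coeff n (r * s)) = ∑ p ∈ Finset.HasAntidiagonal.antidiagonal n,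
      rangeProj P hP (R.coeff p.1 r) * rangeProj P hP (R.coeff p.2 s)
    rw [R.coeff_mul, map_sum]
    simp only [map_mul]
  existsUnique_coeff k s hs0 hs := by
    -- Prescribed coefficients are lifted to `R` through the inclusion of symmetric algebras.
    obtain ⟨r, ⟨hr, e⟩, -⟩ := R.existsUnique_coeff k (fun n => rangeInc P hP (s n))
      (by simp only [hs0, map_zero]) (fun i hi => rangeInc_mem P hP (hs i hi))
    have e' : ∀ n, rangeProj P hP (R.coeff n r) = s n := fun n => by
      rw [e, rangeProj_rangeInc P hP hPP]
    refine ⟨R.toDGAlg.quotMk _ r, ⟨⟨r, hr, rfl⟩, e'⟩, ?_⟩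
    rintro _ ⟨⟨r', -, rfl⟩, h⟩
    refine DGAlg.quotMk_eq.2 ((wt_zero_eq_zero_iff P hP hPP _).2 fun n => ?_)
    rw [map_sub, map_sub, e', sub_eq_zero]
    exact h n
  coeff_d n r h i hi := by
    obtain ⟨r, rfl⟩ := R.toDGAlg.quotMk_surjective _ r
    change rangeProj P hP (R.coeff i (R.d r)) = 0
    -- The class is represented by its weight zero component, whose own low coefficients vanish, so
    -- the filtration condition in `R` applies.
    rw [← rangeProj_coeff_wt_zero P hP hPP, hd,
      R.coeff_d n (wt P hP 0 r) (fun j hj => ?_) i hi, map_zero]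
    rw [← rangeInc_rangeProj_coeff]
    exact (congrArg (rangeInc P hP) (h j hj)).trans (map_zero _)

/-- The projection onto the weight zero part. -/
def toWeightZero : Mor R (weightZero P hP hd hPP) where
  toHom := R.toDGAlg.quotHom (weightIdeal P hP hd)
  continuous n := ⟨n, fun x hx => by
    rw [mem_pow] at hx ⊢
    intro i hi
    exact (congrArg (rangeProj P hP) (hx i hi)).trans (map_zero _)⟩

/-- The inclusion of the weight zero part. -/
def ofWeightZero : Mor (weightZero P hP hd hPP) R where
  toLin := R.toDGAlg.quotLift (weightIdeal P hP hd) (wt P hP 0) fun x hx => hx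
  map_mul a b := by
    obtain ⟨a, rfl⟩ := R.toDGAlg.quotMk_surjective _ a
    obtain ⟨b, rfl⟩ := R.toDGAlg.quotMk_surjective _ b
    exact wt_zero_mul P hP a b
  map_mem := by
    rintro k _ ⟨a, ha, rfl⟩
    exact wt_mem P hP 0 ha
  map_d a := by
    obtain ⟨a, rfl⟩ := R.toDGAlg.quotMk_surjective _ a
    exact hd a
  continuous n := ⟨n, fun x hx => by
    obtain ⟨x, rfl⟩ := R.toDGAlg.quotMk_surjective _ x
    have hx := (mem_pow _).1 hx
    refine R.mem_pow.2 fun i hi => ?_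
    change R.coeff i (wt P hP 0 x) = 0
    rw [← rangeInc_rangeProj_coeff]
    exact (congrArg (rangeInc P hP) (hx i hi)).trans (map_zero _)⟩

theorem toWeightZero_comp_ofWeightZero :
    (toWeightZero P hP hd hPP).comp (ofWeightZero P hP hd hPP) = Mor.id _ := by
  ext x
  obtain ⟨x, rfl⟩ := R.toDGAlg.quotMk_surjective _ x
  refine DGAlg.quotMk_eq.2 ((mem_weightIdeal P hP hd).2 ?_)
  change wt P hP 0 (wt P hP 0 x - x) = 0
  rw [map_sub, wt_wt P hP hPP, if_pos rfl, sub_self]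

/-- Modulo `R²` every element is a generator, and there the linear part of the induced differential
is `P` applied to that of `d`. -/
theorem isMinimal_weightZero (h : ∀ v, P (R.V.symFst (R.coeff 1 (R.d (R.gen v)))) = 0) :
    (weightZero P hP hd hPP).IsMinimal := by
  intro r
  obtain ⟨r, rfl⟩ := R.toDGAlg.quotMk_surjective _ r
  rw [mem_pow_two]
  change rangeProj P hP (R.coeff 1 (R.d r)) = 0
  obtain ⟨v, hv⟩ := R.exists_gen_sub_mem r
  have h1 := mem_pow_two.1 ((R.pow 2).d_mem _ hv)
  rw [map_sub, map_sub, sub_eq_zero] at h1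
  rw [h1]
  clear hv h1
  induction v using R.V.homog_induction with
  | mem k v hv =>
    rw [← ι_symFst (R.coeff_mem 1 (R.d_mem (gen_mem hv))), rangeProj_ι,
      show toRange P hP (R.V.symFst (R.coeff 1 (R.d (R.gen v)))) = 0 from
        rangeSubtype_injective P hP ((h v).trans (map_zero (rangeSubtype P hP)).symm), map_zero]
  | zero => simp only [map_zero]
  | add v w hv hw => simp only [map_add, hv, hw, add_zero]

/-- If the weight operator is the commutator of the differential with an antiderivation, then the
algebra is prohomotopy equivalent to its weight zero part. -/
theorem exists_isMinimal_of_weight [CharZero K] (hPP : ∀ v, P (P v) = P v)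
    (h : R.carrier →ₗ[K] R.carrier) (h_gr : ∀ k, ∀ r ∈ R.gr k, h r ∈ R.gr (k - 1))
    (h_pow : ∀ n, ∀ r ∈ (R.pow n).sub, h r ∈ (R.pow n).sub)
    (h_mul : ∀ r s, h (r * s) = h r * s + R.toDGAlg.sgn r * h s) (h_h : ∀ r, h (h r) = 0)
    (h_d : ∀ r, R.d (h r) + h (R.d r) = wtSum P hP (fun j => (j : K)) r)
    (h_gen : ∀ v, h (R.gen (P v)) = 0)
    (hmin : ∀ v, P (R.V.symFst (R.coeff 1 (R.d (R.gen v)))) = 0) :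
    ∃ S : CompleteQuasismooth K, S.IsMinimal ∧ R.ProhomotopyEquivalent S := by
  -- As `d² = 0`, the commutator `dh + hd` commutes with `d`; it is the weight operator, so `d`
  -- preserves weights. The same holds for `h` by `h² = 0`.
  have hd : ∀ j r, wt P hP j (R.d r) = R.d (wt P hP j r) := by
    refine wt_comm P hP hPP (fun n => (R.pow n).d_mem) fun r => ?_
    rw [← h_d, ← h_d, R.d_d, map_zero, add_zero, map_add, R.d_d, zero_add]
  have hh : ∀ j r, wt P hP j (h r) = h (wt P hP j r) := by
    refine wt_comm P hP hPP h_pow fun r => ?_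
    rw [← h_d, ← h_d, h_h, map_zero, zero_add, map_add, h_h, add_zero]
  -- Weight zero elements are series in generators from `im P`, which the antiderivation `h` kills.
  have h_zero : ∀ r, h (wt P hP 0 r) = 0 := by
    refine eq_zero_of_gen (D := h ∘ₗ wt P hP 0) (fun n r hr => h_pow _ _ (wt_mem_pow P hP 0 hr))
      (fun v => ?_) (fun i v hv b => ?_)
    · rw [LinearMap.comp_apply, wt_zero_gen, h_gen]
    · exact ⟨R.toDGAlg.sgn (R.gen (P v)), by
        rw [LinearMap.comp_apply, LinearMap.comp_apply, wt_zero_mul, h_mul, wt_zero_gen, h_gen,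
          zero_mul, zero_add]⟩
  refine ⟨weightZero P hP (hd 0) hPP, isMinimal_weightZero P hP (hd 0) hPP hmin,
    toWeightZero P hP (hd 0) hPP, ofWeightZero P hP (hd 0) hPP, fun n => ?_, fun n => ?_⟩
  · obtain ⟨H, hH, h0, h1⟩ := exists_weight_homotopy n (wt P hP) h
      (fun j k r => wt_mem P hP j) (fun j n r => wt_mem_pow P hP j) (wt_mem_pow_self P hP)
      (sub_sum_wt_mem P hP n) (wt_mul P hP) hd h_gr h_pow h_mul h_zero
      (fun j r => by rw [h_d, wtSum_wt P hP hPP])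
    refine Relation.EqvGen.rel _ _ ⟨H, ⟨n, hH⟩, ?_, ?_⟩
    · ext x; exact h0 x
    · ext x; exact h1 x
  · rw [toWeightZero_comp_ofWeightZero]
    exact Relation.EqvGen.refl _

end WeightZero

end CompleteQuasismooth

namespace CompleteQuasismooth

open GradedSpace

variable {K : Type u} [Field K]

/-! ### Change of generators -/

/-- An automorphism of the filtered graded algebra underlying `R`. -/
structure Automorphism (R : CompleteQuasismooth K) where
  toLin : R.carrier →ₗ[K] R.carrier
  inv : R.carrier →ₗ[K] R.carrier
  toLin_inv : ∀ x, toLin (inv x) = x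
  inv_toLin : ∀ x, inv (toLin x) = x
  map_mul : ∀ x y, toLin (x * y) = toLin x * toLin y
  map_gr : ∀ k, ∀ x ∈ R.gr k, toLin x ∈ R.gr k
  inv_gr : ∀ k, ∀ x ∈ R.gr k, inv x ∈ R.gr k
  map_pow : ∀ n, ∀ x ∈ (R.pow n).sub, toLin x ∈ (R.pow n).sub
  inv_pow : ∀ n, ∀ x ∈ (R.pow n).sub, inv x ∈ (R.pow n).sub

namespace Automorphism

variable {R : CompleteQuasismooth K} (e : R.Automorphism)

theorem inv_mul (x y : R.carrier) : e.inv (x * y) = e.inv x * e.inv y := by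
  rw [← e.inv_toLin (e.inv x * e.inv y), e.map_mul, e.toLin_inv, e.toLin_inv]

theorem inv_mem_pow_iff {n : ℕ} {x : R.carrier} :
    e.inv x ∈ (R.pow n).sub ↔ x ∈ (R.pow n).sub :=
  ⟨fun h => by rw [← e.toLin_inv x]; exact e.map_pow n _ h, e.inv_pow n x⟩

/-- The same dg-algebra, with the images under an automorphism as generators. -/
abbrev recoord : CompleteQuasismooth K where
  toDGAlg := R.toDGAlg
  V := R.V
  coeff n := R.coeff n ∘ₗ e.inv
  coeff_zero := by rw [R.coeff_zero, LinearMap.zero_comp]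
  coeff_mem i _ _ hr := R.coeff_mem i (e.inv_gr _ _ hr)
  coeff_mul n r s := by
    simp only [LinearMap.comp_apply, e.inv_mul, R.coeff_mul]
  existsUnique_coeff k s hs0 hs := by
    obtain ⟨r, ⟨hr, h⟩, huniq⟩ := R.existsUnique_coeff k s hs0 hs
    refine ⟨e.toLin r, ⟨e.map_gr k r hr, fun i => ?_⟩, ?_⟩
    · rw [LinearMap.comp_apply, e.inv_toLin, h]
    · rintro r' ⟨hr', h'⟩
      rw [← huniq (e.inv r') ⟨e.inv_gr k r' hr', h'⟩, e.toLin_inv]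
  coeff_d n r hr := by
    have hr' : r ∈ (R.pow n).sub := e.inv_mem_pow_iff.1 (R.mem_pow.2 hr)
    exact R.mem_pow.1 (e.inv_mem_pow_iff.2 ((R.pow n).d_mem r hr'))

theorem recoord_mem_pow_iff {n : ℕ} {x : R.carrier} :
    x ∈ (e.recoord.pow n).sub ↔ x ∈ (R.pow n).sub := by
  rw [← e.inv_mem_pow_iff, R.mem_pow]
  exact e.recoord.mem_pow

/-- The automorphism preserves the filtration, so new generators give the same truncations `R/Rⁿ`.
This is what transports prohomotopies. -/
theorem recoord_pow (n : ℕ) : e.recoord.pow n = R.pow n := by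
  have h : (e.recoord.pow n).sub = (R.pow n).sub := by
    ext x; exact e.recoord_mem_pow_iff
  cases h' : e.recoord.pow n
  cases h'' : R.pow n
  rw [h', h''] at h
  cases h
  rfl

theorem recoord_gen (v : R.V.carrier) : e.recoord.gen v = e.toLin (R.gen v) := by
  refine e.recoord.ext_coeff fun n => (e.recoord.coeff_gen n v).trans ?_
  rw [LinearMap.comp_apply, e.inv_toLin, coeff_gen]

theorem prohomotopyEquivalent_of_recoord {S : CompleteQuasismooth K}
    (h : e.recoord.ProhomotopyEquivalent S) : R.ProhomotopyEquivalent S := by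
  obtain ⟨f, g, hgf, hfg⟩ := h
  refine ⟨⟨f.toHom, fun n => ?_⟩, ⟨g.toHom, fun n => ?_⟩, fun n => ?_, hfg⟩
  · obtain ⟨m, hm⟩ := f.continuous n
    exact ⟨m, fun x hx => hm x (e.recoord_mem_pow_iff.2 hx)⟩
  · obtain ⟨m, hm⟩ := g.continuous n
    exact ⟨m, fun x hx => e.recoord_mem_pow_iff.1 (hm x hx)⟩
  · have key : ∀ I : R.toDGAlg.DGIdeal, I = R.pow n →
        e.recoord.HomotopyEquivalent ((R.toDGAlg.quotHom I).comp (g.toHom.comp f.toHom))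
          ((R.toDGAlg.quotHom I).comp (DGAlg.Hom.id R.toDGAlg)) →
        R.HomotopyEquivalent ((R.toDGAlg.quotHom (R.pow n)).comp (g.toHom.comp f.toHom))
          ((R.toDGAlg.quotHom (R.pow n)).comp (DGAlg.Hom.id R.toDGAlg)) := by
      rintro _ rfl h
      refine Relation.EqvGen.mono (fun a b => ?_) _ _ h
      rintro ⟨H, ⟨m, hm⟩, hH⟩
      exact ⟨H, ⟨m, fun x hx => hm x (e.recoord_mem_pow_iff.2 hx)⟩, hH⟩
    exact key _ (e.recoord_pow n) (hgf n)

end Automorphism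

/-! ### Endomorphisms prescribed on generators -/

section Extension

variable {R : CompleteQuasismooth K}

variable (R) in
/-- The power series with the coefficients of an element. -/
def series : R.carrier →ₗ[K] PowerSeries R.V.Sym where
  toFun r := PowerSeries.mk fun n => R.coeff n r
  map_add' r s := by ext n; simp
  map_smul' c r := by ext n; simp

theorem coeff_series (n : ℕ) (r : R.carrier) :
    PowerSeries.coeff n (R.series r) = R.coeff n r :=
  PowerSeries.coeff_mk n fun n => R.coeff n r

theorem series_mul (r s : R.carrier) : R.series (r * s) = R.series r * R.series s := by
  ext n
  rw [PowerSeries.coeff_mul]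
  simp only [coeff_series, R.coeff_mul]

variable (u : R.V.carrier →ₗ[K] R.carrier) (hu : ∀ k, ∀ v ∈ R.V.gr k, u v ∈ R.gr k)

/-- The algebra map from the graded symmetric algebra to power series given by the values on
generators. -/
def symSeries : R.V.Sym →ₐ[K] PowerSeries R.V.Sym :=
  R.V.symLift (R.series ∘ₗ u) fun i j v w hv hw => by
    rw [LinearMap.comp_apply, LinearMap.comp_apply, ← series_mul, ← series_mul,
      R.comm (hu i v hv) (hu j w hw), Units.smul_def, Units.smul_def, map_zsmul]

/-- The coefficients of `symSeries`. -/
def symCoeff (m : ℕ) : R.V.Sym →ₗ[K] R.V.Sym where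
  toFun x := PowerSeries.coeff m (symSeries u hu x)
  map_add' x y := by simp
  map_smul' c x := by
    rw [map_smul]
    rfl

theorem symCoeff_mul (m : ℕ) (x y : R.V.Sym) : symCoeff u hu m (x * y) =
    ∑ p ∈ Finset.HasAntidiagonal.antidiagonal m, symCoeff u hu p.1 x * symCoeff u hu p.2 y := by
  change PowerSeries.coeff m (symSeries u hu (x * y)) = _
  rw [map_mul, PowerSeries.coeff_mul]
  rfl

theorem symCoeff_one (m : ℕ) : symCoeff u hu m 1 = if m = 0 then 1 else 0 := by
  change PowerSeries.coeff m (symSeries u hu 1) = _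
  rw [map_one, PowerSeries.coeff_one]

theorem symCoeff_ι (m : ℕ) (v : R.V.carrier) :
    symCoeff u hu m (R.V.symι v) = R.coeff m (u v) := by
  change PowerSeries.coeff m (symSeries u hu (R.V.symι v)) = _
  rw [symSeries, symLift_ι, LinearMap.comp_apply, coeff_series]

theorem symCoeff_mem (m : ℕ) {n : ℕ} {k : ℤ} {x : R.V.Sym} (hx : x ∈ R.V.symPiece n k) :
    symCoeff u hu m x ∈ R.V.symPiece m k := by
  revert m
  refine symPiece_induction (P := fun n k x => ∀ m, symCoeff u hu m x ∈ R.V.symPiece m k)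
    ?_ ?_ ?_ ?_ ?_ hx
  · intro n k m
    rw [map_zero]; exact Submodule.zero_mem _
  · intro n k x y hx hy m
    rw [map_add]; exact Submodule.add_mem _ (hx m) (hy m)
  · intro n k c x hx m
    rw [map_smul]; exact Submodule.smul_mem _ c (hx m)
  · intro m
    rw [symCoeff_one]
    split_ifs with h
    · rw [h]; exact R.V.one_mem_symPiece
    · exact Submodule.zero_mem _
  · intro n i k v x hv _ hx m
    rw [symCoeff_mul]
    refine Submodule.sum_mem _ fun p hp => ?_
    rw [← Finset.HasAntidiagonal.mem_antidiagonal.1 hp, symCoeff_ι]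
    exact mul_mem_symPiece (R.coeff_mem _ (hu i v hv)) (hx _)

/-- The values `u v` have no constant term, so a product of `n` of them starts in order `n`. Hence
each coefficient of the extension is a finite sum. -/
theorem symCoeff_eq_zero {m n : ℕ} {k : ℤ} {x : R.V.Sym} (hx : x ∈ R.V.symPiece n k)
    (hm : m < n) : symCoeff u hu m x = 0 := by
  revert m
  refine symPiece_induction (P := fun n k x => ∀ {m}, m < n → symCoeff u hu m x = 0)
    ?_ ?_ ?_ ?_ ?_ hx
  · intro n k m _
    rw [map_zero]
  · intro n k x y hx hy m hm
    rw [map_add, hx hm, hy hm, add_zero]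
  · intro n k c x hx m hm
    rw [map_smul, hx hm, smul_zero]
  · intro m hm
    omega
  · intro n i k v x hv _ hx m hm
    rw [symCoeff_mul]
    refine Finset.sum_eq_zero fun p hp => ?_
    rw [Finset.HasAntidiagonal.mem_antidiagonal] at hp
    rw [symCoeff_ι]
    rcases Nat.eq_zero_or_pos p.1 with h | h
    · rw [h, coeff_zero_apply, zero_mul]
    · rw [hx (by omega), mul_zero]

theorem symCoeff_coeff_eq_zero {m n : ℕ} (hm : m < n) (r : R.carrier) :
    symCoeff u hu m (R.coeff n r) = 0 :=
  linearMap_coeff_ext (T' := 0) (fun _ _ hx => symCoeff_eq_zero u hu hx hm) r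

end Extension

variable {R : CompleteQuasismooth K}

/-- A linear map of degree `0` on generators extends to an algebra endomorphism. -/
theorem exists_extension (u : R.V.carrier →ₗ[K] R.carrier)
    (hu : ∀ k, ∀ v ∈ R.V.gr k, u v ∈ R.gr k) : ∃ φ : R.carrier →ₗ[K] R.carrier,
    (∀ x y, φ (x * y) = φ x * φ y) ∧ (∀ k, ∀ x ∈ R.gr k, φ x ∈ R.gr k) ∧
      (∀ n, ∀ x ∈ (R.pow n).sub, φ x ∈ (R.pow n).sub) ∧ ∀ v, φ (R.gen v) = u v := by
  obtain ⟨φ, hφ, hgr⟩ := exists_linearMap_of_coeff (V := R.toDGAlg.toGradedSpace) R 0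
    (fun m => ∑ i ∈ Finset.range (m + 1), symCoeff u hu m ∘ₗ R.coeff i)
    (by
      ext x
      simp [coeff_zero_apply])
    (fun n k r hr => by
      rw [LinearMap.sum_apply, add_zero]
      exact Submodule.sum_mem _ fun i _ => symCoeff_mem u hu n (R.coeff_mem i hr))
  -- Any longer range gives the same sum. This lets the factors of a product share one range.
  have hφ' : ∀ N m r, m < N → R.coeff m (φ r) =
      ∑ i ∈ Finset.range N, symCoeff u hu m (R.coeff i r) := by
    intro N m r hN
    rw [hφ, LinearMap.sum_apply]
    refine Finset.sum_subset (fun i hi => ?_) fun i _ hi => ?_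
    · rw [Finset.mem_range] at hi ⊢; omega
    · rw [Finset.mem_range] at hi
      exact symCoeff_coeff_eq_zero u hu (by omega) r
  refine ⟨φ, fun r s => ?_, fun k x hx => by simpa using hgr k x hx, fun n x hx => ?_,
    fun v => ?_⟩
  · refine R.ext_coeff fun m => ?_
    have e : ∀ p ∈ Finset.HasAntidiagonal.antidiagonal m,
        R.coeff p.1 (φ r) * R.coeff p.2 (φ s) =
          ∑ i ∈ Finset.range (m + 1), ∑ j ∈ Finset.range (m + 1),
            symCoeff u hu p.1 (R.coeff i r) * symCoeff u hu p.2 (R.coeff j s) := by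
      intro p hp
      rw [Finset.HasAntidiagonal.mem_antidiagonal] at hp
      rw [hφ' (m + 1) _ _ (by omega), hφ' (m + 1) _ _ (by omega), Finset.sum_mul_sum]
    rw [hφ' (m + 1) m _ m.lt_succ_self, R.coeff_mul, Finset.sum_congr rfl e]
    simp only [R.coeff_mul, map_sum]
    rw [sum_range_antidiagonal (m + 1)
      fun i j => symCoeff u hu m (R.coeff i r * R.coeff j s)]
    · simp only [symCoeff_mul]
      rw [Finset.sum_comm (s := Finset.HasAntidiagonal.antidiagonal m)]
      refine Finset.sum_congr rfl fun i _ => ?_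
      rw [Finset.sum_comm]
    · intro i j hij
      rw [symCoeff_mul]
      refine Finset.sum_eq_zero fun p hp => ?_
      rw [Finset.HasAntidiagonal.mem_antidiagonal] at hp
      by_cases h : p.1 < i
      · rw [symCoeff_coeff_eq_zero u hu h, zero_mul]
      · rw [symCoeff_coeff_eq_zero u hu (m := p.2) (by omega), mul_zero]
  · rw [mem_pow] at hx ⊢
    intro i hi
    rw [hφ' (i + 1) i x i.lt_succ_self]
    refine Finset.sum_eq_zero fun j hj => ?_
    rw [Finset.mem_range] at hj
    rw [hx j (by omega), map_zero]
  · refine R.ext_coeff fun m => ?_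
    rw [hφ' (m + 2) m _ (by omega), Finset.sum_eq_single 1]
    · rw [coeff_one_gen, symCoeff_ι]
    · intro i _ hi
      rw [coeff_gen, if_neg hi, map_zero]
    · intro h
      exact absurd (Finset.mem_range.2 (by omega)) h

/-- The extension is the identity modulo `R²`, hence unipotent and invertible. Its inverse also
fixes linear parts, so the linear part of `d` survives the change of generators. -/
theorem exists_automorphism (u : R.V.carrier →ₗ[K] R.carrier)
    (hu : ∀ k, ∀ v ∈ R.V.gr k, u v ∈ R.gr k) (hu1 : ∀ v, R.coeff 1 (u v) = R.V.symι v) :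
    ∃ e : R.Automorphism, (∀ v, e.toLin (R.gen v) = u v) ∧
      ∀ x, R.coeff 1 (e.inv x) = R.coeff 1 x := by
  obtain ⟨φ, hmul, hgr, hpow, hgen⟩ := exists_extension u hu
  have h2 : ∀ x, φ x - x ∈ (R.pow 2).sub := by
    intro x
    obtain ⟨v, hv⟩ := R.exists_gen_sub_mem x
    have e : φ x - x = φ (x - R.gen v) - (x - R.gen v) + (u v - R.gen v) := by
      rw [map_sub, hgen]; abel
    rw [e]
    refine Submodule.add_mem _ (Submodule.sub_mem _ (hpow _ _ hv) hv) ?_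
    rw [mem_pow_two, map_sub, hu1, coeff_one_gen, sub_self]
  obtain ⟨ψ, h3, h4, h5, h6⟩ := exists_inverse hgr
    (hom_sub_mem_pow_succ hmul (fun n => ⟨n, hpow n⟩) h2)
  refine ⟨⟨φ, ψ, h3, h4, hmul, hgr, h5, hpow, h6⟩, hgen, fun x => ?_⟩
  have := mem_pow_two.1 (h2 (ψ x))
  rw [h3, map_sub, sub_eq_zero] at this
  exact this.symm



end CompleteQuasismooth

/-! ### Contraction of a differential onto its cohomology -/

namespace GradedSpace

variable {K : Type u} [Field K]

/-- A differential on a graded vector space has a contraction onto its cohomology. -/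
theorem exists_contraction (V : GradedSpace K) (δ : V.carrier →ₗ[K] V.carrier)
    (hδ : ∀ k, ∀ v ∈ V.gr k, δ v ∈ V.gr (k + 1)) (hδδ : ∀ v, δ (δ v) = 0) :
    ∃ η : V.carrier →ₗ[K] V.carrier, (∀ k, ∀ v ∈ V.gr k, η v ∈ V.gr (k - 1)) ∧
      (∀ v, η (η v) = 0) ∧ (∀ v, δ (η (δ v)) = δ v) ∧ ∀ v, η (δ (η v)) = η v := by
  -- A projection onto the boundaries in each degree; `η` lifts it through `δ`, so that `δηδ = δ`.
  have hproj : ∀ k, ∃ q : V.carrier →ₗ[K] V.carrier,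
      (∀ v, q v ∈ (V.gr (k - 1)).map δ) ∧ ∀ v ∈ (V.gr (k - 1)).map δ, q v = v := by
    intro k
    obtain ⟨p, hp⟩ := ((V.gr (k - 1)).map δ).subtype.exists_leftInverse_of_injective
      (Submodule.ker_subtype _)
    exact ⟨((V.gr (k - 1)).map δ).subtype ∘ₗ p, fun v => (p v).2,
      fun v hv => congrArg Subtype.val (LinearMap.congr_fun hp ⟨v, hv⟩)⟩
  choose q hq hq' using hproj
  obtain ⟨η, hη⟩ := V.exists_linearMap_of_rel (M := V.carrier) (fun k =>
    { carrier := {x | x.2 ∈ V.gr (k - 1) ∧ δ x.2 = q k x.1}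
      zero_mem' := ⟨Submodule.zero_mem _, by simp⟩
      add_mem' := fun {x y} hx hy => ⟨Submodule.add_mem _ hx.1 hy.1, by simp [hx.2, hy.2]⟩
      smul_mem' := fun c x hx => ⟨Submodule.smul_mem _ c hx.1, by simp [hx.2]⟩ })
    (fun k v _ => hq k v)
  have hη1 : ∀ k, ∀ v ∈ V.gr k, η v ∈ V.gr (k - 1) := fun k v hv => (hη k v hv).1
  have h1 : ∀ v, δ (η (δ v)) = δ v := by
    intro v
    induction v using V.homog_induction with
    | mem k v hv =>
      rw [(hη _ _ (hδ k v hv)).2]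
      exact hq' _ _ ⟨v, by rwa [add_sub_cancel_right], rfl⟩
    | zero => simp only [map_zero]
    | add v w hv hw => simp only [map_add, hv, hw]
  have hη2 : ∀ k, ∀ v ∈ V.gr k, η (δ (η v)) ∈ V.gr (k - 1) := fun k v hv => by
    have := hη1 _ _ (hδ _ _ (hη1 k v hv))
    rwa [sub_add_cancel] at this
  -- Passing to `θ = ηδη` gives `θδθ = θ` while keeping `δθδ = δ`.
  obtain ⟨θ, hθ⟩ : ∃ θ : V.carrier →ₗ[K] V.carrier, ∀ v, θ v = η (δ (η v)) :=
    ⟨η ∘ₗ δ ∘ₗ η, fun v => rfl⟩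
  have hθ1 : ∀ v, δ (θ (δ v)) = δ v := fun v => by rw [hθ, h1, h1]
  have hθ2 : ∀ v, θ (δ (θ v)) = θ v := fun v => by simp only [hθ, h1]
  have hθ3 : ∀ k, ∀ v ∈ V.gr k, θ v ∈ V.gr (k - 1) := fun k v hv => by rw [hθ]; exact hη2 k v hv
  -- The correction `θ - θθδ` has square zero, by `θδθ = θ`, and retains both other identities, by
  -- `δ² = 0`.
  refine ⟨θ - θ ∘ₗ θ ∘ₗ δ, fun k v hv => ?_, fun v => ?_, fun v => ?_, fun v => ?_⟩
  · have h := hθ3 _ _ (hθ3 _ _ (hδ k v hv))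
    rw [add_sub_cancel_right] at h
    exact Submodule.sub_mem _ (hθ3 k v hv) h
  · simp only [LinearMap.sub_apply, LinearMap.comp_apply, map_sub, hθ2, sub_self]
  · simp only [LinearMap.sub_apply, LinearMap.comp_apply, hδδ, map_zero, sub_zero, hθ1]
  · simp only [LinearMap.sub_apply, LinearMap.comp_apply, map_sub, hδδ, map_zero, sub_zero, hθ2]

end GradedSpace

namespace CompleteQuasismooth

open GradedSpace

variable {K : Type u} [Field K]

/-! ### The linear part of the differential -/

/-- The linear part of the differential. -/
def linD (R : CompleteQuasismooth K) : R.V.carrier →ₗ[K] R.V.carrier :=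
  R.V.symFst ∘ₗ R.coeff 1 ∘ₗ R.d ∘ₗ R.gen

variable {R : CompleteQuasismooth K}

theorem linD_mem (k : ℤ) (v : R.V.carrier) (hv : v ∈ R.V.gr k) : R.linD v ∈ R.V.gr (k + 1) :=
  symFst_mem (R.coeff_mem 1 (R.d_mem (gen_mem hv)))

theorem coeff_one_d_gen (v : R.V.carrier) : R.coeff 1 (R.d (R.gen v)) = R.V.symι (R.linD v) := by
  induction v using R.V.homog_induction with
  | mem k v hv => exact (ι_symFst (R.coeff_mem 1 (R.d_mem (gen_mem hv)))).symm
  | zero => simp only [map_zero]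
  | add v w hv hw => simp only [map_add, hv, hw]

theorem coeff_one_d {x : R.carrier} {v : R.V.carrier} (h : R.coeff 1 x = R.V.symι v) :
    R.coeff 1 (R.d x) = R.V.symι (R.linD v) := by
  have h1 : x - R.gen v ∈ (R.pow 2).sub := by
    rw [mem_pow_two, map_sub, h, coeff_one_gen, sub_self]
  have h2 := mem_pow_two.1 ((R.pow 2).d_mem _ h1)
  rw [map_sub, map_sub, sub_eq_zero] at h2
  rw [h2, coeff_one_d_gen]

theorem linD_linD (v : R.V.carrier) : R.linD (R.linD v) = 0 := by
  rw [← R.V.symFst_ι (R.linD (R.linD v)), ← coeff_one_d (coeff_one_d_gen v), R.d_d, map_zero,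
    map_zero]

/-- `d` preserves `R²`, so its linear part depends on generators only modulo `R²`, where nothing has
changed. -/
theorem Automorphism.recoord_linD (e : R.Automorphism)
    (he : ∀ x, R.coeff 1 (e.inv x) = R.coeff 1 x) (v : R.V.carrier) :
    e.recoord.linD v = R.linD v := by
  have h : R.coeff 1 (e.toLin (R.gen v)) = R.V.symι v := by
    rw [← he, e.inv_toLin, coeff_one_gen]
  change R.V.symFst (R.coeff 1 (e.inv (R.d (e.recoord.gen v)))) = _
  rw [he, e.recoord_gen, coeff_one_d h, symFst_ι]

/-! ### Minimal models -/

/-- The commutator of the differential with an antiderivation is a derivation. -/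
theorem commutator_mul {h : R.carrier →ₗ[K] R.carrier}
    (h_gr : ∀ k, ∀ r ∈ R.gr k, h r ∈ R.gr (k - 1))
    (h_mul : ∀ r s, h (r * s) = h r * s + R.toDGAlg.sgn r * h s) (r s : R.carrier) :
    R.d (h (r * s)) + h (R.d (r * s)) =
      (R.d (h r) + h (R.d r)) * s + r * (R.d (h s) + h (R.d s)) := by
  have h_sgn : ∀ r, h (R.toDGAlg.sgn r) = -R.toDGAlg.sgn (h r) := by
    intro r
    induction r using R.toDGAlg.homog_induction with
    | mem k r hr =>
      rw [R.toDGAlg.sgn_of_mem hr, R.toDGAlg.sgn_of_mem (h_gr k r hr), Int.negOnePow_sub,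
        Int.negOnePow_one, mul_neg, mul_one, Units.smul_def, Units.smul_def, map_zsmul,
        Units.val_neg, neg_smul, neg_neg]
    | zero => simp only [map_zero, neg_zero]
    | add r s hr hs => simp only [map_add, hr, hs, neg_add]
  rw [h_mul, map_add, R.toDGAlg.leibniz_sgn, R.toDGAlg.leibniz_sgn, R.toDGAlg.leibniz_sgn,
    map_add, h_mul, h_mul, R.toDGAlg.d_sgn, h_sgn, R.toDGAlg.sgn_sgn]
  simp only [add_mul, mul_add, neg_mul]
  abel

/-- If the linear part of the differential is strictly contractible off its cohomology, then there
is a minimal model. -/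
theorem exists_isMinimal_of_gen [CharZero K] {η : R.V.carrier →ₗ[K] R.V.carrier}
    (hη : ∀ k, ∀ v ∈ R.V.gr k, η v ∈ R.V.gr (k - 1)) (hηη : ∀ v, η (η v) = 0)
    (hδηδ : ∀ v, R.linD (η (R.linD v)) = R.linD v) (hηδη : ∀ v, η (R.linD (η v)) = η v)
    (hgen : ∀ v, R.d (R.gen (η (R.linD v))) = R.gen (R.linD v)) :
    ∃ S : CompleteQuasismooth K, S.IsMinimal ∧ R.ProhomotopyEquivalent S := by
  -- Hodge-type splitting of `V`: `Q` projects onto the contractible part and `P = 1 - Q` onto a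
  -- copy of the cohomology of `δ`.
  obtain ⟨Q, hQ⟩ : ∃ Q : R.V.carrier →ₗ[K] R.V.carrier,
      ∀ v, Q v = R.linD (η v) + η (R.linD v) := ⟨R.linD ∘ₗ η + η ∘ₗ R.linD, fun v => rfl⟩
  obtain ⟨P, hPQ⟩ : ∃ P : R.V.carrier →ₗ[K] R.V.carrier, ∀ v, P v = v - Q v :=
    ⟨LinearMap.id - Q, fun v => rfl⟩
  have hQgr : ∀ k, ∀ v ∈ R.V.gr k, Q v ∈ R.V.gr k := by
    intro k v hv
    rw [hQ]
    have h1 := linD_mem _ _ (hη k v hv)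
    have h2 := hη _ _ (linD_mem k v hv)
    rw [sub_add_cancel] at h1
    rw [add_sub_cancel_right] at h2
    exact Submodule.add_mem _ h1 h2
  have hP : ∀ k, ∀ v ∈ R.V.gr k, P v ∈ R.V.gr k := fun k v hv => by
    rw [hPQ]; exact Submodule.sub_mem _ hv (hQgr k v hv)
  have hPη : ∀ v, P (η v) = 0 := fun v => by
    rw [hPQ, hQ, hηη, map_zero, zero_add, hηδη, sub_self]
  have hηP : ∀ v, η (P v) = 0 := fun v => by
    rw [hPQ, hQ, map_sub, map_add, hηη, add_zero, hηδη, sub_self]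
  have hPδ : ∀ v, P (R.linD v) = 0 := fun v => by
    rw [hPQ, hQ, linD_linD, map_zero, add_zero, hδηδ, sub_self]
  have hδP : ∀ v, R.linD (P v) = 0 := fun v => by
    rw [hPQ, hQ, map_sub, map_add, linD_linD, zero_add, hδηδ, sub_self]
  have hQP : ∀ v, Q (P v) = 0 := fun v => by
    rw [hQ, hηP, hδP, map_zero, map_zero, add_zero]
  have hPP : ∀ v, P (P v) = P v := fun v => by rw [hPQ, hQP, sub_zero]
  have hPQ0 : ∀ v, P (Q v) = 0 := fun v => by
    rw [hQ, map_add, hPη, hPδ, add_zero]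
  have hQQ : ∀ v, Q (Q v) = Q v := fun v => by
    have := hPQ (Q v)
    rwa [hPQ0, eq_comm, sub_eq_zero, eq_comm] at this
  have hsub : ∀ v, v - P v = Q v := fun v => by rw [hPQ, sub_sub_cancel]
  obtain ⟨h, h_gr, h_pow, h_mul, h_h, h_gen, wt_h, h_wtSum⟩ :=
    exists_homotopyOperator P hP hη hηη hPη hηP
  obtain ⟨L, hL⟩ : ∃ L : R.carrier →ₗ[K] R.carrier, ∀ r, L r = R.d (h r) + h (R.d r) :=
    ⟨R.d ∘ₗ h + h ∘ₗ R.d, fun r => rfl⟩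
  have L_pow : ∀ n, ∀ r ∈ (R.pow n).sub, L r ∈ (R.pow n).sub := fun n r hr => by
    rw [hL]
    exact Submodule.add_mem _ ((R.pow n).d_mem _ (h_pow n r hr))
      (h_pow n _ ((R.pow n).d_mem _ hr))
  have L_mul : ∀ r s, L (r * s) = L r * s + r * L s := fun r s => by
    rw [hL, hL, hL, commutator_mul h_gr h_mul]
  have L_gr : ∀ k, ∀ r ∈ R.gr k, L r ∈ R.gr k := by
    intro k r hr
    rw [hL]
    have h1 := R.d_mem (h_gr k r hr)
    have h2 := h_gr _ _ (R.d_mem hr)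
    rw [sub_add_cancel] at h1
    rw [add_sub_cancel_right] at h2
    exact Submodule.add_mem _ h1 h2
  have h_L : ∀ r, h (L r) = L (h r) := fun r => by
    rw [hL, hL, map_add, h_h, h_h, map_zero, zero_add, add_zero]
  -- On the contractible part `d` and `h` interchange the generators `ηδv` and `δηv` exactly, so
  -- their commutator is the identity there.
  have L_gen : ∀ v, L (R.gen (Q v)) = R.gen (Q v) := by
    intro v
    have h1 : L (R.gen (η (R.linD v))) = R.gen (η (R.linD v)) := by
      rw [hL, h_gen, hηη, map_zero, map_zero, zero_add, hgen, h_gen]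
    have h2 : R.d (R.gen (η v)) = R.gen (R.linD (η v)) := by rw [← hgen, hηδη]
    have h3 : L (R.gen (R.linD (η v))) = R.gen (R.linD (η v)) := by
      rw [hL, h_gen, hηδη, h2, ← h2, R.d_d, map_zero, add_zero]
    rw [hQ, map_add, map_add, h1, h3]
  -- The obstruction: since `h` kills `gen (P v)`, this is `L (gen (P v))`, which should become
  -- zero.
  let z : R.V.carrier → R.carrier := fun v => h (R.d (R.gen (P v)))
  have z_pow : ∀ v, z v ∈ (R.pow 2).sub := fun v => h_pow 2 _ (by
    rw [mem_pow_two, coeff_one_d_gen, hδP, map_zero])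
  obtain ⟨N, hN⟩ : ∃ N, N = wtSum P hP (fun j => (j : K)) := ⟨_, rfl⟩
  obtain ⟨G, hG⟩ : ∃ G, G = wtSum P hP (fun j => (j : K)⁻¹) := ⟨_, rfl⟩
  -- Two derivations which agree on generators modulo `R²`: they coincide on `Q v` and differ by `z`
  -- on `P v`.
  have L_sub_N : ∀ n, ∀ r ∈ (R.pow n).sub, L r - N r ∈ (R.pow (n + 1)).sub := by
    refine derivation_mem_pow_succ (D := L - N) (fun a b => ?_)
      (fun n r hr => ?_) (fun r => ?_)
    · simp only [LinearMap.sub_apply, L_mul, hN, wtSum_natCast_mul, sub_mul, mul_sub]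
      abel
    · rw [LinearMap.sub_apply, hN]
      exact Submodule.sub_mem _ (L_pow n r hr) (wtSum_mem_pow P hP _ hr)
    · obtain ⟨v, hv⟩ := R.exists_gen_sub_mem r
      have e : (L - N) r = (L (r - R.gen v) - N (r - R.gen v)) + z v := by
        have e1 : L (R.gen v) = R.gen (Q v) + z v := by
          have : v = Q v + P v := by rw [hPQ]; abel
          conv_lhs => rw [this, map_add, map_add, L_gen, hL, h_gen, hηP, map_zero, map_zero,
            zero_add]
        rw [LinearMap.sub_apply, map_sub, map_sub, e1, hN, wtSum_natCast_gen, hsub]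
        abel
      rw [e, hN]
      exact Submodule.add_mem _ (Submodule.sub_mem _ (L_pow 2 _ hv) (wtSum_mem_pow P hP _ hv))
        (z_pow v)
  -- `X` contains the obstruction and is stable under `G`; on it `G` is a right inverse of `N`, and
  -- `L = hd` maps it to itself.
  let X : Submodule K R.carrier := LinearMap.ker h ⊓ LinearMap.ker (wt P hP 0)
  have G_X : ∀ x ∈ X, G x ∈ X := by
    rintro x ⟨hx, hx'⟩
    rw [SetLike.mem_coe, LinearMap.mem_ker] at hx hx'
    refine ⟨?_, ?_⟩
    · rw [SetLike.mem_coe, LinearMap.mem_ker, hG, h_wtSum, hx, map_zero]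
    · rw [SetLike.mem_coe, LinearMap.mem_ker, hG, wt_wtSum P hP hPP, hx', smul_zero]
  have L_X : ∀ x ∈ X, L x = h (R.d x) := fun x hx => by
    rw [hL, LinearMap.mem_ker.1 hx.1, map_zero, zero_add]
  have h_X : ∀ x, h x ∈ X := fun x => ⟨h_h x, wt_h x⟩
  have X_closed : ∀ x, (∀ n, ∃ y ∈ X, x - y ∈ (R.pow n).sub) → x ∈ X := by
    intro x hx
    refine ⟨eq_zero_of_mem_pow fun n => ?_, eq_zero_of_mem_pow fun n => ?_⟩
    · obtain ⟨y, hy, hxy⟩ := hx n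
      have := h_pow n _ hxy
      rwa [map_sub, LinearMap.mem_ker.1 hy.1, sub_zero] at this
    · obtain ⟨y, hy, hxy⟩ := hx n
      have := wt_mem_pow P hP 0 hxy
      rwa [map_sub, LinearMap.mem_ker.1 hy.2, sub_zero] at this
  have LG : ∀ n, ∀ x ∈ X, x ∈ (R.pow n).sub → (L ∘ₗ G) x - x ∈ (R.pow (n + 1)).sub := by
    intro n x hx hxn
    have hNG : N (G x) = x := by
      rw [hN, hG]; exact wtSum_wtSum_inv P hP x hx.2 hPP
    have := L_sub_N n (G x) (by rw [hG]; exact wtSum_mem_pow P hP _ hxn)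
    rwa [hNG] at this
  have key : ∀ k, ∀ v ∈ R.V.gr k, ∃ x ∈ R.gr k,
      R.coeff 1 x = R.V.symι (P v) ∧ h x = 0 ∧ h (R.d x) = 0 := by
    intro k v hv
    have hPv := gen_mem (hP k v hv)
    have hzk : z v ∈ R.gr k := by
      have := h_gr _ _ (R.d_mem hPv)
      rwa [add_sub_cancel_right] at this
    have hGgr : ∀ x ∈ R.gr k, G x ∈ R.gr k := fun x hx => by
      rw [hG]; exact wtSum_mem P hP _ hx
    -- `LG` is unipotent on `X`, so `LGw = z v` is solvable. Subtracting `Gw` from the generator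
    -- kills the obstruction, and `h` still vanishes on the result.
    obtain ⟨w, hw, hwk, e⟩ := exists_preimage (T := L ∘ₗ G) X_closed
      (fun k x hx => L_gr k _ (by rw [hG]; exact wtSum_mem P hP _ hx))
      (fun x hx => by
        rw [LinearMap.comp_apply, L_X _ (G_X x hx)]
        exact h_X _)
      (fun n x hx => L_pow n _ (by rw [hG]; exact wtSum_mem_pow P hP _ hx)) LG (h_X _) hzk
    have hw2 : w ∈ (R.pow 2).sub := by
      have := LG 1 w hw (mem_pow_one w)
      rw [e] at this
      rw [← sub_sub_cancel (z v) w]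
      exact Submodule.sub_mem _ (z_pow v) this
    have hGw : h (G w) = 0 := (G_X w hw).1
    refine ⟨R.gen (P v) - G w, Submodule.sub_mem _ hPv (hGgr w hwk), ?_, ?_, ?_⟩
    · rw [map_sub, coeff_one_gen, sub_eq_self, ← mem_pow_two, hG]
      exact wtSum_mem_pow P hP _ hw2
    · rw [map_sub, h_gen, hηP, map_zero, hGw, sub_zero]
    · rw [map_sub, map_sub, ← L_X _ (G_X w hw), sub_eq_zero]
      exact e.symm
  obtain ⟨χ, hχ⟩ := R.V.exists_linearMap_of_rel (M := R.carrier) (fun k =>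
    { carrier := {x | x.2 ∈ R.gr k ∧ R.coeff 1 x.2 = R.V.symι (P x.1) ∧ h x.2 = 0 ∧
        h (R.d x.2) = 0}
      zero_mem' := ⟨Submodule.zero_mem _, by simp⟩
      add_mem' := fun {x y} hx hy => ⟨Submodule.add_mem _ hx.1 hy.1, by
        simp [hx.2, hy.2]⟩
      smul_mem' := fun c x hx => ⟨Submodule.smul_mem _ c hx.1, by simp [hx.2]⟩ }) key
  have hχ1 : ∀ v, R.coeff 1 (χ v) = R.V.symι (P v) ∧ h (χ v) = 0 ∧ h (R.d (χ v)) = 0 := by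
    intro v
    induction v using R.V.homog_induction with
    | mem k v hv => exact (hχ k v hv).2
    | zero => simp
    | add v w hv hw => simp [hv, hw]
  -- The contractible generators are kept; the others are replaced by their corrections, which agree
  -- with them modulo `R²`.
  obtain ⟨e, he, he1⟩ := exists_automorphism (R.gen ∘ₗ Q + χ ∘ₗ P)
    (fun k v hv => Submodule.add_mem _ (gen_mem (hQgr k v hv)) (hχ k _ (hP k v hv)).1)
    (fun v => by
      rw [LinearMap.add_apply, LinearMap.comp_apply, LinearMap.comp_apply, map_add, coeff_one_gen,
        (hχ1 _).1, hPP, ← map_add, hPQ, add_sub_cancel])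
  have he2 : ∀ v, e.recoord.gen v = R.gen (Q v) + χ (P v) := fun v => by
    rw [e.recoord_gen, he]; rfl
  refine (?_ : ∃ S : CompleteQuasismooth K, S.IsMinimal ∧ e.recoord.ProhomotopyEquivalent S).imp
    fun S hS => ⟨hS.1, e.prohomotopyEquivalent_of_recoord hS.2⟩
  -- The operator `h` is the one built from the old generators, whereas the weights refer to the new
  -- ones.
  refine exists_isMinimal_of_weight (R := e.recoord) P hP hPP h h_gr
    (fun n r hr => e.recoord_mem_pow_iff.2 (h_pow n r (e.recoord_mem_pow_iff.1 hr)))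
    h_mul h_h (fun r => ?_) (fun v => ?_) (fun v => ?_)
  · have hgen2 : ∀ v, L (e.recoord.gen v) =
        wtSum (R := e.recoord) P hP (fun j => (j : K)) (e.recoord.gen v) := by
      intro v
      have h1 : L (χ (P v)) = 0 := by
        rw [hL, (hχ1 _).2.1, (hχ1 _).2.2, map_zero, add_zero]
      rw [wtSum_natCast_gen (R := e.recoord), hsub, he2, he2, hQQ, hPQ0, map_zero, add_zero,
        map_add, L_gen, h1, add_zero]
    rw [← sub_eq_zero, ← hL]
    -- `L` and the new weight operator are derivations agreeing on the new generators, so their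
    -- difference vanishes by filtered induction.
    refine eq_zero_of_gen (R := e.recoord)
      (D := L - wtSum (R := e.recoord) P hP (fun j => (j : K))) (fun n r hr => ?_)
      (fun v => ?_) (fun i v _ b => ⟨e.recoord.gen v, ?_⟩) r
    · exact Submodule.sub_mem _
        (e.recoord_mem_pow_iff.2 (L_pow n r (e.recoord_mem_pow_iff.1 hr)))
        (wtSum_mem_pow (R := e.recoord) P hP _ hr)
    · exact sub_eq_zero.2 (hgen2 v)
    · have h2 := wtSum_natCast_mul (R := e.recoord) P hP (e.recoord.gen v) b
      have h3 := L_mul (e.recoord.gen v) b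
      refine (congrArg₂ (· - ·) h3 h2).trans ?_
      rw [hgen2, add_sub_add_left_eq_sub, ← mul_sub]
      rfl
  · rw [he2, hQP, map_zero, zero_add, hPP]
    exact (hχ1 _).2.1
  · have := e.recoord_linD he1 v
    change P (e.recoord.linD v) = 0
    rw [this, hPδ]

/-- Every complete quasismooth algebra has a minimal model. -/
theorem exists_isMinimal [CharZero K] (R : CompleteQuasismooth K) :
    ∃ S : CompleteQuasismooth K, S.IsMinimal ∧ R.ProhomotopyEquivalent S := by
  obtain ⟨η, hη, hηη, hδηδ, hηδη⟩ := R.V.exists_contraction R.linD linD_mem linD_linD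
  obtain ⟨Q, hQ⟩ : ∃ Q : R.V.carrier →ₗ[K] R.V.carrier, ∀ v, Q v = R.linD (η v) :=
    ⟨R.linD ∘ₗ η, fun v => rfl⟩
  have hQgr : ∀ k, ∀ v ∈ R.V.gr k, Q v ∈ R.V.gr k := fun k v hv => by
    have h := linD_mem _ _ (hη k v hv)
    rw [sub_add_cancel] at h
    rwa [hQ]
  have hdη : ∀ k, ∀ v ∈ R.V.gr k, R.d (R.gen (η v)) ∈ R.gr k := fun k v hv => by
    have h := R.d_mem (gen_mem (hη k v hv))
    rwa [sub_add_cancel] at h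
  -- The linear boundary `δηv` is replaced by the true boundary `d (gen (η v))`, whose linear part
  -- it is; hence the change is trivial modulo `R²`.
  obtain ⟨e, he, he1⟩ := exists_automorphism (R.gen ∘ₗ (LinearMap.id - Q) + R.d ∘ₗ R.gen ∘ₗ η)
    (fun k v hv => Submodule.add_mem _ (gen_mem (Submodule.sub_mem _ hv (hQgr k v hv)))
      (hdη k v hv))
    (fun v => by
      simp only [LinearMap.add_apply, LinearMap.comp_apply, LinearMap.sub_apply, LinearMap.id_apply,
        map_add, coeff_one_gen, coeff_one_d_gen]
      rw [← map_add, hQ, sub_add_cancel])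
  have he2 : ∀ v, e.recoord.gen v = R.gen (v - Q v) + R.d (R.gen (η v)) := fun v => by
    rw [e.recoord_gen, he]; rfl
  have hlin := e.recoord_linD he1
  refine (?_ : ∃ S : CompleteQuasismooth K, S.IsMinimal ∧ e.recoord.ProhomotopyEquivalent S).imp
    fun S hS => ⟨hS.1, e.prohomotopyEquivalent_of_recoord hS.2⟩
  refine exists_isMinimal_of_gen (R := e.recoord) hη hηη (fun v => ?_) (fun v => ?_) (fun v => ?_)
  · rw [hlin, hlin, hδηδ]
  · rw [hlin, hηδη]
  -- The new generator at `δv` is `d (gen (ηδv))`, and by `η² = 0` the generator at `ηδv` is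
  -- unchanged.
  · rw [hlin, he2, he2, hQ, hQ, hδηδ, sub_self, map_zero, zero_add, hηη, map_zero, map_zero,
      sub_zero, map_zero, add_zero]

end CompleteQuasismooth

end QuasiSmooth

end

theorem theorem4p2 (K : Type u) [Field K] [CharZero K] :
    (∀ R : QuasiSmooth.CompleteQuasismooth K,
      ∃ S : QuasiSmooth.CompleteQuasismooth K, S.IsMinimal ∧ R.ProhomotopyEquivalent S) ∧
    (∀ R S : QuasiSmooth.CompleteQuasismooth K, R.IsMinimal → S.IsMinimal →
      (R.ProhomotopyEquivalent S ↔ R.Isomorphic S)) :=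
  ⟨fun R => R.exists_isMinimal, fun _ _ hR hS =>
    ⟨fun h => h.isomorphic hR hS, fun h => h.prohomotopyEquivalent⟩⟩
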